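/- Let $V$ be a separable real Hilbert space. Let $-B$ be a symmetric positive operator on $V$ with compact inverse, and let $\lambda_B$ be a lower bound of the eigenvalues of $-B$. Let $g:V\times V\to V$ satisfy, for some $C_1>0$, $$\|g(x_1,y_1)-g(x_2,y_2)\|\le C_1(\|x_1-x_2\|+\|y_1-y_2\|)\qquad(x_1,x_2,y_1,y_2\in V),$$ and assume $\lambda_B>C_1$. Let $H\in(0,1)$, let $Q$ be a symmetric positive operator on $V$ of finite trace, and let $\mathbb P$ be the law, on the Borel sets of the space $C_0(\mathbb R;V)$ of continuous paths vanishing at $0$ with the compact-open topology, of the centred Gaussian process $(\omega(t))_{t\in\mathbb R}$ with covariance $\mathbb E[\omega(t)\otimes\omega(s)]=(|t|^{2H}+|s|^{2H}-|t-s|^{2H})\,Q$ (trace class fractional Brownian motion). Let $0<\gamma<H$, let $\Omega\subset C_0(\mathbb R;V)$ be the set of paths that are $\gamma$-Hölder on every compact interval, equipped with the trace $\sigma$-algebra and the restriction $\mathbb P'$ of $\mathbb P$. For $\varepsilon>0$ put $\theta^\varepsilon_t\omega=\omega(\cdot+t/\varepsilon)-\omega(t/\varepsilon)$. Then $B$ generates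 a strongly continuous semigroup $S_B$ with $\|S_B(t)\|\le e^{-\lambda_Bt}$ for $t\ge0$, and for every $x\in V$ and $\varepsilon>0$ the following holds. $(\Omega,\mathbb P',\theta^\varepsilon)$ is an ergodic metric dynamical system, and the equation $$dY(t)=\tfrac1\varepsilon BY(t)\,dt+\tfrac1\varepsilon g(x,Y(t))\,dt+d\omega(t/\varepsilon),\qquad Y(0)=y,$$ in the mild sense, i.e. $$Y(t)=S_B(\tfrac t\varepsilon)y+\frac1\varepsilon\int_0^tS_B(\tfrac{t-r}\varepsilon)g(x,Y(r))\,dr+\omega(\tfrac t\varepsilon)+\frac1\varepsilon B\int_0^tS_B(\tfrac{t-r}\varepsilon)\,\omega(\tfrac r\varepsilon)\,dr\qquad(t\ge 0),$$ where the last integral lies in the domain of $B$, has for all $\omega\in\Omega$, $y\in V$ a unique continuous solution $t\mapsto\phi(t,\omega,y)$ on $[0,\infty)$. The map $\phi:\mathbb R^+\times\Omega\times V\to V$ is a random dynamical system over $\theta^\varepsilon$: it is measurable, $\phi(0,\omega,\cdot)=\mathrm{id}$ and $\phi(t+\tau,\omega,y)=\phi(t,\theta^\varepsilon_\tau\omega,\phi(\tau,\omega,y))$.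 There are a random variable $Y^\varepsilon_F(\cdot,x):\Omega\to V$ and a measurable $\theta^\varepsilon$-invariant set $\Omega_0\subset\Omega$ of full measure such that, for all $\omega\in\Omega_0$ and with $\rho=(\lambda_B-C_1)/\varepsilon$: 1. (random fixed point) $\phi(t,\omega,Y^\varepsilon_F(\omega,x))=Y^\varepsilon_F(\theta^\varepsilon_t\omega,x)$ for all $t\ge0$; 2. (temperedness) $\lim_{t\to\pm\infty}|t|^{-1}\log^+\|Y^\varepsilon_F(\theta^\varepsilon_t\omega,x)\|=0$; 3. (forward attraction) $\|\phi(t,\omega,y)-Y^\varepsilon_F(\theta^\varepsilon_t\omega,x)\|\le e^{-\rho t}\|y-Y^\varepsilon_F(\omega,x)\|$ for all $y\in V$ and $t\ge0$; 4. (pullback attraction) for every map $y:\Omega\to V$ and $t\ge0$, $\|\phi(t,\theta^\varepsilon_{-t}\omega,y(\theta^\varepsilon_{-t}\omega))-Y^\varepsilon_F(\omega,x)\|\le e^{-\rho t}\|y(\theta^\varepsilon_{-t}\omega)-Y^\varepsilon_F(\theta^\varepsilon_{-t}\omega,x)\|$; and if $\lim_{t\to\pm\infty}|t|^{-1}\log^+\|y(\theta^\varepsilon_t\omega)\|=0$,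 then $\lim_{t\to\infty}e^{\delta t}\|\phi(t,\theta^\varepsilon_{-t}\omega,y(\theta^\varepsilon_{-t}\omega))-Y^\varepsilon_F(\omega,x)\|=0$ for every $\delta<\rho$. -/

import Mathlib

open MeasureTheory ProbabilityTheory Filter Set Topology
open scoped NNReal

noncomputable section

namespace FastRDS

/-! ### The linear operator and its semigroup -/

/-- `L` is a symmetric positive (unbounded) operator on `V` with compact inverse. (Such an operator
is automatically closed and densely defined.) -/
structure IsPositiveSymmetricWithCompactInverse {V : Type*} [NormedAddCommGroup V]
    [InnerProductSpace ℝ V] (L : V →ₗ.[ℝ] V) : Prop where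
  symmetric : ∀ u v : L.domain, inner ℝ (L u) (v : V) = inner ℝ (u : V) (L v)
  positive : ∀ u : L.domain, u ≠ 0 → 0 < inner ℝ (L u) (u : V)
  compact_inverse : ∃ K : V →L[ℝ] V, IsCompactOperator K ∧
    ∀ u w : V, (u, w) ∈ L.graph ↔ u = K w

/-- `μ` is an eigenvalue of the (unbounded) operator `L`. -/
def IsEigenvalue {V : Type*} [NormedAddCommGroup V] [InnerProductSpace ℝ V]
    (L : V →ₗ.[ℝ] V) (μ : ℝ) : Prop :=
  ∃ v : V, v ≠ 0 ∧ (v, μ • v) ∈ L.graph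

/-- `(S t)_{t ≥ 0}` is a strongly continuous semigroup whose infinitesimal generator is `B`
(with the domain of `B` equal to the domain of the generator). Only the values of `S` at
nonnegative times matter, and these are uniquely determined by `B`. -/
structure IsSemigroupGeneratedBy {V : Type*} [NormedAddCommGroup V] [InnerProductSpace ℝ V]
    (S : ℝ → V →L[ℝ] V) (B : V →ₗ.[ℝ] V) : Prop where
  zero : S 0 = ContinuousLinearMap.id ℝ V
  add : ∀ s t : ℝ, 0 ≤ s → 0 ≤ t → S (s + t) = (S s).comp (S t)
  strongly_continuous : ∀ v : V, ContinuousOn (fun t => S t v) (Ici 0)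
  generator : ∀ v w : V, (v, w) ∈ B.graph ↔
    Tendsto (fun t : ℝ => t⁻¹ • (S t v - v)) (𝓝[>] 0) (𝓝 w)

/-! ### Path spaces and fractional Brownian motion -/

/-- The space `C₀(ℝ; V)` of continuous paths which vanish at zero. -/
abbrev C0Path (V : Type*) [NormedAddCommGroup V] : Type _ :=
  {ω : C(ℝ, V) // ω 0 = 0}

/-- The Borel σ-algebra of the compact-open topology on `C₀(ℝ; V)`. -/
instance instMeasurableSpaceC0Path (V : Type*) [NormedAddCommGroup V] :
    MeasurableSpace (C0Path V) := borel _

instance instBorelSpaceC0Path (V : Type*) [NormedAddCommGroup V] : BorelSpace (C0Path V) := ⟨rfl⟩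

/-- Hölder continuity with exponent `γ` on every compact interval. -/
def IsLocallyHolder {V : Type*} [NormedAddCommGroup V] (γ : ℝ≥0) (f : ℝ → V) : Prop :=
  ∀ a b : ℝ, ∃ C : ℝ≥0, HolderOnWith C γ f (Icc a b)

/-- The path space of the canonical process: paths in `C₀(ℝ; V)` that are `γ`-Hölder on every
compact interval, with the trace of the Borel σ-algebra of `C₀(ℝ; V)`. -/
abbrev HolderPath (V : Type*) [NormedAddCommGroup V] (γ : ℝ≥0) : Type _ :=
  {ω : C0Path V // IsLocallyHolder γ (ω.1 : ℝ → V)}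

/-- The Wiener shift `θ_t ω = ω(· + t) - ω(t)` on `C₀(ℝ; V)`. -/
def shiftC0 {V : Type*} [NormedAddCommGroup V] (t : ℝ) (ω : C0Path V) : C0Path V :=
  ⟨⟨fun s => ω.1 (s + t) - ω.1 t, by fun_prop⟩, by simp⟩

theorem isLocallyHolder_shiftC0 {V : Type*} [NormedAddCommGroup V] {γ : ℝ≥0} (t : ℝ)
    (ω : C0Path V) (hω : IsLocallyHolder γ (ω.1 : ℝ → V)) :
    IsLocallyHolder γ ((shiftC0 t ω).1 : ℝ → V) := by
  intro a b
  obtain ⟨C, hC⟩ := hω (a + t) (b + t)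
  refine ⟨C, fun x hx y hy => ?_⟩
  have h := hC (x + t) ⟨by linarith [hx.1], by linarith [hx.2]⟩ (y + t)
    ⟨by linarith [hy.1], by linarith [hy.2]⟩
  simpa [shiftC0] using h

/-- The Wiener shift on the space of Hölder paths. -/
def shift {V : Type*} [NormedAddCommGroup V] {γ : ℝ≥0} (t : ℝ) (ω : HolderPath V γ) :
    HolderPath V γ :=
  ⟨shiftC0 t ω.1, isLocallyHolder_shiftC0 t ω.1 ω.2⟩

/-- `Q` is a symmetric positive operator of finite trace. -/
def IsTraceClassCovariance {V : Type*} [NormedAddCommGroup V] [InnerProductSpace ℝ V]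
    [CompleteSpace V] (Q : V →L[ℝ] V) : Prop :=
  Q.IsPositive ∧ ∃ (s : Set V) (b : HilbertBasis s ℝ V), Summable fun i => inner ℝ (Q (b i)) (b i)

/-- `P` is the law on `C₀(ℝ; V)` of a trace class `V`-valued fractional Brownian motion with
Hurst parameter `H`: the coordinate process is a centred Gaussian process with covariance
`𝔼[ω(t) ⊗ ω(s)] = (|t|^{2H} + |s|^{2H} - |t - s|^{2H}) Q`. -/
structure IsFBMLaw {V : Type*} [NormedAddCommGroup V] [InnerProductSpace ℝ V]
    [CompleteSpace V] [MeasurableSpace V] (H : ℝ) (Q : V →L[ℝ] V) (P : Measure (C0Path V)) :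
    Prop where
  traceClass : IsTraceClassCovariance Q
  gaussian : IsGaussianProcess (fun (t : ℝ) (ω : C0Path V) => ω.1 t) P
  mean : ∀ (t : ℝ) (v : V), ∫ ω : C0Path V, inner ℝ (ω.1 t) v ∂P = 0
  covariance : ∀ (t s : ℝ) (v w : V),
    ∫ ω : C0Path V, inner ℝ (ω.1 t) v * inner ℝ (ω.1 s) w ∂P =
      (|t| ^ (2 * H) + |s| ^ (2 * H) - |t - s| ^ (2 * H)) * inner ℝ (Q v) w

/-! ### Random dynamical systems -/

/-- `(Ω, 𝓕, P, θ)` is an ergodic metric dynamical system. -/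
structure IsErgodicMDS {Ω : Type*} [MeasurableSpace Ω] (P : Measure Ω) (θ : ℝ → Ω → Ω) :
    Prop where
  isProbabilityMeasure : IsProbabilityMeasure P
  measurable : Measurable fun p : ℝ × Ω => θ p.1 p.2
  zero : ∀ ω, θ 0 ω = ω
  add : ∀ s t ω, θ (s + t) ω = θ s (θ t ω)
  measurePreserving : ∀ t, MeasurePreserving (θ t) P P
  ergodic : ∀ A : Set Ω, MeasurableSet A → (∀ t, θ t ⁻¹' A = A) → P A = 0 ∨ P A = 1

/-- `φ : ℝ⁺ × Ω × E → E` is measurable and a cocycle over `θ`. -/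
structure IsRDS {Ω E : Type*} [MeasurableSpace Ω] [MeasurableSpace E] (θ : ℝ → Ω → Ω)
    (φ : ℝ≥0 → Ω → E → E) : Prop where
  measurable : Measurable fun p : ℝ≥0 × Ω × E => φ p.1 p.2.1 p.2.2
  zero : ∀ ω b, φ 0 ω b = b
  cocycle : ∀ (t τ : ℝ≥0) ω b, φ (t + τ) ω b = φ t (θ τ ω) (φ τ ω b)

/-- The growth condition in the definition of a tempered random variable, along the orbit
of `ω`: `log⁺ X(θ_t ω) / |t| → 0` as `t → ±∞`. -/
def TemperedAt {Ω : Type*} (θ : ℝ → Ω → Ω) (X : Ω → ℝ) (ω : Ω) : Prop :=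
  Tendsto (fun t : ℝ => Real.posLog (X (θ t ω)) / |t|) atTop (𝓝 0) ∧
  Tendsto (fun t : ℝ => Real.posLog (X (θ t ω)) / |t|) atBot (𝓝 0)

/-- `Ω₀` is a measurable `θ`-invariant set of full measure. -/
structure IsInvariantFull {Ω : Type*} [MeasurableSpace Ω] (P : Measure Ω) (θ : ℝ → Ω → Ω)
    (Ω₀ : Set Ω) : Prop where
  measurableSet : MeasurableSet Ω₀
  invariant : ∀ t, θ t ⁻¹' Ω₀ = Ω₀
  full : P Ω₀ᶜ = 0

/-- Forward attraction on `Ω₀` with exponential rate `r`: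
`‖φ(t, ω, y) - Y(θ_t ω)‖ ≤ e^{-rt} ‖y - Y(ω)‖` for all `t ≥ 0` and all initial values `y`. -/
def IsForwardAttracting {Ω E : Type*} [NormedAddCommGroup E] (θ : ℝ → Ω → Ω)
    (φ : ℝ≥0 → Ω → E → E) (Y : Ω → E) (Ω₀ : Set Ω) (r : ℝ) : Prop :=
  ∀ ω ∈ Ω₀, ∀ (y : E) (t : ℝ≥0),
    ‖φ t ω y - Y (θ t ω)‖ ≤ Real.exp (-(r * t)) * ‖y - Y ω‖

/-- Pullback attraction on `Ω₀` with exponential rate `r`: for every (random) initial value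
`y(·)`, the distance `‖φ(t, θ_{-t}ω, y(θ_{-t}ω)) - Y(ω)‖` is at most `e^{-rt}` times the initial
distance; and if `‖y‖` is tempered then this distance is `o(e^{-δt})` for every `δ < r`. -/
def IsPullbackAttracting {Ω E : Type*} [NormedAddCommGroup E] (θ : ℝ → Ω → Ω)
    (φ : ℝ≥0 → Ω → E → E) (Y : Ω → E) (Ω₀ : Set Ω) (r : ℝ) : Prop :=
  ∀ y : Ω → E, ∀ ω ∈ Ω₀,
    (∀ t : ℝ≥0, ‖φ t (θ (-t) ω) (y (θ (-t) ω)) - Y ω‖ ≤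
      Real.exp (-(r * t)) * ‖y (θ (-t) ω) - Y (θ (-t) ω)‖) ∧
    (TemperedAt θ (fun ω' => ‖y ω'‖) ω → ∀ δ : ℝ, δ < r →
      Tendsto (fun t : ℝ≥0 => Real.exp (δ * t) * ‖φ t (θ (-t) ω) (y (θ (-t) ω)) - Y ω‖)
        atTop (𝓝 0))

/-! ### The fast equation with frozen slow variable -/

/-- `Y` is a mild solution on `[0, ∞)` of
`dY = ε⁻¹ B Y dt + ε⁻¹ g(x, Y) dt + dω(t/ε)`, `Y(0) = y₀`. Here `S_{B/ε}(t) = S_B(t/ε)`, and the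
stochastic convolution `∫₀ᵗ S_{B/ε}(t - r) dω_ε(r)` of the path `ω_ε(r) = ω(r/ε)` is
`ω_ε(t) + ε⁻¹ B ∫₀ᵗ S_{B/ε}(t - r) ω_ε(r) dr`, the integral being required to lie in the
domain of `B`. -/
structure IsMildSolution {V : Type*} [NormedAddCommGroup V] [InnerProductSpace ℝ V]
    (B : V →ₗ.[ℝ] V) (S : ℝ → V →L[ℝ] V) (g : V → V → V) (x : V) (ε : ℝ) (ω : ℝ → V) (y₀ : V)
    (Y : ℝ → V) : Prop where
  continuousOn : ContinuousOn Y (Ici 0)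
  eq : ∀ t : ℝ, 0 ≤ t → ∃ w : V,
    (∫ r in (0 : ℝ)..t, S ((t - r) / ε) (ω (r / ε)), w) ∈ B.graph ∧
    Y t = S (t / ε) y₀ + ε⁻¹ • (∫ r in (0 : ℝ)..t, S ((t - r) / ε) (g x (Y r)))
      + (ω (t / ε) + ε⁻¹ • w)

/-- `φ` is the solution map of the fast equation: `t ↦ φ(t, ω, y₀)` is the unique mild solution
on `[0, ∞)` starting at `y₀`, for every noise path `ω`. -/
def IsGeneratedByFastEquation {V : Type*} [NormedAddCommGroup V] [InnerProductSpace ℝ V]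
    {γ : ℝ≥0} (B : V →ₗ.[ℝ] V) (S : ℝ → V →L[ℝ] V) (g : V → V → V) (x : V) (ε : ℝ)
    (φ : ℝ≥0 → HolderPath V γ → V → V) : Prop :=
  ∀ (ω : HolderPath V γ) (y₀ : V),
    IsMildSolution B S g x ε ω.1.1 y₀ (fun t => φ t.toNNReal ω y₀) ∧
    ∀ Y : ℝ → V, IsMildSolution B S g x ε ω.1.1 y₀ Y → ∀ t : ℝ≥0, Y t = φ t ω y₀

end FastRDS

end

/-!
The fast equation is a Lipschitz perturbation of a dissipative linear equation, so any two solutions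
with the same noise approach each other at the rate `lamB - C₁`. Its random fixed point is the
limit of the solutions started from `0` at time `-n`.

*Semigroup.* `-B` is diagonal in a Hilbert basis with eigenvalues `≥ lamB` (spectral theorem for
the compact operator `K = (-B)⁻¹`), and `S(t)` is multiplication by `e^{-λ t}`. All that is used
later is collected in `IsSmoothingSemigroup`: the bound `‖S(t)‖ ≤ e^{-lamB t}`, the bound
`‖(-B) S(t)‖ ≤ 1/t`, and relations with the injective operator `K`. Since `K` is injective, mild
equations can be tested after applying `K` (`SolvesInverse`), where only bounded operators occur.

*Flow.* Because `ω` is locally Hölder, the singular integral `B ∫ S(t-r) (ω(r) - ω(t)) dr` converges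
(`exists_stochConv`), so `ω(t) + B ∫ S(t-r) ω(r) dr` exists and is continuous in `t`. Picard
iteration contracts the supremum norm by `C₁ / lamB < 1` on every interval `[0, T]`, uniqueness and
the contraction of the flow follow from Gronwall's inequality, the cocycle property from uniqueness.
The stochastic convolution is measurable in `ω` because its image under the measurable embedding
`K` is. The substitution `t ↦ t / ε` reduces every `ε` to `ε = 1` (`isMildSolution_iff`).

*Fixed point.* On the set of paths whose Hölder constants on `[-n, n]` grow at most quadratically
in `n` (`HasHolderGrowth`), the flow started from `0` has polynomial growth, so the contraction
makes the pullback sequence Cauchy, and its limit grows polynomially along the orbit and is thus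
tempered. This set is invariant under the shift. It has full measure by Kolmogorov's argument: the
law of an increment is that of `|t - s|^H • ω(1)`, which has moments of all orders by Fernique's
theorem, and a high moment beats the number of dyadic intervals, also as `n` grows
(`IsFBMLaw.ae_hasHolderGrowth`).

*Ergodicity.* Laws on `C₀(ℝ; V)` are determined by the characters `exp(i L)` of linear observables
`L = ∑ ⟨ω(tᵢ), vᵢ⟩` (`measure_ext_of_linObs`). The covariance of the increments depends only on the
time difference, which gives invariance under the shift, and tends to `0` as this difference grows.
Hence the centred characters along an orbit are asymptotically orthogonal, an invariant event is
uncorrelated with all of them, and is therefore independent of itself (`IsFBMLaw.ergodic_shiftC0`).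
-/

noncomputable section

namespace FastRDS

section

/-! ### Diagonal operators in a Hilbert basis -/

section Diagonal

variable {V : Type*} [NormedAddCommGroup V] [InnerProductSpace ℝ V] {ι : Type*}

theorem hasSum_sq_repr (b : HilbertBasis ι ℝ V) (v : V) :
    HasSum (fun i => (b.repr v i) ^ 2) (‖v‖ ^ 2) := by
  have h := b.hasSum_inner_mul_inner v v
  rw [real_inner_self_eq_norm_sq] at h
  convert! h using 2 with i
  rw [b.repr_apply_apply, real_inner_comm v, sq]

theorem memlp_mul_of_bounded (b : HilbertBasis ι ℝ V) {f : ι → ℝ} {C : ℝ} (hf : ∀ i, |f i| ≤ C)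
    (v : V) : Memℓp (fun i => f i * b.repr v i) 2 := by
  have h2 : (0 : ℝ) < (2 : ENNReal).toReal := by norm_num
  rw [memℓp_gen_iff h2]
  refine Summable.of_nonneg_of_le (fun i => by positivity) (fun i => ?_)
    ((hasSum_sq_repr b v).summable.mul_left (C ^ 2))
  simp only [ENNReal.toReal_ofNat, Real.rpow_ofNat, norm_mul, mul_pow, Real.norm_eq_abs, sq_abs]
  have := hf i
  rw [← sq_abs (f i)]
  gcongr

/-- The operator which multiplies the `i`-th coordinate in the Hilbert basis `b` by `f i`. It is
only meaningful for bounded `f`, and set to `0` otherwise. -/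
def diagOp (b : HilbertBasis ι ℝ V) (f : ι → ℝ) : V →L[ℝ] V :=
  open Classical in
  if h : ∃ C : ℝ, ∀ i, |f i| ≤ C then
    LinearMap.mkContinuous
      { toFun := fun v => b.repr.symm ⟨fun i => f i * b.repr v i,
          memlp_mul_of_bounded b h.choose_spec v⟩
        map_add' := fun v w => by
          rw [← map_add]
          congr 1
          ext i
          simp only [map_add, lp.coeFn_add, Pi.add_apply, mul_add]
        map_smul' := fun c v => by
          rw [RingHom.id_apply, ← map_smul]
          congr 1
          ext i
          simp [mul_left_comm] }
      |h.choose| (fun v => by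
        rw [LinearMap.coe_mk, AddHom.coe_mk, LinearIsometryEquiv.norm_map]
        refine lp.norm_le_of_tsum_le (by norm_num) (by positivity) ?_
        simp only [ENNReal.toReal_ofNat, Real.rpow_ofNat, norm_mul, mul_pow, Real.norm_eq_abs,
          sq_abs]
        have hs := hasSum_sq_repr b v
        rw [← hs.tsum_eq, ← tsum_mul_left]
        have hle : ∀ i, f i ^ 2 * (b.repr v i) ^ 2 ≤ h.choose ^ 2 * (b.repr v i) ^ 2 := fun i => by
          have := h.choose_spec i
          rw [← sq_abs (f i)]
          gcongr
        exact Summable.tsum_le_tsum hle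
          (Summable.of_nonneg_of_le (fun i => by positivity) hle (hs.summable.mul_left _))
          (hs.summable.mul_left _))
  else 0

theorem repr_diagOp (b : HilbertBasis ι ℝ V) {f : ι → ℝ} {C : ℝ} (hf : ∀ i, |f i| ≤ C) (v : V)
    (i : ι) : b.repr (diagOp b f v) i = f i * b.repr v i := by
  have h : ∃ C : ℝ, ∀ i, |f i| ≤ C := ⟨C, hf⟩
  simp [diagOp, h]

theorem repr_ext (b : HilbertBasis ι ℝ V) {v w : V} (h : ∀ i, b.repr v i = b.repr w i) :
    v = w :=
  b.repr.injective (lp.ext (funext h))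

theorem norm_le_of_repr_le (b : HilbertBasis ι ℝ V) {v w : V} {C : ℝ} (hC : 0 ≤ C)
    (h : ∀ i, |b.repr v i| ≤ C * |b.repr w i|) : ‖v‖ ≤ C * ‖w‖ := by
  refine le_of_sq_le_sq ?_ (by positivity)
  rw [mul_pow]
  refine hasSum_le (fun i => ?_) (hasSum_sq_repr b v) ((hasSum_sq_repr b w).mul_left (C ^ 2))
  rw [← sq_abs, ← sq_abs (b.repr w i), ← mul_pow]
  have := h i
  gcongr

theorem norm_diagOp_le (b : HilbertBasis ι ℝ V) {f : ι → ℝ} {C : ℝ} (hC : 0 ≤ C)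
    (hf : ∀ i, |f i| ≤ C) : ‖diagOp b f‖ ≤ C := by
  refine ContinuousLinearMap.opNorm_le_bound _ hC fun v => norm_le_of_repr_le b hC fun i => ?_
  rw [repr_diagOp b hf, abs_mul]
  have := hf i
  gcongr

/-- Bounded pointwise convergence of the multipliers gives strong convergence of the diagonal
operators. -/
theorem tendsto_diagOp (b : HilbertBasis ι ℝ V) {α : Type*} {l : Filter α}
    {F : α → ι → ℝ} {f : ι → ℝ} {C : ℝ} (hF : ∀ᶠ a in l, ∀ i, |F a i| ≤ C)
    (hf : ∀ i, |f i| ≤ C) (hlim : ∀ i, Tendsto (fun a => F a i) l (𝓝 (f i))) (v : V) :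
    Tendsto (fun a => diagOp b (F a) v) l (𝓝 (diagOp b f v)) := by
  rw [tendsto_iff_norm_sub_tendsto_zero]
  have hsq : Tendsto (fun a => ‖diagOp b (F a) v - diagOp b f v‖ ^ 2) l (𝓝 0) := by
    have h1 : Tendsto (fun a => ∑' i, ((F a i - f i) * b.repr v i) ^ 2) l
        (𝓝 (∑' _ : ι, (0:ℝ))) := by
      refine tendsto_tsum_of_dominated_convergence
        (bound := fun i => (2 * C) ^ 2 * (b.repr v i) ^ 2)
        ((hasSum_sq_repr b v).summable.mul_left _) (fun i => ?_) ?_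
      · have := (((hlim i).sub_const (f i)).mul_const (b.repr v i)).pow 2
        simpa using this
      · filter_upwards [hF] with a ha i
        rw [Real.norm_eq_abs, abs_of_nonneg (by positivity), mul_pow, ← sq_abs (F a i - f i)]
        have h3 : |F a i - f i| ≤ 2 * C := by
          have := abs_sub (F a i) (f i)
          linarith [ha i, hf i]
        gcongr
    rw [tsum_zero] at h1
    refine h1.congr' ?_
    filter_upwards [hF] with a ha
    rw [← (hasSum_sq_repr b _).tsum_eq]
    refine tsum_congr fun i => ?_
    rw [map_sub, lp.coeFn_sub, Pi.sub_apply, repr_diagOp b ha, repr_diagOp b hf, sub_mul]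
  have h2 := hsq.sqrt
  simpa using h2

end Diagonal

/-! ### Spectral decomposition of the inverse operator -/

section Spectral

universe u

variable {V : Type u} [NormedAddCommGroup V] [InnerProductSpace ℝ V] [CompleteSpace V]

/-- A compact symmetric operator has a Hilbert basis of eigenvectors. -/
theorem exists_hilbertBasis_eigenvectors {K : V →L[ℝ] V} (hK : IsCompactOperator K)
    (hsym : (K : V →ₗ[ℝ] V).IsSymmetric) :
    ∃ (ι : Type u) (b : HilbertBasis ι ℝ V) (κ : ι → ℝ), ∀ i, K (b i) = κ i • b i := by
  let E : ℝ → Submodule ℝ V := fun μ => Module.End.eigenspace (K : V →ₗ[ℝ] V) μ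
  have hE : ∀ μ, IsClosed (E μ : Set V) := fun μ => by
    have : (E μ : Set V) = {v | K v = μ • v} := by
      ext v; simp [E]
    rw [this]
    exact isClosed_eq K.continuous (by fun_prop)
  have : ∀ μ, CompleteSpace (E μ) := fun μ => (hE μ).completeSpace_coe
  choose s b hb using fun μ => exists_hilbertBasis ℝ (E μ)
  have hOrth : OrthogonalFamily ℝ (fun μ => E μ) fun μ => (E μ).subtypeₗᵢ :=
    hsym.orthogonalFamily_eigenspaces
  have hon := hOrth.orthonormal_sigma_orthonormal (fun μ => (b μ).orthonormal)
  refine ⟨(Σ μ, s μ), HilbertBasis.mkOfOrthogonalEqBot hon ?_, fun i => i.1, fun i => ?_⟩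
  · rw [eq_bot_iff, ← ContinuousLinearMap.orthogonalComplement_iSup_eigenspaces_eq_bot hK hsym]
    intro v hv
    rw [Submodule.mem_orthogonal] at hv ⊢
    have key : ∀ μ, E μ ≤ (ℝ ∙ v)ᗮ := by
      intro μ
      have h0 : (E μ).subtypeL.adjoint v = 0 := by
        refine repr_ext (b μ) fun i => ?_
        rw [(b μ).repr_apply_apply, ContinuousLinearMap.adjoint_inner_right, map_zero]
        exact hv _ (Submodule.subset_span ⟨⟨μ, i⟩, rfl⟩)
      intro u hu
      rw [Submodule.mem_orthogonal_singleton_iff_inner_left]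
      have := ContinuousLinearMap.adjoint_inner_right (E μ).subtypeL ⟨u, hu⟩ v
      rw [h0, inner_zero_right] at this
      exact this.symm
    intro u hu
    exact (Submodule.mem_orthogonal_singleton_iff_inner_left).1 (iSup_le key hu)
  · rw [HilbertBasis.coe_mkOfOrthogonalEqBot]
    exact Module.End.mem_eigenspace_iff.1 (b i.1 i.2).2

/-- The compact inverse `K` of a positive symmetric operator `-B` is diagonal in a Hilbert basis;
the eigenvalues are the inverses of numbers `lam i` bounded below by every lower bound of the
eigenvalues of `-B`. -/
theorem exists_spectral_decomposition {B : V →ₗ.[ℝ] V}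
    (hB : IsPositiveSymmetricWithCompactInverse (-B)) {lamB : ℝ}
    (hlamB : ∀ μ : ℝ, IsEigenvalue (-B) μ → lamB ≤ μ) :
    ∃ (K : V →L[ℝ] V) (ι : Type u) (b : HilbertBasis ι ℝ V) (lam : ι → ℝ),
      (∀ v w : V, (v, w) ∈ B.graph ↔ v = -K w) ∧ (∀ i, lamB ≤ lam i) ∧ (∀ i, 0 < lam i) ∧
      ∀ i, K (b i) = (lam i)⁻¹ • b i := by
  obtain ⟨K, hK, hgraph⟩ := hB.compact_inverse
  have hmem : ∀ w, ∃ u : (-B).domain, (u : V) = K w ∧ (-B) u = w := fun w => by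
    have := (hgraph (K w) w).2 rfl
    rw [LinearPMap.mem_graph_iff] at this
    obtain ⟨u, h1, h2⟩ := this
    exact ⟨u, h1, h2⟩
  have hsym : (K : V →ₗ[ℝ] V).IsSymmetric := fun w v => by
    obtain ⟨u, hu, hu'⟩ := hmem w
    obtain ⟨u₂, hu₂, hu₂'⟩ := hmem v
    have := hB.symmetric u u₂
    rw [hu, hu', hu₂, hu₂'] at this
    simpa using this.symm
  obtain ⟨ι, b, κ, hb⟩ := exists_hilbertBasis_eigenvectors hK hsym
  have hne : ∀ i, b i ≠ 0 := fun i => b.orthonormal.ne_zero i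
  have hκ : ∀ i, 0 < κ i := fun i => by
    obtain ⟨u, hu, hu'⟩ := hmem (b i)
    have h0 : u ≠ 0 := by
      rintro rfl
      rw [LinearPMap.map_zero] at hu'
      exact hne i hu'.symm
    have := hB.positive u h0
    rw [hu, hu', hb, inner_smul_right, real_inner_self_eq_norm_sq, b.orthonormal.1 i] at this
    simpa using this
  refine ⟨K, ι, b, fun i => (κ i)⁻¹, fun v w => ?_, fun i => hlamB _ ⟨b i, hne i, ?_⟩,
    fun i => inv_pos.2 (hκ i), fun i => by rw [inv_inv, hb]⟩
  · have h1 : (v, w) ∈ B.graph ↔ (v, -w) ∈ (-B).graph := by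
      simp only [LinearPMap.mem_graph_iff, LinearPMap.neg_apply, neg_inj]
      rfl
    rw [h1, hgraph, map_neg]
  · rw [hgraph, map_smul, hb, smul_smul, inv_mul_cancel₀ (hκ i).ne', one_smul]

end Spectral

end

section

/-! ### The semigroup and its smoothing properties -/

/-- The properties of the semigroup `S` generated by `B` used for the fast equation, where
`K = (-B)⁻¹` and `A t = -B S(t)` for `t > 0`: all operators are bounded, so that the unbounded `B`
no longer appears. For convenience `S t` is the identity for `t ≤ 0`. -/
structure IsSmoothingSemigroup {V : Type*} [NormedAddCommGroup V] [InnerProductSpace ℝ V]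
    (S A : ℝ → V →L[ℝ] V) (K : V →L[ℝ] V) (l : ℝ) : Prop where
  injective : Function.Injective K
  eq_id : ∀ t, t ≤ 0 → S t = ContinuousLinearMap.id ℝ V
  add : ∀ s t, 0 ≤ s → 0 ≤ t → ∀ v, S (s + t) v = S s (S t v)
  norm_le : ∀ t, 0 ≤ t → ‖S t‖ ≤ Real.exp (-(l * t))
  continuous_apply : ∀ v, Continuous fun t => S t v
  comm : ∀ t v, K (S t v) = S t (K v)
  inverse_smoothing : ∀ t, 0 < t → ∀ v, K (A t v) = S t v
  norm_smoothing_le : ∀ t, 0 < t → ‖A t‖ ≤ t⁻¹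
  continuousOn_smoothing : ∀ v, ContinuousOn (fun t => A t v) (Ioi 0)
  integral : ∀ t, 0 ≤ t → ∀ v, ∫ r in (0 : ℝ)..t, S r v = K (v - S t v)

theorem mul_exp_neg_le_inv {a t : ℝ} (ht : 0 < t) : a * Real.exp (-(a * t)) ≤ t⁻¹ := by
  rw [← one_div, le_div_iff₀ ht, mul_right_comm, Real.exp_neg, ← div_eq_mul_inv,
    div_le_one (Real.exp_pos _)]
  linarith [Real.add_one_le_exp (a * t)]

theorem abs_exp_neg_le_one {a t : ℝ} (ha : 0 < a) (ht : 0 ≤ t) : |Real.exp (-(a * t))| ≤ 1 := by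
  rw [abs_of_pos (Real.exp_pos _), Real.exp_le_one_iff]
  have := mul_nonneg ha.le ht
  linarith

theorem one_sub_exp_neg_le (x : ℝ) : 1 - Real.exp (-x) ≤ x := by
  linarith [Real.add_one_le_exp (-x)]

variable {V : Type*} [NormedAddCommGroup V] [InnerProductSpace ℝ V]

section Spectral

variable {ι : Type*} {b : HilbertBasis ι ℝ V} {lam : ι → ℝ}

theorem tendsto_difference_quotient_diagOp (hlam : ∀ i, 0 < lam i) (v : V) :
    Tendsto (fun t : ℝ => diagOp b (fun i => (1 - Real.exp (-(lam i * t))) / (lam i * t)) v)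
      (𝓝[>] 0) (𝓝 v) := by
  have hid : diagOp b (fun _ => (1 : ℝ)) v = v :=
    repr_ext b fun i => by rw [repr_diagOp b (C := 1) (by simp), one_mul]
  conv_rhs => rw [← hid]
  refine tendsto_diagOp b (C := 1) ?_ (by simp) (fun i => ?_) v
  · filter_upwards [self_mem_nhdsWithin] with t (ht : 0 < t) i
    have hp := mul_pos (hlam i) ht
    have h1 : Real.exp (-(lam i * t)) ≤ 1 := Real.exp_le_one_iff.2 (by linarith)
    rw [abs_of_nonneg (div_nonneg (by linarith) hp.le), div_le_one hp]
    exact one_sub_exp_neg_le _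
  · have hd : HasDerivAt (fun t : ℝ => -Real.exp (-(lam i * t))) (lam i) 0 := by
      have := (((hasDerivAt_id (0 : ℝ)).const_mul (lam i)).fun_neg.exp).fun_neg
      simpa using this
    have := (hasDerivAt_iff_tendsto_slope_zero.1 hd).mono_left
      (nhdsWithin_mono (0 : ℝ) (fun x (hx : 0 < x) => hx.ne'))
    have h2 := this.const_mul (lam i)⁻¹
    rw [inv_mul_cancel₀ (hlam i).ne'] at h2
    refine h2.congr fun t => ?_
    simp only [zero_add, mul_zero, neg_zero, Real.exp_zero, smul_eq_mul, div_eq_mul_inv, mul_inv]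
    ring

/-- Multiplication by `e^{-λᵢ t}` is a smoothing semigroup; `‖A t‖ ≤ 1/t` is the scalar inequality
`a e^{-a t} ≤ 1/t`, uniform in the eigenvalue `a`. -/
theorem isSmoothingSemigroup_diagOp [CompleteSpace V] {K : V →L[ℝ] V} {l : ℝ} (hl : ∀ i, l ≤ lam i)
    (hlam : ∀ i, 0 < lam i)
    (hKr : ∀ v i, b.repr (K v) i = (lam i)⁻¹ * b.repr v i) :
    IsSmoothingSemigroup (fun t => diagOp b fun i => Real.exp (-(lam i * max t 0)))
      (fun t => diagOp b fun i => lam i * Real.exp (-(lam i * t))) K l := by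
  have hS : ∀ t v i, b.repr (diagOp b (fun i => Real.exp (-(lam i * max t 0))) v) i =
      Real.exp (-(lam i * max t 0)) * b.repr v i := fun t v i =>
    repr_diagOp b (fun i => abs_exp_neg_le_one (hlam i) (le_max_right _ _)) v i
  have hAle : ∀ t, 0 < t → ∀ i, |lam i * Real.exp (-(lam i * t))| ≤ t⁻¹ := fun t ht i => by
    rw [abs_of_pos (mul_pos (hlam i) (Real.exp_pos _))]
    exact mul_exp_neg_le_inv ht
  have hcont : ∀ v, Continuous fun t => diagOp b (fun i => Real.exp (-(lam i * max t 0))) v := by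
    intro v
    rw [continuous_iff_continuousAt]
    intro t
    refine tendsto_diagOp b (C := 1)
      (Eventually.of_forall fun s i => abs_exp_neg_le_one (hlam i) (le_max_right _ _))
      (fun i => abs_exp_neg_le_one (hlam i) (le_max_right _ _)) (fun i => ?_) v
    exact (Continuous.continuousAt (by fun_prop))
  refine ⟨fun v w h => repr_ext b fun i => ?_, fun t ht => ?_, fun s t hs ht v => ?_,
    fun t ht => ?_, hcont, fun t v => ?_, fun t ht v => ?_, fun t ht => ?_, fun v => ?_,
    fun t ht v => ?_⟩
  · have := congrArg (fun x => b.repr x i) h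
    simp only [hKr] at this
    exact mul_left_cancel₀ (inv_ne_zero (hlam i).ne') this
  · ext v
    refine repr_ext b fun i => ?_
    rw [hS, max_eq_right ht]
    simp
  · refine repr_ext b fun i => ?_
    simp only [hS]
    rw [max_eq_left hs, max_eq_left ht, max_eq_left (add_nonneg hs ht), ← mul_assoc,
      ← Real.exp_add]
    ring_nf
  · refine norm_diagOp_le b (Real.exp_pos _).le fun i => ?_
    rw [max_eq_left ht, abs_of_pos (Real.exp_pos _), Real.exp_le_exp]
    have := mul_le_mul_of_nonneg_right (hl i) ht
    linarith
  · refine repr_ext b fun i => ?_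
    simp only [hS, hKr]
    ring
  · refine repr_ext b fun i => ?_
    rw [hKr, repr_diagOp b (hAle t ht), hS, max_eq_left ht.le, ← mul_assoc, ← mul_assoc,
      inv_mul_cancel₀ (hlam i).ne', one_mul]
  · exact norm_diagOp_le b (inv_pos.2 ht).le (hAle t ht)
  · intro t (ht : 0 < t)
    refine ContinuousAt.continuousWithinAt ?_
    refine tendsto_diagOp b (C := (t / 2)⁻¹) ?_ (fun i => ?_) (fun i => ?_) v
    · filter_upwards [lt_mem_nhds (half_lt_self ht)] with s hs i
      exact (hAle s ((half_pos ht).trans hs) i).trans (inv_anti₀ (half_pos ht) hs.le)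
    · exact (hAle t ht i).trans (inv_anti₀ (half_pos ht) (half_lt_self ht).le)
    · exact (Continuous.continuousAt (by fun_prop))
  · refine repr_ext b fun i => ?_
    simp only [hKr, map_sub, lp.coeFn_sub, Pi.sub_apply, hS]
    rw [b.repr_apply_apply, ← innerSL_apply_apply ℝ,
      ← ContinuousLinearMap.intervalIntegral_comp_comm _ ((hcont v).intervalIntegrable _ _)]
    simp only [innerSL_apply_apply, ← b.repr_apply_apply]
    simp only [hS]
    rw [intervalIntegral.integral_mul_const]
    have h1 : ∫ x in (0 : ℝ)..t, Real.exp (-(lam i * max x 0)) =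
        ∫ x in (0 : ℝ)..t, Real.exp (-(lam i) * x) := by
      refine intervalIntegral.integral_congr fun x hx => ?_
      rw [uIcc_of_le ht] at hx
      simp only [max_eq_left hx.1, neg_mul]
    rw [h1, intervalIntegral.integral_comp_mul_left (f := Real.exp) (neg_ne_zero.2 (hlam i).ne'),
      integral_exp, max_eq_left ht, smul_eq_mul]
    have := (hlam i).ne'
    simp only [mul_zero, Real.exp_zero, neg_mul]
    field_simp
    ring

/-- After applying `-K` the difference quotient of the semigroup converges at every vector. This
yields both inclusions between `B` and the generator. -/
theorem tendsto_neg_inverse_difference_quotient {K : V →L[ℝ] V} (hlam : ∀ i, 0 < lam i)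
    (hKr : ∀ v i, b.repr (K v) i = (lam i)⁻¹ * b.repr v i) (v : V) :
    Tendsto (fun t : ℝ => -K (t⁻¹ • (diagOp b (fun i => Real.exp (-(lam i * max t 0))) v - v)))
      (𝓝[>] 0) (𝓝 v) := by
  refine (tendsto_difference_quotient_diagOp (b := b) hlam v).congr' ?_
  filter_upwards [self_mem_nhdsWithin] with t (ht : 0 < t)
  refine repr_ext b fun i => ?_
  have hle : ∀ i, |(1 - Real.exp (-(lam i * t))) / (lam i * t)| ≤ 1 := fun i => by
    have hp := mul_pos (hlam i) ht
    have h1 : Real.exp (-(lam i * t)) ≤ 1 := Real.exp_le_one_iff.2 (by linarith)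
    rw [abs_of_nonneg (div_nonneg (by linarith) hp.le), div_le_one hp]
    exact one_sub_exp_neg_le _
  rw [repr_diagOp b hle, map_neg, lp.coeFn_neg, Pi.neg_apply, hKr, map_smul, lp.coeFn_smul,
    Pi.smul_apply, map_sub, lp.coeFn_sub, Pi.sub_apply,
    repr_diagOp b (fun i => abs_exp_neg_le_one (hlam i) (le_max_right _ _)), max_eq_left ht.le]
  have := (hlam i).ne'
  simp only [smul_eq_mul]
  field_simp
  ring

end Spectral

/-- The operator `B` generates a smoothing semigroup with exponential decay. -/
theorem exists_isSmoothingSemigroup [CompleteSpace V] {B : V →ₗ.[ℝ] V}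
    (hB : IsPositiveSymmetricWithCompactInverse (-B)) {lamB : ℝ}
    (hlamB : ∀ μ : ℝ, IsEigenvalue (-B) μ → lamB ≤ μ) :
    ∃ (S A : ℝ → V →L[ℝ] V) (K : V →L[ℝ] V), (∀ v w : V, (v, w) ∈ B.graph ↔ v = -K w) ∧
      IsSemigroupGeneratedBy S B ∧ IsSmoothingSemigroup S A K lamB := by
  obtain ⟨K, ι, b, lam, hgraph, hl, hlam, hK⟩ := exists_spectral_decomposition hB hlamB
  have hKr : ∀ v i, b.repr (K v) i = (lam i)⁻¹ * b.repr v i := by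
    intro v i
    have h1 := (b.hasSum_repr v).mapL K
    have h2 := h1.mapL (innerSL ℝ (b i))
    have h3 := hasSum_single (f := fun j => innerSL ℝ (b i) (K (b.repr v j • b j))) i
      (fun j hj => by simp [hK, b.orthonormal.2 hj.symm])
    rw [b.repr_apply_apply, ← innerSL_apply_apply ℝ, h2.unique h3]
    simp [hK, b.orthonormal.1 i, mul_comm]
  have hsm := isSmoothingSemigroup_diagOp hl hlam hKr
  refine ⟨_, _, K, hgraph, ⟨hsm.eq_id 0 le_rfl, fun s t hs ht => ?_,
    fun v => (hsm.continuous_apply v).continuousOn, fun v w => ?_⟩, hsm⟩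
  · ext v
    exact hsm.add s t hs ht v
  · rw [hgraph]
    have key := tendsto_neg_inverse_difference_quotient (b := b) hlam hKr
    constructor
    · rintro rfl
      refine (key w).congr fun t => ?_
      simp only [map_smul, map_sub, map_neg, hsm.comm, ← smul_neg]
      congr 1
      abel
    · intro h
      have h2 := ((K.continuous.tendsto w).comp h).neg
      exact tendsto_nhds_unique (key v) h2

end

section

/-! ### Convolution with the semigroup -/

variable {V : Type*} [NormedAddCommGroup V] [InnerProductSpace ℝ V]

theorem tendsto_clm_apply {α : Type*} {l : Filter α} {F : α → V →L[ℝ] V} {L : V →L[ℝ] V}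
    {h : α → V} {v : V} {M : ℝ} (hM : ∀ᶠ a in l, ‖F a‖ ≤ M)
    (hF : Tendsto (fun a => F a v) l (𝓝 (L v))) (hh : Tendsto h l (𝓝 v)) :
    Tendsto (fun a => F a (h a)) l (𝓝 (L v)) := by
  have h1 : Tendsto (fun a => F a (h a - v)) l (𝓝 0) := by
    have h2 : Tendsto (fun a => M * ‖h a - v‖) l (𝓝 0) := by
      simpa using (tendsto_iff_norm_sub_tendsto_zero.1 hh).const_mul M
    refine squeeze_zero_norm' ?_ h2
    filter_upwards [hM] with a ha
    exact (F a).le_of_opNorm_le ha _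
  have := h1.add hF
  simpa using this

/-- The convolution `∫₀ᵗ S(t - r) h(r) dr`. -/
def conv (S : ℝ → V →L[ℝ] V) (h : ℝ → V) (t : ℝ) : V :=
  ∫ r in (0 : ℝ)..t, S (t - r) (h r)

section Semigroup

variable {S A : ℝ → V →L[ℝ] V} {K : V →L[ℝ] V} {l : ℝ}

namespace IsSmoothingSemigroup

theorem norm_le_one (hS : IsSmoothingSemigroup S A K l) (hl : 0 ≤ l) (t : ℝ) : ‖S t‖ ≤ 1 := by
  rcases le_total t 0 with ht | ht
  · rw [hS.eq_id t ht]
    exact ContinuousLinearMap.norm_id_le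
  · refine (hS.norm_le t ht).trans (Real.exp_le_one_iff.2 ?_)
    have := mul_nonneg hl ht
    linarith

theorem continuous_uncurry (hS : IsSmoothingSemigroup S A K l) (hl : 0 ≤ l) :
    Continuous fun p : ℝ × V => S p.1 p.2 := by
  rw [continuous_iff_continuousAt]
  intro p
  exact tendsto_clm_apply (F := fun q : ℝ × V => S q.1) (M := 1)
    (Eventually.of_forall fun q => hS.norm_le_one hl _)
    (((hS.continuous_apply p.2).tendsto p.1).comp (continuous_fst.tendsto p))
    (continuous_snd.tendsto p)

theorem continuous_comp (hS : IsSmoothingSemigroup S A K l) (hl : 0 ≤ l) {X : Type*}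
    [TopologicalSpace X] {f : X → ℝ} {h : X → V} (hf : Continuous f) (hh : Continuous h) :
    Continuous fun x => S (f x) (h x) :=
  (hS.continuous_uncurry hl).comp (hf.prodMk hh)

theorem continuousOn_smoothing_comp (hS : IsSmoothingSemigroup S A K l) {h : ℝ → V}
    (hh : Continuous h) : ContinuousOn (fun s => A s (h s)) (Ioi 0) := by
  intro t (ht : 0 < t)
  refine tendsto_clm_apply (M := (t / 2)⁻¹) ?_ (hS.continuousOn_smoothing (h t) t ht)
    hh.continuousWithinAt
  filter_upwards [mem_nhdsWithin_of_mem_nhds (lt_mem_nhds (half_lt_self ht))] with s hs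
  have h2 : 0 < t / 2 := half_pos ht
  exact (hS.norm_smoothing_le s (h2.trans hs)).trans (inv_anti₀ h2 hs.le)

theorem continuous_conv (hS : IsSmoothingSemigroup S A K l) (hl : 0 ≤ l) {h : ℝ → V}
    (hh : Continuous h) : Continuous (conv S h) := by
  refine intervalIntegral.continuous_parametric_intervalIntegral_of_continuous (s := fun x => x)
    ?_ continuous_id
  exact hS.continuous_comp hl (by fun_prop) (by fun_prop)

theorem intervalIntegrable_conv (hS : IsSmoothingSemigroup S A K l) (hl : 0 ≤ l) {h : ℝ → V}
    (hh : ContinuousOn h (Ici 0)) {t u : ℝ} (ht : 0 ≤ t) :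
    IntervalIntegrable (fun r => S (u - r) (h r)) volume 0 t := by
  refine ContinuousOn.intervalIntegrable ?_
  rw [uIcc_of_le ht]
  exact (hS.continuous_uncurry hl).comp_continuousOn
    (ContinuousOn.prodMk (by fun_prop) (hh.mono Icc_subset_Ici_self))

theorem conv_const [CompleteSpace V] (hS : IsSmoothingSemigroup S A K l) (v : V) {t : ℝ}
    (ht : 0 ≤ t) : conv S (fun _ => v) t = K (v - S t v) := by
  rw [← hS.integral t ht v, conv,
    intervalIntegral.integral_comp_sub_left (fun r => S r v) t, sub_self, sub_zero]

theorem conv_sub (hS : IsSmoothingSemigroup S A K l) (hl : 0 ≤ l) {h₁ h₂ : ℝ → V}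
    (hh₁ : ContinuousOn h₁ (Ici 0)) (hh₂ : ContinuousOn h₂ (Ici 0)) {t : ℝ} (ht : 0 ≤ t) :
    conv S h₁ t - conv S h₂ t = conv S (fun r => h₁ r - h₂ r) t := by
  rw [conv, conv, conv, ← intervalIntegral.integral_sub
    (hS.intervalIntegrable_conv hl hh₁ ht) (hS.intervalIntegrable_conv hl hh₂ ht)]
  simp only [map_sub]

theorem conv_congr {h₁ h₂ : ℝ → V} {t : ℝ} (ht : 0 ≤ t) (h : ∀ r ∈ Icc 0 t, h₁ r = h₂ r) :
    conv S h₁ t = conv S h₂ t := by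
  refine intervalIntegral.integral_congr fun r hr => ?_
  rw [uIcc_of_le ht] at hr
  simp only [h r hr]

/-- The convolution over `[0, τ + t]` splits at `τ`. -/
theorem conv_add [CompleteSpace V] (hS : IsSmoothingSemigroup S A K l) (hl : 0 ≤ l) {h : ℝ → V}
    (hh : ContinuousOn h (Ici 0)) {t τ : ℝ} (ht : 0 ≤ t) (hτ : 0 ≤ τ) :
    conv S h (t + τ) = S t (conv S h τ) + conv S (fun r => h (r + τ)) t := by
  have hi := hS.intervalIntegrable_conv hl hh (u := t + τ) (add_nonneg ht hτ)
  have hi1 := hS.intervalIntegrable_conv hl hh (u := t + τ) hτ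
  rw [conv, ← intervalIntegral.integral_add_adjacent_intervals hi1 (hi1.symm.trans hi)]
  congr 1
  · rw [conv, ← ContinuousLinearMap.intervalIntegral_comp_comm _
      (hS.intervalIntegrable_conv hl hh hτ)]
    refine intervalIntegral.integral_congr fun r hr => ?_
    rw [uIcc_of_le hτ] at hr
    rw [← hS.add _ _ ht (sub_nonneg.2 hr.2), add_sub_assoc]
  · have := intervalIntegral.integral_comp_add_right (a := 0) (b := t)
      (fun r => S (t + τ - r) (h r)) τ
    rw [zero_add] at this
    rw [← this, conv]
    simp only [add_sub_add_right_eq_sub]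

theorem norm_conv_le (hS : IsSmoothingSemigroup S A K l) (hl : 0 < l) {h : ℝ → V} {t D : ℝ}
    (ht : 0 ≤ t) (hD : ∀ r ∈ Icc 0 t, ‖h r‖ ≤ D) : ‖conv S h t‖ ≤ D / l := by
  have hD0 : 0 ≤ D := (norm_nonneg _).trans (hD 0 ⟨le_rfl, ht⟩)
  have hb : IntervalIntegrable (fun r => Real.exp (-(l * (t - r))) * D) volume 0 t :=
    Continuous.intervalIntegrable (by fun_prop) _ _
  refine (intervalIntegral.norm_integral_le_of_norm_le ht
    (ae_of_all _ fun r hr => ?_) hb).trans ?_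
  · refine (S (t - r)).le_of_opNorm_le_of_le ?_ (hD r ⟨hr.1.le, hr.2⟩)
    exact hS.norm_le _ (sub_nonneg.2 hr.2)
  · rw [intervalIntegral.integral_mul_const,
      intervalIntegral.integral_comp_sub_left (fun r => Real.exp (-(l * r))) t, sub_self, sub_zero]
    have h1 : ∀ r, Real.exp (-(l * r)) = Real.exp ((-l) * r) := fun r => by ring_nf
    simp only [h1]
    rw [intervalIntegral.integral_comp_mul_left (f := Real.exp) (neg_ne_zero.2 hl.ne'),
      integral_exp, smul_eq_mul, div_eq_inv_mul]
    refine mul_le_mul_of_nonneg_right ?_ hD0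
    rw [mul_zero, Real.exp_zero, inv_neg, neg_mul, ← mul_neg, neg_sub]
    have := (Real.exp_pos (-l * t)).le
    exact mul_le_of_le_one_right (inv_pos.2 hl).le (by linarith)

end IsSmoothingSemigroup

/-! ### The stochastic convolution -/

/-- `z` solves `K z = K ω(t) - ∫₀ᵗ S(t - r) ω(r) dr`. As `K = (-B)⁻¹`, this says that `z` is the
stochastic convolution `ω(t) + B ∫₀ᵗ S(t - r) ω(r) dr`. For a Hölder path `ω` it is given by an
absolutely convergent integral, since `‖A s‖ ≤ 1/s`. -/
theorem IsSmoothingSemigroup.exists_stochConv [CompleteSpace V]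
    (hS : IsSmoothingSemigroup S A K l) (hl : 0 ≤ l) {ω : ℝ → V} (hω0 : ω 0 = 0) {T γ L : ℝ}
    (hT : 0 ≤ T) (hγ : 0 < γ)
    (hω : ∀ r ∈ Icc 0 T, ∀ s ∈ Icc 0 T, ‖ω r - ω s‖ ≤ L * |r - s| ^ γ)
    (hωc : ContinuousOn ω (Icc 0 T)) :
    ∃ z : ℝ → V, Continuous z ∧ (∀ t ∈ Icc 0 T, K (z t) = K (ω t) - conv S ω t) ∧
      ∀ t ∈ Icc 0 T, ‖z t‖ ≤ L * T ^ γ * (1 + γ⁻¹) := by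
  rcases hT.eq_or_lt with rfl | hT0
  · refine ⟨fun _ => 0, continuous_const, fun t ht => ?_, fun t ht => ?_⟩
    · obtain rfl : t = 0 := le_antisymm ht.2 ht.1
      simp [conv, hω0]
    · simp [Real.zero_rpow hγ.ne']
  have hL : 0 ≤ L := by
    have := (norm_nonneg _).trans (hω T ⟨hT, le_rfl⟩ 0 ⟨le_rfl, hT⟩)
    rw [sub_zero, abs_of_nonneg hT] at this
    exact nonneg_of_mul_nonneg_left this (Real.rpow_pos_of_pos hT0 γ)
  -- `η` extends `ω|_[0, T]` by constants; it is globally Hölder, and `η r = 0` for `r ≤ 0`.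
  set η : ℝ → V := fun r => ω (projIcc 0 T hT r) with hη
  have hηc : Continuous η := hωc.domRestrict.comp continuous_projIcc
  have hηeq : ∀ r ∈ Icc 0 T, η r = ω r := fun r hr => by
    simp only [hη, projIcc_of_mem hT hr]
  have hη0 : ∀ r ≤ 0, η r = 0 := fun r hr => by
    simp only [hη, projIcc_of_le_left hT hr, hω0]
  have hηH : ∀ r s, ‖η r - η s‖ ≤ L * |r - s| ^ γ := fun r s => by
    refine (hω _ (projIcc 0 T hT r).2 _ (projIcc 0 T hT s).2).trans ?_
    have := (LipschitzWith.projIcc hT).dist_le_mul r s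
    rw [NNReal.coe_one, one_mul, Subtype.dist_eq, Real.dist_eq, Real.dist_eq] at this
    exact mul_le_mul_of_nonneg_left (Real.rpow_le_rpow (abs_nonneg _) this hγ.le) hL
  have hbound : ∀ t s : ℝ, 0 < s → ‖A s (η (t - s) - η t)‖ ≤ L * s ^ (γ - 1) := fun t s hs => by
    refine ((A s).le_of_opNorm_le_of_le (hS.norm_smoothing_le s hs) (hηH _ _)).trans (le_of_eq ?_)
    rw [sub_sub_cancel_left, abs_neg, abs_of_pos hs, Real.rpow_sub_one hs.ne']
    ring
  have hbi : IntervalIntegrable (fun s : ℝ => L * s ^ (γ - 1)) volume 0 T :=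
    (intervalIntegral.intervalIntegrable_rpow' (by linarith)).const_mul L
  have hmeas : ∀ t, AEStronglyMeasurable (fun s => A s (η (t - s) - η t))
      (volume.restrict (uIoc 0 T)) := fun t => by
    rw [uIoc_of_le hT]
    refine (ContinuousOn.aestronglyMeasurable ?_ measurableSet_Ioi).mono_measure
      (Measure.restrict_mono Ioc_subset_Ioi_self le_rfl)
    exact hS.continuousOn_smoothing_comp (by fun_prop)
  have hint : ∀ t, IntervalIntegrable (fun s => A s (η (t - s) - η t)) volume 0 T := fun t => by
    refine hbi.mono_fun (hmeas t) ?_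
    refine (ae_restrict_iff' measurableSet_uIoc).2 (ae_of_all _ fun s hs => ?_)
    rw [uIoc_of_le hT] at hs
    exact (hbound t s hs.1).trans (le_abs_self _)
  -- As `η` vanishes on the negative half-line, the convolution may be taken over `[0, T]` for every
  -- `t`; subtracting `η t` under the integral makes the smoothing kernel `A` integrable.
  refine ⟨fun t => S T (η t) - ∫ s in (0 : ℝ)..T, A s (η (t - s) - η t), ?_, fun t ht => ?_,
    fun t ht => ?_⟩
  · refine ((S T).continuous.comp hηc).sub ?_
    refine intervalIntegral.continuous_of_dominated_interval
      (bound := fun s => L * s ^ (γ - 1)) hmeas (fun t => ae_of_all _ fun s hs => ?_) hbi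
      (ae_of_all _ fun s _ => ?_)
    · rw [uIoc_of_le hT] at hs
      exact hbound t s hs.1
    · exact (A s).continuous.comp (by fun_prop)
  · have h1 : K (∫ s in (0 : ℝ)..T, A s (η (t - s) - η t)) =
        (∫ s in (0 : ℝ)..T, S s (η (t - s))) - K (η t - S T (η t)) := by
      rw [← ContinuousLinearMap.intervalIntegral_comp_comm _ (hint t), ← hS.integral T hT,
        ← intervalIntegral.integral_sub
          ((hS.continuous_comp hl (by fun_prop) (by fun_prop)).intervalIntegrable _ _)
          ((hS.continuous_apply _).intervalIntegrable _ _)]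
      refine intervalIntegral.integral_congr_ae (ae_of_all _ fun s hs => ?_)
      rw [uIoc_of_le hT] at hs
      rw [hS.inverse_smoothing s hs.1, map_sub]
    have h2 : ∫ s in (0 : ℝ)..T, S s (η (t - s)) = conv S ω t := by
      have hc : Continuous fun s => S s (η (t - s)) :=
        hS.continuous_comp hl (by fun_prop) (by fun_prop)
      rw [← intervalIntegral.integral_add_adjacent_intervals (b := t)
        (hc.intervalIntegrable _ _) (hc.intervalIntegrable _ _)]
      have h3 : ∫ s in t..T, S s (η (t - s)) = 0 := by
        rw [← intervalIntegral.integral_zero (a := t) (b := T) (μ := volume)]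
        refine intervalIntegral.integral_congr fun s hs => ?_
        rw [uIcc_of_le ht.2] at hs
        simp only [hη0 (t - s) (by linarith [hs.1]), map_zero]
      have h4 : conv S η t = conv S ω t :=
        conv_congr ht.1 fun r hr => hηeq r ⟨hr.1, hr.2.trans ht.2⟩
      rw [h3, add_zero, ← h4, conv]
      have := intervalIntegral.integral_comp_sub_left (a := 0) (b := t)
        (fun r => S r (η (t - r))) t
      simp only [sub_sub_cancel, sub_self, sub_zero] at this
      exact this.symm
    rw [map_sub, h1, h2, map_sub, hηeq t ht]
    abel
  · have h1 : ‖∫ s in (0 : ℝ)..T, A s (η (t - s) - η t)‖ ≤ L * T ^ γ * γ⁻¹ := by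
      refine (intervalIntegral.norm_integral_le_of_norm_le hT
        (ae_of_all _ fun s hs => hbound t s hs.1) hbi).trans (le_of_eq ?_)
      rw [intervalIntegral.integral_const_mul, integral_rpow (Or.inl (by linarith)),
        sub_add_cancel, Real.zero_rpow hγ.ne']
      ring
    have h2 : ‖S T (η t)‖ ≤ L * T ^ γ := by
      refine ((S T).le_of_opNorm_le (hS.norm_le_one hl T) _).trans ?_
      have := hηH t 0
      rw [hη0 0 le_rfl, sub_zero, sub_zero, abs_of_nonneg ht.1] at this
      rw [one_mul]
      refine this.trans ?_
      have := ht.1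
      have := ht.2
      gcongr
    refine (norm_sub_le _ _).trans ?_
    linarith

end Semigroup

end

section

/-! ### The mild equation after applying the inverse operator -/

/-- Integral form of Gronwall's inequality. -/
theorem le_mul_exp_of_le_integral {u : ℝ → ℝ} (hu : Continuous u) {a c : ℝ} (hc : 0 ≤ c)
    (h : ∀ t, 0 ≤ t → u t ≤ a + c * ∫ r in (0 : ℝ)..t, u r) {t : ℝ} (ht : 0 ≤ t) :
    u t ≤ a * Real.exp (c * t) := by
  set U : ℝ → ℝ := fun t => a + c * ∫ r in (0 : ℝ)..t, u r with hU
  have hd : ∀ t, HasDerivAt U (c * u t) t := fun t =>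
    ((intervalIntegral.integral_hasDerivAt_right (hu.intervalIntegrable _ _)
      (hu.stronglyMeasurableAtFilter _ _) hu.continuousAt).const_mul c).const_add a
  have hd2 : ∀ t, HasDerivAt (fun t => U t * Real.exp (-(c * t)))
      (c * u t * Real.exp (-(c * t)) + U t * (Real.exp (-(c * t)) * -c)) t := fun t => by
    have h1 : HasDerivAt (fun t : ℝ => Real.exp (-(c * t))) (Real.exp (-(c * t)) * -c) t := by
      simpa using (((hasDerivAt_id t).const_mul c).fun_neg.exp)
    exact (hd t).mul h1
  have hanti : AntitoneOn (fun t => U t * Real.exp (-(c * t))) (Ici 0) := by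
    refine antitoneOn_of_hasDerivWithinAt_nonpos (convex_Ici 0)
      (fun t _ => (hd2 t).continuousAt.continuousWithinAt)
      (fun t _ => (hd2 t).hasDerivWithinAt) (fun t ht => ?_)
    rw [interior_Ici] at ht
    have h1 := mul_le_mul_of_nonneg_left (h t (le_of_lt ht)) hc
    have h2 := mul_le_mul_of_nonneg_right h1 (Real.exp_pos (-(c * t))).le
    have h3 : U t = a + c * ∫ r in (0 : ℝ)..t, u r := rfl
    rw [← h3] at h2
    linarith
  have h0 := hanti (mem_Ici.2 le_rfl) (mem_Ici.2 ht) ht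
  simp only [hU, intervalIntegral.integral_same, mul_zero, add_zero, neg_zero, Real.exp_zero,
    mul_one] at h0
  rw [Real.exp_neg, ← div_eq_mul_inv, div_le_iff₀ (Real.exp_pos _)] at h0
  exact (h t ht).trans h0

theorem continuous_of_lipschitz_bound {E : Type*} [NormedAddCommGroup E] {G : E → E} {C : ℝ}
    (hG : ∀ u v, ‖G u - G v‖ ≤ C * ‖u - v‖) :
    Continuous G :=
  (LipschitzWith.of_dist_le' (K := C) (by simpa [dist_eq_norm] using hG)).continuous

variable {V : Type*} [NormedAddCommGroup V] [InnerProductSpace ℝ V]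

/-- `Y` solves the mild equation `dY = B Y dt + G(Y) dt + dω`, `Y(0) = y`, where the equation is
written after applying the injective operator `K = (-B)⁻¹`, so that only bounded operators
occur. -/
structure SolvesInverse (S : ℝ → V →L[ℝ] V) (K : V →L[ℝ] V) (G : V → V) (ω : ℝ → V) (y : V)
    (Y : ℝ → V) : Prop where
  continuousOn : ContinuousOn Y (Ici 0)
  eq : ∀ t, 0 ≤ t → K (Y t) = K (S t y + conv S (fun r => G (Y r)) t + ω t) - conv S ω t

section Semigroup

variable {S A : ℝ → V →L[ℝ] V} {K : V →L[ℝ] V} {l C : ℝ} {G : V → V}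

/-- Solutions driven by the same path approach each other exponentially fast. -/
theorem SolvesInverse.norm_sub_le (hS : IsSmoothingSemigroup S A K l) (hl : 0 < l) (hC : 0 ≤ C)
    (hG : ∀ u v, ‖G u - G v‖ ≤ C * ‖u - v‖) {ω : ℝ → V} {y₁ y₂ : V} {Y₁ Y₂ : ℝ → V}
    (h₁ : SolvesInverse S K G ω y₁ Y₁) (h₂ : SolvesInverse S K G ω y₂ Y₂) {t : ℝ} (ht : 0 ≤ t) :
    ‖Y₁ t - Y₂ t‖ ≤ Real.exp (-((l - C) * t)) * ‖y₁ - y₂‖ := by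
  have hGc := continuous_of_lipschitz_bound hG
  have hc₁ : ContinuousOn (fun r => G (Y₁ r)) (Ici 0) := hGc.comp_continuousOn h₁.continuousOn
  have hc₂ : ContinuousOn (fun r => G (Y₂ r)) (Ici 0) := hGc.comp_continuousOn h₂.continuousOn
  set D : ℝ → V := fun r => Y₁ r - Y₂ r with hD
  have hDc : ContinuousOn D (Ici 0) := h₁.continuousOn.sub h₂.continuousOn
  have heq : ∀ t, 0 ≤ t → D t = S t (y₁ - y₂) + conv S (fun r => G (Y₁ r) - G (Y₂ r)) t :=
    fun t ht => hS.injective <| by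
      rw [← hS.conv_sub hl.le hc₁ hc₂ ht]
      simp only [hD, map_sub, map_add, h₁.eq t ht, h₂.eq t ht]
      abel
  -- Gronwall's inequality for `e^{l t} ‖D t‖`, extended by a constant to negative times
  set u : ℝ → ℝ := fun r => Real.exp (l * max r 0) * ‖D (max r 0)‖ with hu
  have huc : Continuous u := by
    refine Continuous.mul (by fun_prop) (Continuous.norm ?_)
    exact hDc.comp_continuous (by fun_prop) fun r => mem_Ici.2 (le_max_right _ _)
  have key : ∀ t, 0 ≤ t → u t ≤ ‖y₁ - y₂‖ + C * ∫ r in (0 : ℝ)..t, u r := fun t ht => by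
    have hint : IntervalIntegrable (fun r => Real.exp (-(l * t)) * (C * u r)) volume 0 t :=
      Continuous.intervalIntegrable (by fun_prop) _ _
    have hconv : ‖conv S (fun r => G (Y₁ r) - G (Y₂ r)) t‖ ≤
        Real.exp (-(l * t)) * (C * ∫ r in (0 : ℝ)..t, u r) := by
      refine (intervalIntegral.norm_integral_le_of_norm_le ht
        (ae_of_all _ fun r hr => ?_) hint).trans (le_of_eq ?_)
      · refine ((S (t - r)).le_of_opNorm_le_of_le (hS.norm_le _ (sub_nonneg.2 hr.2))
          (hG _ _)).trans (le_of_eq ?_)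
        simp only [hu, max_eq_left hr.1.le, hD]
        rw [mul_sub, neg_sub, sub_eq_neg_add, Real.exp_add]
        ring
      · rw [intervalIntegral.integral_const_mul, intervalIntegral.integral_const_mul]
    have hSy : ‖S t (y₁ - y₂)‖ ≤ Real.exp (-(l * t)) * ‖y₁ - y₂‖ :=
      (S t).le_of_opNorm_le (hS.norm_le t ht) _
    have hDt : ‖D t‖ ≤ Real.exp (-(l * t)) * (‖y₁ - y₂‖ + C * ∫ r in (0 : ℝ)..t, u r) := by
      rw [heq t ht, mul_add]
      exact (norm_add_le _ _).trans (add_le_add hSy hconv)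
    simp only [hu, max_eq_left ht]
    calc Real.exp (l * t) * ‖D t‖
        ≤ Real.exp (l * t) * (Real.exp (-(l * t)) * (‖y₁ - y₂‖ + C * ∫ r in (0 : ℝ)..t, u r)) := by
          gcongr
      _ = _ := by rw [← mul_assoc, ← Real.exp_add, add_neg_cancel, Real.exp_zero, one_mul]
  have hfin := le_mul_exp_of_le_integral huc hC key ht
  simp only [hu, max_eq_left ht] at hfin
  calc ‖D t‖ = Real.exp (-(l * t)) * (Real.exp (l * t) * ‖D t‖) := by
        rw [← mul_assoc, ← Real.exp_add, neg_add_cancel, Real.exp_zero, one_mul]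
    _ ≤ Real.exp (-(l * t)) * (‖y₁ - y₂‖ * Real.exp (C * t)) := by gcongr
    _ = _ := by
        rw [mul_comm ‖y₁ - y₂‖, ← mul_assoc, ← Real.exp_add]
        ring_nf

theorem SolvesInverse.unique (hS : IsSmoothingSemigroup S A K l) (hl : 0 < l) (hC : 0 ≤ C)
    (hG : ∀ u v, ‖G u - G v‖ ≤ C * ‖u - v‖) {ω : ℝ → V} {y : V} {Y₁ Y₂ : ℝ → V}
    (h₁ : SolvesInverse S K G ω y Y₁) (h₂ : SolvesInverse S K G ω y Y₂) {t : ℝ} (ht : 0 ≤ t) :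
    Y₁ t = Y₂ t := by
  have := h₁.norm_sub_le hS hl hC hG h₂ ht
  rw [sub_self, norm_zero, mul_zero] at this
  exact sub_eq_zero.1 (norm_le_zero_iff.1 this)

theorem SolvesInverse.initial (hS : IsSmoothingSemigroup S A K l) {ω : ℝ → V} (hω : ω 0 = 0)
    {y : V} {Y : ℝ → V} (h : SolvesInverse S K G ω y Y) : Y 0 = y := by
  refine hS.injective ?_
  rw [h.eq 0 le_rfl]
  simp [conv, hω, hS.eq_id 0 le_rfl]

/-- The time shift of a solution solves the equation driven by the shifted path. -/
theorem SolvesInverse.shift [CompleteSpace V] (hS : IsSmoothingSemigroup S A K l) (hl : 0 ≤ l)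
    (hG : ∀ u v, ‖G u - G v‖ ≤ C * ‖u - v‖) {ω : ℝ → V} (hω : Continuous ω) {y : V} {Y : ℝ → V}
    (h : SolvesInverse S K G ω y Y) {τ : ℝ} (hτ : 0 ≤ τ) :
    SolvesInverse S K G (fun s => ω (s + τ) - ω τ) (Y τ) (fun s => Y (s + τ)) := by
  have hGc := continuous_of_lipschitz_bound hG
  have hYc : ContinuousOn (fun r => G (Y r)) (Ici 0) := hGc.comp_continuousOn h.continuousOn
  refine ⟨h.continuousOn.comp (by fun_prop) fun s hs => add_nonneg hs hτ, fun t ht => ?_⟩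
  have e0 : K (S t (Y τ)) = S t (K (S τ y + conv S (fun r => G (Y r)) τ + ω τ) - conv S ω τ) := by
    rw [hS.comm, h.eq τ hτ]
  have e1 := hS.conv_add hl hYc ht hτ
  have e2 := hS.conv_add hl hω.continuousOn ht hτ
  have e3 := hS.conv_sub hl (h₁ := fun s => ω (s + τ)) (h₂ := fun _ => ω τ) (by fun_prop)
    (by fun_prop) ht
  rw [hS.conv_const _ ht] at e3
  have e4 : K (S t (Y τ) + conv S (fun r => G (Y (r + τ))) t + (ω (t + τ) - ω τ)) =
      K (S t (Y τ)) + K (conv S (fun r => G (Y (r + τ))) t) + (K (ω (t + τ)) - K (ω τ)) := by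
    rw [map_add, map_add, map_sub]
  rw [e4, h.eq _ (add_nonneg ht hτ), ← e3, e1, e2, e0]
  simp only [map_add, map_sub, hS.comm, hS.add t τ ht hτ]
  abel

/-- A priori bound: away from the initial value, the size of a solution is controlled by that of
the stochastic convolution `z`. -/
theorem SolvesInverse.norm_le (hS : IsSmoothingSemigroup S A K l) (hC : 0 ≤ C) (hCl : C < l)
    (hG : ∀ u v, ‖G u - G v‖ ≤ C * ‖u - v‖) {ω : ℝ → V} {Y z : ℝ → V}
    (h : SolvesInverse S K G ω 0 Y) {T D : ℝ}
    (hz : ∀ t ∈ Icc 0 T, K (z t) = K (ω t) - conv S ω t) (hD : ∀ t ∈ Icc 0 T, ‖z t‖ ≤ D)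
    (hT : 0 ≤ T) : ‖Y T‖ ≤ (l * D + ‖G 0‖) / (l - C) := by
  have hl : 0 < l := hC.trans_lt hCl
  obtain ⟨s, hs, hmax⟩ := isCompact_Icc.exists_isMaxOn (nonempty_Icc.2 hT)
    ((h.continuousOn.mono Icc_subset_Ici_self).norm : ContinuousOn (fun t => ‖Y t‖) (Icc 0 T))
  have hYs : Y s = z s + conv S (fun r => G (Y r)) s := hS.injective <| by
    rw [h.eq s hs.1, map_add K (z s), hz s hs]
    simp only [map_zero, zero_add, map_add]
    abel
  have h1 : ‖conv S (fun r => G (Y r)) s‖ ≤ (C * ‖Y s‖ + ‖G 0‖) / l := by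
    refine hS.norm_conv_le hl hs.1 fun r hr => ?_
    have h2 := hG (Y r) 0
    have h3 := norm_sub_norm_le (G (Y r)) (G 0)
    have h4 : ‖Y r‖ ≤ ‖Y s‖ := hmax ⟨hr.1, hr.2.trans hs.2⟩
    have h5 := mul_le_mul_of_nonneg_left h4 hC
    rw [sub_zero] at h2
    linarith
  have h2 : ‖Y s‖ ≤ D + (C * ‖Y s‖ + ‖G 0‖) / l := by
    calc ‖Y s‖ = ‖z s + conv S (fun r => G (Y r)) s‖ := by rw [← hYs]
      _ ≤ _ := (norm_add_le _ _).trans (add_le_add (hD s hs) h1)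
  refine (hmax ⟨hT, le_rfl⟩ : ‖Y T‖ ≤ ‖Y s‖).trans ?_
  rw [le_div_iff₀ (sub_pos.2 hCl)]
  have h3 := mul_le_mul_of_nonneg_left h2 hl.le
  rw [mul_add, mul_div_cancel₀ _ hl.ne'] at h3
  linarith

end Semigroup

end

section

/-! ### Existence of solutions and measurable dependence on parameters -/

variable {V : Type*} [NormedAddCommGroup V] [InnerProductSpace ℝ V]

/-- The Picard iterates of `Y = f + ∫₀ᵗ S(t - r) G(Y(r)) dr`. -/
def picard (S : ℝ → V →L[ℝ] V) (G : V → V) (f : ℝ → V) : ℕ → ℝ → V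
  | 0 => f
  | n + 1 => fun t => f t + conv S (fun r => G (picard S G f n r)) t

/-- The limit of the Picard iterates. -/
def picardLimit (S : ℝ → V →L[ℝ] V) (G : V → V) (f : ℝ → V) (t : ℝ) : V :=
  limUnder atTop fun n => picard S G f n t

section Semigroup

variable {S A : ℝ → V →L[ℝ] V} {K : V →L[ℝ] V} {l C : ℝ} {G : V → V}

theorem continuous_picard (hS : IsSmoothingSemigroup S A K l) (hl : 0 ≤ l) (hG : Continuous G)
    {f : ℝ → V} (hf : Continuous f) (n : ℕ) : Continuous (picard S G f n) := by
  induction n with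
  | zero => exact hf
  | succ n ih => exact hf.add (hS.continuous_conv hl (hG.comp ih))

/-- The Picard iteration contracts the supremum norm on `[0, T]` by the factor `C / l < 1`. -/
theorem norm_picard_succ_sub_le (hS : IsSmoothingSemigroup S A K l) (hC : 0 ≤ C) (hCl : C < l)
    (hG : ∀ u v, ‖G u - G v‖ ≤ C * ‖u - v‖) {f : ℝ → V} (hf : Continuous f) {T : ℝ} :
    ∃ M, ∀ n, ∀ t ∈ Icc 0 T, ‖picard S G f n t - picard S G f (n + 1) t‖ ≤ M * (C / l) ^ n := by
  have hl : 0 < l := hC.trans_lt hCl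
  have hGc := continuous_of_lipschitz_bound hG
  have hc := continuous_picard hS hl.le hGc hf
  obtain ⟨M, hM⟩ := isCompact_Icc.exists_bound_of_continuousOn (s := Icc 0 T)
    ((hc 0).sub (hc 1)).continuousOn
  refine ⟨M, fun n => ?_⟩
  induction n with
  | zero => simpa using hM
  | succ n ih =>
    intro t ht
    have h1 : picard S G f (n + 1) t - picard S G f (n + 1 + 1) t =
        conv S (fun r => G (picard S G f n r) - G (picard S G f (n + 1) r)) t := by
      rw [← hS.conv_sub hl.le (h₁ := fun r => G (picard S G f n r))
        (h₂ := fun r => G (picard S G f (n + 1) r)) (hGc.comp (hc _)).continuousOn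
        (hGc.comp (hc _)).continuousOn ht.1]
      exact add_sub_add_left_eq_sub _ _ _
    rw [h1]
    refine (hS.norm_conv_le hl ht.1 (D := C * (M * (C / l) ^ n)) fun r hr => ?_).trans
      (le_of_eq (by rw [pow_succ]; ring))
    exact (hG _ _).trans (mul_le_mul_of_nonneg_left (ih r ⟨hr.1, hr.2.trans ht.2⟩) hC)

theorem exists_norm_picard_sub_limit_le [CompleteSpace V] (hS : IsSmoothingSemigroup S A K l)
    (hC : 0 ≤ C) (hCl : C < l) (hG : ∀ u v, ‖G u - G v‖ ≤ C * ‖u - v‖) {f : ℝ → V}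
    (hf : Continuous f) (T : ℝ) :
    ∃ M, ∀ t ∈ Icc 0 T, Tendsto (fun n => picard S G f n t) atTop (𝓝 (picardLimit S G f t)) ∧
      ∀ n, ‖picard S G f n t - picardLimit S G f t‖ ≤ M * (C / l) ^ n := by
  have hl : 0 < l := hC.trans_lt hCl
  have hq : C / l < 1 := (div_lt_one hl).2 hCl
  obtain ⟨M, hM⟩ := norm_picard_succ_sub_le hS hC hCl hG hf (T := T)
  refine ⟨M / (1 - C / l), fun t ht => ?_⟩
  have hcau := cauchySeq_of_le_geometric (C / l) M hq
    (fun n => (dist_eq_norm (picard S G f n t) _).le.trans (hM n t ht))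
  have hlim : Tendsto (fun n => picard S G f n t) atTop (𝓝 (picardLimit S G f t)) :=
    tendsto_nhds_limUnder (cauchySeq_tendsto_of_complete hcau)
  refine ⟨hlim, fun n => ?_⟩
  rw [← dist_eq_norm]
  refine (dist_le_of_le_geometric_of_tendsto (C / l) M hq
    (fun n => (dist_eq_norm (picard S G f n t) _).le.trans (hM n t ht)) hlim n).trans
    (le_of_eq (by ring))

theorem tendsto_geometric_error (hC : 0 ≤ C) (hCl : C < l) (M : ℝ) :
    Tendsto (fun n : ℕ => M * (C / l) ^ n) atTop (𝓝 0) := by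
  have hl : 0 < l := hC.trans_lt hCl
  simpa using (tendsto_pow_atTop_nhds_zero_of_lt_one (div_nonneg hC hl.le)
    ((div_lt_one hl).2 hCl)).const_mul M

theorem continuousOn_picardLimit [CompleteSpace V] (hS : IsSmoothingSemigroup S A K l)
    (hC : 0 ≤ C) (hCl : C < l) (hG : ∀ u v, ‖G u - G v‖ ≤ C * ‖u - v‖) {f : ℝ → V}
    (hf : Continuous f) : ContinuousOn (picardLimit S G f) (Ici 0) := by
  have hl : 0 < l := hC.trans_lt hCl
  intro t (ht : 0 ≤ t)
  have hon : ContinuousOn (picardLimit S G f) (Icc 0 (t + 1)) := by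
    obtain ⟨M, hM⟩ := exists_norm_picard_sub_limit_le hS hC hCl hG hf (t + 1)
    have hunif : TendstoUniformlyOn (picard S G f) (picardLimit S G f) atTop (Icc 0 (t + 1)) := by
      rw [Metric.tendstoUniformlyOn_iff]
      intro δ hδ
      filter_upwards [(tendsto_geometric_error hC hCl M).eventually_lt_const hδ] with n hn s hs
      rw [dist_comm, dist_eq_norm]
      exact ((hM s hs).2 n).trans_lt hn
    exact hunif.continuousOn (Eventually.of_forall fun n =>
      (continuous_picard hS hl.le (continuous_of_lipschitz_bound hG) hf n).continuousOn).frequently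
  refine (hon t ⟨ht, by linarith⟩).mono_of_mem_nhdsWithin ?_
  rw [← Ici_inter_Iic]
  exact inter_mem self_mem_nhdsWithin (mem_nhdsWithin_of_mem_nhds (Iic_mem_nhds (by linarith)))

theorem picardLimit_eq [CompleteSpace V] (hS : IsSmoothingSemigroup S A K l)
    (hC : 0 ≤ C) (hCl : C < l) (hG : ∀ u v, ‖G u - G v‖ ≤ C * ‖u - v‖) {f : ℝ → V}
    (hf : Continuous f) {t : ℝ} (ht : 0 ≤ t) :
    picardLimit S G f t = f t + conv S (fun r => G (picardLimit S G f r)) t := by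
  have hl : 0 < l := hC.trans_lt hCl
  have hGc := continuous_of_lipschitz_bound hG
  obtain ⟨M, hM⟩ := exists_norm_picard_sub_limit_le hS hC hCl hG hf t
  have h1 := (hM t ⟨ht, le_rfl⟩).1.comp (tendsto_add_atTop_nat 1)
  refine tendsto_nhds_unique h1 ?_
  refine tendsto_const_nhds.add ?_
  rw [tendsto_iff_norm_sub_tendsto_zero]
  refine squeeze_zero (fun n => norm_nonneg _) (fun n => ?_)
    (tendsto_geometric_error hC hCl (C * M / l))
  rw [hS.conv_sub hl.le (h₁ := fun r => G (picard S G f n r))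
    (h₂ := fun r => G (picardLimit S G f r))
    (hGc.comp (continuous_picard hS hl.le hGc hf n)).continuousOn
    (hGc.comp_continuousOn (continuousOn_picardLimit hS hC hCl hG hf)) ht]
  refine (hS.norm_conv_le hl ht (D := C * (M * (C / l) ^ n)) fun r hr => ?_).trans
    (le_of_eq (by ring))
  exact (hG _ _).trans (mul_le_mul_of_nonneg_left ((hM r ⟨hr.1, hr.2⟩).2 n) hC)

section Measurable

variable [SecondCountableTopology V] [MeasurableSpace V] [BorelSpace V]
  {Θ : Type*} [MeasurableSpace Θ]

theorem measurable_conv (hS : IsSmoothingSemigroup S A K l) (hl : 0 ≤ l) {f : ℝ → Θ → V}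
    (hfc : ∀ p, Continuous fun t => f t p) (hfm : ∀ t, Measurable (f t)) (t : ℝ) :
    Measurable fun p => conv S (fun r => f r p) t := by
  have hjoint : Measurable (Function.uncurry fun (r : ℝ) (p : Θ) => S (t - r) (f r p)) :=
    measurable_uncurry_of_continuous_of_measurable
      (fun p => hS.continuous_comp hl (by fun_prop) (hfc p))
      (fun r => (S (t - r)).continuous.measurable.comp (hfm r))
  have hsm := hjoint.stronglyMeasurable
  simp only [conv, intervalIntegral]
  exact (hsm.integral_prod_left.measurable).sub (hsm.integral_prod_left.measurable)

theorem measurable_picard (hS : IsSmoothingSemigroup S A K l) (hl : 0 ≤ l) (hG : Continuous G)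
    {f : ℝ → Θ → V} (hfc : ∀ p, Continuous fun t => f t p) (hfm : ∀ t, Measurable (f t))
    (n : ℕ) (t : ℝ) : Measurable fun p => picard S G (fun r => f r p) n t := by
  induction n generalizing t with
  | zero => exact hfm t
  | succ n ih =>
    exact (hfm t).add (measurable_conv hS hl
      (f := fun r p => G (picard S G (fun r => f r p) n r))
      (fun p => hG.comp (continuous_picard hS hl hG (hfc p) n))
      (fun r => hG.measurable.comp (ih r)) t)

theorem measurable_picardLimit [CompleteSpace V] (hS : IsSmoothingSemigroup S A K l)
    (hC : 0 ≤ C) (hCl : C < l) (hG : ∀ u v, ‖G u - G v‖ ≤ C * ‖u - v‖) {f : ℝ → Θ → V}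
    (hfc : ∀ p, Continuous fun t => f t p) (hfm : ∀ t, Measurable (f t)) {t : ℝ} (ht : 0 ≤ t) :
    Measurable fun p => picardLimit S G (fun r => f r p) t := by
  refine measurable_of_tendsto_metrizable
    (measurable_picard hS (hC.trans hCl.le) (continuous_of_lipschitz_bound hG) hfc hfm · t) ?_
  rw [tendsto_pi_nhds]
  intro p
  obtain ⟨M, hM⟩ := exists_norm_picard_sub_limit_le hS hC hCl hG (hfc p) t
  exact (hM t ⟨ht, le_rfl⟩).1

end Measurable

end Semigroup

end

section

/-! ### The path space and the flow of the equation -/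

section PathSpace

variable {V : Type*} [NormedAddCommGroup V]

theorem continuous_eval_c0Path (t : ℝ) : Continuous fun ω : C0Path V => ω.1 t :=
  (continuous_eval_const t).comp continuous_subtype_val

theorem measurable_eval_c0Path [MeasurableSpace V] [BorelSpace V] (t : ℝ) :
    Measurable fun ω : C0Path V => ω.1 t :=
  (continuous_eval_c0Path t).measurable

theorem measurable_eval_holderPath [MeasurableSpace V] [BorelSpace V] {γ : ℝ≥0} (t : ℝ) :
    Measurable fun ω : HolderPath V γ => ω.1.1 t :=
  (measurable_eval_c0Path t).comp measurable_subtype_coe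

theorem continuous_shiftC0 : Continuous fun p : ℝ × C0Path V => shiftC0 p.1 p.2 := by
  refine Continuous.subtype_mk (ContinuousMap.continuous_of_continuous_uncurry _ ?_) _
  have h : Continuous fun q : (ℝ × C0Path V) × ℝ => q.1.2.1 (q.2 + q.1.1) - q.1.2.1 q.1.1 := by
    fun_prop
  exact h

theorem measurable_shift [SecondCountableTopology V] {γ : ℝ≥0} :
    Measurable fun p : ℝ × HolderPath V γ => shift p.1 p.2 := by
  refine Measurable.subtype_mk ?_
  exact continuous_shiftC0.measurable.comp
    (measurable_fst.prodMk (measurable_subtype_coe.comp measurable_snd))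

@[simp]
theorem shift_apply {γ : ℝ≥0} (t : ℝ) (ω : HolderPath V γ) (s : ℝ) :
    (shift t ω).1.1 s = ω.1.1 (s + t) - ω.1.1 t := rfl

theorem holderPath_ext {γ : ℝ≥0} {ω ω' : HolderPath V γ} (h : ∀ t, ω.1.1 t = ω'.1.1 t) :
    ω = ω' :=
  Subtype.ext (Subtype.ext (ContinuousMap.ext h))

theorem shift_zero {γ : ℝ≥0} (ω : HolderPath V γ) : shift 0 ω = ω :=
  holderPath_ext fun t => by rw [shift_apply, add_zero, ω.1.2, sub_zero]

theorem shift_add {γ : ℝ≥0} (s t : ℝ) (ω : HolderPath V γ) :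
    shift (s + t) ω = shift s (shift t ω) :=
  holderPath_ext fun r => by
    simp only [shift_apply, add_assoc, sub_sub_sub_cancel_right]

/-- The Hölder estimate of a path in `HolderPath V γ` on `[a, b]`. -/
theorem HolderPath.exists_holder_bound {γ : ℝ≥0} (ω : HolderPath V γ) (a b : ℝ) :
    ∃ L : ℝ, ∀ r ∈ Icc a b, ∀ s ∈ Icc a b, ‖ω.1.1 r - ω.1.1 s‖ ≤ L * |r - s| ^ (γ : ℝ) := by
  obtain ⟨L, hL⟩ := ω.2 a b
  refine ⟨L, fun r hr s hs => ?_⟩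
  rw [← dist_eq_norm, ← Real.dist_eq]
  exact hL.dist_le hr hs

end PathSpace

variable {V : Type*} [NormedAddCommGroup V] [InnerProductSpace ℝ V]

/-- The stochastic convolution `ω(t) + B ∫₀ᵗ S(t - r) ω(r) dr`, as the solution `z` of
`K z = K ω(t) - ∫₀ᵗ S(t - r) ω(r) dr`. The value is meaningful only if a solution exists. -/
def stochConv (S : ℝ → V →L[ℝ] V) (K : V →L[ℝ] V) (ω : ℝ → V) (t : ℝ) : V :=
  Function.invFun K (K (ω t) - conv S ω t)

/-- The solution at time `t ≥ 0` of `dY = B Y dt + G(Y) dt + dω`, `Y(0) = y`. The forcing is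
extended to negative times by a constant only to make it continuous on `ℝ`. -/
def flow {γ : ℝ≥0} (S : ℝ → V →L[ℝ] V) (K : V →L[ℝ] V) (G : V → V) (t : ℝ)
    (ω : HolderPath V γ) (y : V) : V :=
  picardLimit S G (fun r => S r y + stochConv S K ω.1.1 (max r 0)) t

section Semigroup

variable {S A : ℝ → V →L[ℝ] V} {K : V →L[ℝ] V} {l C : ℝ} {G : V → V} {γ : ℝ≥0}

theorem stochConv_eq_of (hS : IsSmoothingSemigroup S A K l) {ω : ℝ → V} {t : ℝ} {z : V}
    (h : K z = K (ω t) - conv S ω t) : stochConv S K ω t = z := by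
  rw [stochConv, ← h]
  exact Function.leftInverse_invFun hS.injective z

variable [CompleteSpace V]

theorem map_stochConv (hS : IsSmoothingSemigroup S A K l) (hl : 0 ≤ l) (hγ : 0 < γ)
    (ω : HolderPath V γ) {t : ℝ} (ht : 0 ≤ t) :
    K (stochConv S K ω.1.1 t) = K (ω.1.1 t) - conv S ω.1.1 t := by
  obtain ⟨L, hL⟩ := ω.exists_holder_bound 0 t
  obtain ⟨z, -, hz, -⟩ := hS.exists_stochConv hl ω.1.2 ht (NNReal.coe_pos.2 hγ) hL
    ω.1.1.continuous.continuousOn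
  rw [stochConv_eq_of hS (hz t ⟨ht, le_rfl⟩), hz t ⟨ht, le_rfl⟩]

theorem norm_stochConv_le (hS : IsSmoothingSemigroup S A K l) (hl : 0 ≤ l) (hγ : 0 < γ)
    (ω : HolderPath V γ) {T L : ℝ}
    (hL : ∀ r ∈ Icc 0 T, ∀ s ∈ Icc 0 T, ‖ω.1.1 r - ω.1.1 s‖ ≤ L * |r - s| ^ (γ : ℝ))
    {t : ℝ} (ht : t ∈ Icc 0 T) :
    ‖stochConv S K ω.1.1 t‖ ≤ L * T ^ (γ : ℝ) * (1 + (γ : ℝ)⁻¹) := by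
  obtain ⟨z, -, hz, hb⟩ := hS.exists_stochConv hl ω.1.2 (ht.1.trans ht.2) (NNReal.coe_pos.2 hγ) hL
    ω.1.1.continuous.continuousOn
  rw [stochConv_eq_of hS (hz t ht)]
  exact hb t ht

theorem continuous_stochConv (hS : IsSmoothingSemigroup S A K l) (hl : 0 ≤ l) (hγ : 0 < γ)
    (ω : HolderPath V γ) : Continuous fun t => stochConv S K ω.1.1 (max t 0) := by
  rw [continuous_iff_continuousAt]
  intro t
  have hT : 0 ≤ |t| + 1 := by positivity
  obtain ⟨L, hL⟩ := ω.exists_holder_bound 0 (|t| + 1)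
  obtain ⟨z, hzc, hz, -⟩ := hS.exists_stochConv hl ω.1.2 hT (NNReal.coe_pos.2 hγ) hL
    ω.1.1.continuous.continuousOn
  have hzc' : ContinuousAt (fun s => z (max s 0)) t :=
    (hzc.comp (by fun_prop : Continuous fun s : ℝ => max s 0)).continuousAt
  refine hzc'.congr ?_
  filter_upwards [gt_mem_nhds ((le_abs_self t).trans_lt (lt_add_one |t|))] with s hs
  exact (stochConv_eq_of hS (hz _ ⟨le_max_right _ _, max_le hs.le hT⟩)).symm

/-- The stochastic convolution depends measurably on the path: after applying `K` it is continuous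
in the path, and the injective operator `K` is a measurable embedding by the Lusin–Souslin
theorem. -/
theorem measurable_stochConv [TopologicalSpace.SeparableSpace V] [MeasurableSpace V] [BorelSpace V]
    (hS : IsSmoothingSemigroup S A K l) (hl : 0 ≤ l) (hγ : 0 < γ) {t : ℝ} (ht : 0 ≤ t) :
    Measurable fun ω : HolderPath V γ => stochConv S K ω.1.1 t := by
  rw [← (K.continuous.measurableEmbedding hS.injective).measurable_comp_iff]
  have h : (K ∘ fun ω : HolderPath V γ => stochConv S K ω.1.1 t) =
      fun ω => K (ω.1.1 t) - conv S (fun r => ω.1.1 r) t :=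
    funext fun ω => map_stochConv hS hl hγ ω ht
  rw [h]
  exact (K.continuous.measurable.comp (measurable_eval_holderPath t)).sub
    (measurable_conv hS hl (fun ω => ω.1.1.continuous) measurable_eval_holderPath t)

theorem continuous_forcing (hS : IsSmoothingSemigroup S A K l) (hl : 0 ≤ l) (hγ : 0 < γ)
    (ω : HolderPath V γ) (y : V) :
    Continuous fun r => S r y + stochConv S K ω.1.1 (max r 0) :=
  (hS.continuous_apply y).add (continuous_stochConv hS hl hγ ω)

theorem solvesInverse_flow (hS : IsSmoothingSemigroup S A K l) (hγ : 0 < γ) (hC : 0 ≤ C)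
    (hCl : C < l) (hG : ∀ u v, ‖G u - G v‖ ≤ C * ‖u - v‖) (ω : HolderPath V γ) (y : V) :
    SolvesInverse S K G ω.1.1 y (fun t => flow S K G t ω y) := by
  have hl : 0 ≤ l := hC.trans hCl.le
  have hf := continuous_forcing hS hl hγ ω y
  refine ⟨continuousOn_picardLimit hS hC hCl hG hf, fun t ht => ?_⟩
  have h1 := picardLimit_eq hS hC hCl hG hf ht
  rw [max_eq_left ht] at h1
  simp only [flow]
  rw [h1]
  simp only [map_add, map_stochConv hS hl hγ ω ht]
  abel

theorem flow_eq_of_solvesInverse (hS : IsSmoothingSemigroup S A K l) (hγ : 0 < γ) (hC : 0 ≤ C)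
    (hCl : C < l) (hG : ∀ u v, ‖G u - G v‖ ≤ C * ‖u - v‖) {ω : HolderPath V γ} {y : V} {Y : ℝ → V}
    (hY : SolvesInverse S K G ω.1.1 y Y) {t : ℝ} (ht : 0 ≤ t) : Y t = flow S K G t ω y :=
  hY.unique hS (hC.trans_lt hCl) hC hG (solvesInverse_flow hS hγ hC hCl hG ω y) ht

theorem flow_zero (hS : IsSmoothingSemigroup S A K l) (hγ : 0 < γ) (hC : 0 ≤ C)
    (hCl : C < l) (hG : ∀ u v, ‖G u - G v‖ ≤ C * ‖u - v‖) (ω : HolderPath V γ) (y : V) :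
    flow S K G 0 ω y = y :=
  (solvesInverse_flow hS hγ hC hCl hG ω y).initial hS ω.1.2

theorem flow_add (hS : IsSmoothingSemigroup S A K l) (hγ : 0 < γ) (hC : 0 ≤ C)
    (hCl : C < l) (hG : ∀ u v, ‖G u - G v‖ ≤ C * ‖u - v‖) (ω : HolderPath V γ) (y : V) {t τ : ℝ}
    (ht : 0 ≤ t) (hτ : 0 ≤ τ) :
    flow S K G (t + τ) ω y = flow S K G t (shift τ ω) (flow S K G τ ω y) := by
  have h := (solvesInverse_flow hS hγ hC hCl hG ω y).shift hS (hC.trans hCl.le) hG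
    ω.1.1.continuous hτ
  exact flow_eq_of_solvesInverse hS hγ hC hCl hG (ω := shift τ ω) h ht

theorem norm_flow_sub_flow_le (hS : IsSmoothingSemigroup S A K l) (hγ : 0 < γ) (hC : 0 ≤ C)
    (hCl : C < l) (hG : ∀ u v, ‖G u - G v‖ ≤ C * ‖u - v‖) (ω : HolderPath V γ) (y₁ y₂ : V) {t : ℝ}
    (ht : 0 ≤ t) :
    ‖flow S K G t ω y₁ - flow S K G t ω y₂‖ ≤ Real.exp (-((l - C) * t)) * ‖y₁ - y₂‖ :=
  (solvesInverse_flow hS hγ hC hCl hG ω y₁).norm_sub_le hS (hC.trans_lt hCl) hC hG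
    (solvesInverse_flow hS hγ hC hCl hG ω y₂) ht

theorem norm_flow_zero_le (hS : IsSmoothingSemigroup S A K l) (hγ : 0 < γ) (hC : 0 ≤ C)
    (hCl : C < l) (hG : ∀ u v, ‖G u - G v‖ ≤ C * ‖u - v‖) (ω : HolderPath V γ) {T L : ℝ}
    (hT : 0 ≤ T)
    (hL : ∀ r ∈ Icc 0 T, ∀ s ∈ Icc 0 T, ‖ω.1.1 r - ω.1.1 s‖ ≤ L * |r - s| ^ (γ : ℝ)) :
    ‖flow S K G T ω 0‖ ≤ (l * (L * T ^ (γ : ℝ) * (1 + (γ : ℝ)⁻¹)) + ‖G 0‖) / (l - C) :=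
  (solvesInverse_flow hS hγ hC hCl hG ω 0).norm_le hS hC hCl hG
    (fun _ ht => map_stochConv hS (hC.trans hCl.le) hγ ω ht.1)
    (fun _ ht => norm_stochConv_le hS (hC.trans hCl.le) hγ ω hL ht) hT

theorem measurable_flow [TopologicalSpace.SeparableSpace V] [MeasurableSpace V] [BorelSpace V]
    (hS : IsSmoothingSemigroup S A K l) (hγ : 0 < γ) (hC : 0 ≤ C)
    (hCl : C < l) (hG : ∀ u v, ‖G u - G v‖ ≤ C * ‖u - v‖) :
    Measurable fun p : ℝ≥0 × HolderPath V γ × V => flow S K G p.1 p.2.1 p.2.2 := by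
  have hl : 0 ≤ l := hC.trans hCl.le
  refine measurable_uncurry_of_continuous_of_measurable
    (u := fun (t : ℝ≥0) (p : HolderPath V γ × V) => flow S K G t p.1 p.2) (fun p => ?_)
    (fun t => ?_)
  · exact (solvesInverse_flow hS hγ hC hCl hG p.1 p.2).continuousOn.comp_continuous
      NNReal.continuous_coe fun t => mem_Ici.2 t.2
  · refine measurable_picardLimit hS hC hCl hG
      (f := fun r (p : HolderPath V γ × V) => S r p.2 + stochConv S K p.1.1.1 (max r 0))
      (fun p => continuous_forcing hS hl hγ p.1 p.2) (fun r => ?_) t.2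
    exact ((S r).continuous.measurable.comp measurable_snd).add
      ((measurable_stochConv hS hl hγ (le_max_right r 0)).comp measurable_fst)

end Semigroup

end

section

/-! ### Temperedness -/

section Tempered

theorem tendsto_posLog_div_abs {f : ℝ → ℝ} {D a : ℝ} {k : ℕ} (hf0 : ∀ t, 0 ≤ f t)
    (hf : ∀ t, f t ≤ D * (a + |t|) ^ k) {l : Filter ℝ} (hl : Tendsto (fun t : ℝ => |t|) l atTop) :
    Tendsto (fun t => Real.posLog (f t) / |t|) l (𝓝 0) := by
  have hlog : Tendsto (fun u : ℝ => Real.log (a + u) / u) atTop (𝓝 0) := by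
    have h1 : Tendsto (fun u : ℝ => Real.log (a + u) / (a + u)) atTop (𝓝 0) :=
      Real.isLittleO_log_id_atTop.tendsto_div_nhds_zero.comp
        (tendsto_atTop_add_const_left _ a tendsto_id)
    have h2 : Tendsto (fun u : ℝ => (a + u) / u) atTop (𝓝 1) := by
      have h3 : Tendsto (fun u : ℝ => a * u⁻¹ + 1) atTop (𝓝 (a * 0 + 1)) :=
        (tendsto_inv_atTop_zero.const_mul a).add_const 1
      rw [mul_zero, zero_add] at h3
      refine h3.congr' ?_
      filter_upwards [eventually_gt_atTop 0] with u hu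
      field_simp
    have h4 := h1.mul h2
    rw [zero_mul] at h4
    refine h4.congr' ?_
    filter_upwards [eventually_gt_atTop 0, eventually_gt_atTop (-a)] with u hu hua
    have : a + u ≠ 0 := by linarith
    field_simp
  have hmaj : Tendsto (fun u : ℝ => Real.log (max D 1) * u⁻¹ + k * (Real.log (a + u) / u)) atTop
      (𝓝 0) := by
    have := (tendsto_inv_atTop_zero.const_mul (Real.log (max D 1))).add (hlog.const_mul (k : ℝ))
    simpa using this
  refine squeeze_zero' (Eventually.of_forall fun t => div_nonneg Real.posLog_nonneg (abs_nonneg _))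
    ?_ (hmaj.comp hl)
  filter_upwards [hl.eventually_ge_atTop (1 - a), hl.eventually_gt_atTop 0] with t ht1 ht0
  have h1 : (1 : ℝ) ≤ a + |t| := by linarith
  have hD : (1 : ℝ) ≤ max D 1 := le_max_right _ _
  have hpk : (1 : ℝ) ≤ (a + |t|) ^ k := one_le_pow₀ h1
  have h2 : f t ≤ max D 1 * (a + |t|) ^ k :=
    (hf t).trans (mul_le_mul_of_nonneg_right (le_max_left _ _) (by positivity))
  have h3 : Real.posLog (f t) ≤ Real.log (max D 1) + k * Real.log (a + |t|) := by
    refine (Real.posLog_le_posLog (hf0 t) h2).trans (le_of_eq ?_)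
    have h4 : 1 ≤ max D 1 * (a + |t|) ^ k := one_le_mul_of_one_le_of_one_le hD hpk
    rw [Real.posLog_eq_log (h4.trans (le_abs_self _)),
      Real.log_mul (by positivity) (by positivity), Real.log_pow]
  simp only [Function.comp_apply]
  calc Real.posLog (f t) / |t| ≤ (Real.log (max D 1) + k * Real.log (a + |t|)) / |t| := by gcongr
    _ = _ := by ring

/-- A tempered function grows slower than every exponential. -/
theorem tendsto_exp_neg_mul_of_posLog {f : ℝ → ℝ} (hf0 : ∀ t, 0 ≤ f t)
    (hf : Tendsto (fun t => Real.posLog (f t) / |t|) atBot (𝓝 0)) {η : ℝ} (hη : 0 < η) :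
    Tendsto (fun t : ℝ => Real.exp (-(η * t)) * f (-t)) atTop (𝓝 0) := by
  have hf' := hf.comp tendsto_neg_atTop_atBot
  have hmaj : Tendsto (fun t : ℝ => Real.exp (-(η / 2 * t))) atTop (𝓝 0) :=
    Real.tendsto_exp_neg_atTop_nhds_zero.comp (tendsto_id.const_mul_atTop (half_pos hη))
  refine squeeze_zero' (Eventually.of_forall fun t => mul_nonneg (Real.exp_pos _).le (hf0 _))
    ?_ hmaj
  filter_upwards [hf'.eventually_lt_const (half_pos hη), eventually_gt_atTop 0] with t ht ht0
  simp only [Function.comp_apply, abs_neg, abs_of_pos ht0] at ht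
  rw [div_lt_iff₀ ht0] at ht
  have h1 : f (-t) ≤ Real.exp (η / 2 * t) := by
    rcases (hf0 (-t)).eq_or_lt with h0 | h0
    · rw [← h0]; positivity
    · rw [← Real.log_le_iff_le_exp h0]
      refine le_trans ?_ ht.le
      rw [Real.posLog_def]
      exact le_max_right _ _
  calc Real.exp (-(η * t)) * f (-t) ≤ Real.exp (-(η * t)) * Real.exp (η / 2 * t) := by gcongr
    _ = Real.exp (-(η / 2 * t)) := by rw [← Real.exp_add]; ring_nf

theorem TemperedAt.comp_div {Ω : Type*} {θ : ℝ → Ω → Ω} {X : Ω → ℝ} {ω : Ω}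
    (h : TemperedAt θ X ω) {c : ℝ} (hc : 0 < c) : TemperedAt (fun t => θ (t / c)) X ω := by
  have key : ∀ t : ℝ, Real.posLog (X (θ (t / c) ω)) / |t| =
      c⁻¹ * (Real.posLog (X (θ (t / c) ω)) / |t / c|) := fun t => by
    rw [abs_div, abs_of_pos hc]
    field_simp
  constructor
  · simp only [key]
    have := (h.1.comp (tendsto_id.atTop_div_const hc)).const_mul c⁻¹
    simpa using this
  · simp only [key]
    have := (h.2.comp (tendsto_id.atBot_div_const hc)).const_mul c⁻¹
    simpa using this

end Tempered

/-! ### Paths with polynomially growing Hölder norms -/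

section Growth

variable {V : Type*} [NormedAddCommGroup V]

/-- The `γ`-Hölder seminorm of `ω` on `[-n, n]` grows at most quadratically in `n`. -/
def HasHolderGrowth (γ : ℝ) (ω : ℝ → V) : Prop :=
  ∃ C : ℕ, ∀ n : ℕ, ∀ r ∈ Icc (-n : ℝ) n, ∀ s ∈ Icc (-n : ℝ) n,
    ‖ω r - ω s‖ ≤ C * (1 + n) ^ 2 * |r - s| ^ γ

theorem HasHolderGrowth.exists_shift_bound {γ : ℝ} {ω : ℝ → V} (h : HasHolderGrowth γ ω) :
    ∃ C : ℝ, 0 ≤ C ∧ ∀ a T : ℝ, 0 ≤ T → ∀ r ∈ Icc 0 T, ∀ s ∈ Icc 0 T,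
      ‖ω (r + a) - ω (s + a)‖ ≤ C * (2 + |a| + T) ^ 2 * |r - s| ^ γ := by
  obtain ⟨C, hC⟩ := h
  refine ⟨C, Nat.cast_nonneg C, fun a T hT r hr s hs => ?_⟩
  have hn := Nat.le_ceil (|a| + T)
  have hn' := Nat.ceil_lt_add_one (a := |a| + T) (by positivity)
  have hmem : ∀ r ∈ Icc 0 T, r + a ∈ Icc (-(⌈|a| + T⌉₊ : ℝ)) ⌈|a| + T⌉₊ := fun r hr => by
    have := neg_abs_le a
    have := le_abs_self a
    constructor <;> linarith [hr.1, hr.2]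
  refine (hC _ _ (hmem r hr) _ (hmem s hs)).trans ?_
  rw [add_sub_add_right_eq_sub]
  exact mul_le_mul_of_nonneg_right (mul_le_mul_of_nonneg_left
    (pow_le_pow_left₀ (by positivity) (by linarith) 2) (Nat.cast_nonneg C)) (by positivity)

theorem HasHolderGrowth.shift {γ : ℝ} {ω : ℝ → V} (h : HasHolderGrowth γ ω) (t : ℝ) :
    HasHolderGrowth γ fun s => ω (s + t) - ω t := by
  obtain ⟨C, hC⟩ := h
  refine ⟨C * (1 + ⌈|t|⌉₊) ^ 2, fun n r hr s hs => ?_⟩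
  have hk := Nat.le_ceil |t|
  have hmem : ∀ r ∈ Icc (-n : ℝ) n,
      r + t ∈ Icc (-((n + ⌈|t|⌉₊ : ℕ) : ℝ)) ((n + ⌈|t|⌉₊ : ℕ) : ℝ) := fun r hr => by
    have := neg_abs_le t
    have := le_abs_self t
    push_cast
    constructor <;> linarith [hr.1, hr.2]
  have := hC _ _ (hmem r hr) _ (hmem s hs)
  rw [add_sub_add_right_eq_sub] at this
  rw [sub_sub_sub_cancel_right]
  refine this.trans ?_
  push_cast
  rw [mul_assoc (C : ℝ) ((1 + (⌈|t|⌉₊ : ℝ)) ^ 2), ← mul_pow]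
  refine mul_le_mul_of_nonneg_right (mul_le_mul_of_nonneg_left
    (pow_le_pow_left₀ (by positivity) ?_ 2) (Nat.cast_nonneg C)) (by positivity)
  nlinarith [Nat.cast_nonneg (α := ℝ) n, Nat.cast_nonneg (α := ℝ) ⌈|t|⌉₊]

theorem HasHolderGrowth.isLocallyHolder {γ : ℝ≥0} {ω : ℝ → V} (h : HasHolderGrowth γ ω) :
    IsLocallyHolder γ ω := by
  obtain ⟨C, hC⟩ := h
  intro a b
  set n := ⌈max |a| |b|⌉₊
  have hn : max |a| |b| ≤ n := Nat.le_ceil _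
  have hmem : ∀ r ∈ Icc a b, r ∈ Icc (-n : ℝ) n := fun r hr => by
    have := neg_abs_le a
    have := le_abs_self b
    have := le_max_left |a| |b|
    have := le_max_right |a| |b|
    constructor <;> linarith [hr.1, hr.2]
  refine ⟨C * (1 + n) ^ 2, fun r hr s hs => ?_⟩
  have := hC n r (hmem r hr) s (hmem s hs)
  rw [← Real.dist_eq, ← dist_eq_norm] at this
  rw [edist_dist, edist_dist, ENNReal.ofReal_rpow_of_nonneg dist_nonneg (NNReal.coe_nonneg γ),
    ← ENNReal.ofReal_coe_nnreal, ← ENNReal.ofReal_mul (NNReal.coe_nonneg _)]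
  exact ENNReal.ofReal_le_ofReal (by simpa using this)

theorem measurableSet_hasHolderGrowth (γ : ℝ) :
    MeasurableSet {ω : C0Path V | HasHolderGrowth γ ω.1} := by
  simp only [HasHolderGrowth, ofPred_exists]
  refine MeasurableSet.iUnion fun C => IsClosed.measurableSet ?_
  simp only [ofPred_forall]
  refine isClosed_iInter fun n => isClosed_iInter fun r => isClosed_iInter fun _ =>
    isClosed_iInter fun s => isClosed_iInter fun _ => ?_
  exact isClosed_le ((continuous_eval_c0Path r).sub (continuous_eval_c0Path s)).norm
    continuous_const

theorem measurableSet_isLocallyHolder (γ : ℝ≥0) :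
    MeasurableSet {ω : C0Path V | IsLocallyHolder γ (ω.1 : ℝ → V)} := by
  have h : {ω : C0Path V | IsLocallyHolder γ (ω.1 : ℝ → V)} =
      ⋂ n : ℕ, ⋃ C : ℕ, {ω : C0Path V | HolderOnWith C γ (ω.1 : ℝ → V) (Icc (-n : ℝ) n)} := by
    ext ω
    simp only [mem_ofPred_eq, mem_iInter, mem_iUnion]
    constructor
    · intro h n
      obtain ⟨C, hC⟩ := h (-n) n
      obtain ⟨N, hN⟩ := exists_nat_ge C
      exact ⟨N, fun r hr s hs => (hC r hr s hs).trans (by gcongr)⟩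
    · intro h a b
      obtain ⟨C, hC⟩ := h ⌈max |a| |b|⌉₊
      refine ⟨C, hC.mono fun r hr => ?_⟩
      have hn : max |a| |b| ≤ ⌈max |a| |b|⌉₊ := Nat.le_ceil _
      have := neg_abs_le a
      have := le_abs_self b
      have := le_max_left |a| |b|
      have := le_max_right |a| |b|
      constructor <;> linarith [hr.1, hr.2]
  rw [h]
  refine MeasurableSet.iInter fun n => MeasurableSet.iUnion fun C => IsClosed.measurableSet ?_
  simp only [HolderOnWith, ofPred_forall]
  refine isClosed_iInter fun r => isClosed_iInter fun _ =>
    isClosed_iInter fun s => isClosed_iInter fun _ => ?_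
  exact isClosed_le ((continuous_eval_c0Path r).edist (continuous_eval_c0Path s))
    continuous_const

end Growth

end

section

/-! ### The random fixed point -/

theorem summable_cube_mul_exp {ρ : ℝ} (hρ : 0 < ρ) :
    Summable fun n : ℕ => (1 + n : ℝ) ^ 3 * Real.exp (-(ρ * n)) := by
  have h := (summable_nat_add_iff 1).2 (Real.summable_pow_mul_exp_neg_nat_mul 3 hρ)
  refine (h.mul_left (Real.exp ρ)).congr fun n => ?_
  push_cast
  rw [mul_left_comm, ← Real.exp_add]
  ring_nf

variable {V : Type*} [NormedAddCommGroup V] [InnerProductSpace ℝ V]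

/-- The pullback limit `lim φ(n, θ_{-n} ω, 0)`. -/
def pullbackLimit {γ : ℝ≥0} (S : ℝ → V →L[ℝ] V) (K : V →L[ℝ] V) (G : V → V)
    (ω : HolderPath V γ) : V :=
  limUnder atTop fun n : ℕ => flow S K G n (shift (-n) ω) 0

variable [CompleteSpace V] {S A : ℝ → V →L[ℝ] V} {K : V →L[ℝ] V} {l C : ℝ} {G : V → V} {γ : ℝ≥0}

theorem measurable_pullbackLimit [TopologicalSpace.SeparableSpace V] [MeasurableSpace V]
    [BorelSpace V] (hS : IsSmoothingSemigroup S A K l) (hγ : 0 < γ) (hC : 0 ≤ C)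
    (hCl : C < l) (hG : ∀ u v, ‖G u - G v‖ ≤ C * ‖u - v‖) :
    Measurable (pullbackLimit (γ := γ) S K G) := by
  have h : ∀ n : ℕ, StronglyMeasurable fun ω : HolderPath V γ =>
      flow S K G (n : ℝ) (shift (-(n : ℝ)) ω) 0 := fun n => by
    have hs : Measurable fun ω : HolderPath V γ => shift (-(n : ℝ)) ω :=
      measurable_shift.comp measurable_prodMk_left
    have hp : Measurable fun ω : HolderPath V γ =>
        (((n : ℝ≥0), shift (-(n : ℝ)) ω, (0 : V)) : ℝ≥0 × HolderPath V γ × V) :=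
      measurable_const.prodMk (hs.prodMk measurable_const)
    exact ((measurable_flow (γ := γ) hS hγ hC hCl hG).comp hp).stronglyMeasurable
  exact (StronglyMeasurable.limUnder h).measurable

/-- Starting from `0` on the orbit of a path of polynomial Hölder growth, solutions grow at most
polynomially. -/
theorem exists_norm_flow_shift_le (hS : IsSmoothingSemigroup S A K l) (hγ : 0 < γ) (hγ1 : γ ≤ 1)
    (hC : 0 ≤ C) (hCl : C < l) (hG : ∀ u v, ‖G u - G v‖ ≤ C * ‖u - v‖) {ω : HolderPath V γ}
    (hω : HasHolderGrowth γ ω.1.1) :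
    ∃ D : ℝ, 0 ≤ D ∧ ∀ a T : ℝ, 0 ≤ T →
      ‖flow S K G T (shift a ω) 0‖ ≤ D * (2 + |a| + T) ^ 3 := by
  obtain ⟨M, hM, hb⟩ := hω.exists_shift_bound
  have hl : 0 < l := hC.trans_lt hCl
  have hlC : 0 < l - C := sub_pos.2 hCl
  refine ⟨(l * (M * (1 + (γ : ℝ)⁻¹)) + ‖G 0‖) / (l - C), by positivity, fun a T hT => ?_⟩
  have h1 := norm_flow_zero_le hS hγ hC hCl hG (shift a ω) hT (L := M * (2 + |a| + T) ^ 2)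
    fun r hr s hs => by
      have := hb a T hT r hr s hs
      rwa [shift_apply, shift_apply, sub_sub_sub_cancel_right]
  refine h1.trans ?_
  rw [div_mul_eq_mul_div]
  set u := 2 + |a| + T with hu
  have hu1 : 1 ≤ u := by
    have := abs_nonneg a
    linarith
  have hTu : T ^ (γ : ℝ) ≤ u := by
    have hTu' : T ≤ u := by
      have := abs_nonneg a
      linarith
    refine (Real.rpow_le_rpow hT hTu' γ.2).trans ?_
    exact (Real.rpow_le_rpow_of_exponent_le hu1 (show (γ : ℝ) ≤ 1 from hγ1)).trans
      (Real.rpow_one u).le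
  have hG3 : ‖G 0‖ ≤ ‖G 0‖ * u ^ 3 := le_mul_of_one_le_right (norm_nonneg _) (one_le_pow₀ hu1)
  have hmain : M * u ^ 2 * T ^ (γ : ℝ) ≤ M * u ^ 2 * u := by gcongr
  refine div_le_div_of_nonneg_right ?_ hlC.le
  have h2 : l * (M * u ^ 2 * T ^ (γ : ℝ) * (1 + (γ : ℝ)⁻¹)) ≤
      l * (M * u ^ 2 * u * (1 + (γ : ℝ)⁻¹)) := by gcongr
  nlinarith

/-- The pullback process is Cauchy at an exponential rate, up to polynomial factors. -/
theorem exists_norm_pullback_sub_le (hS : IsSmoothingSemigroup S A K l) (hγ : 0 < γ)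
    (hγ1 : γ ≤ 1) (hC : 0 ≤ C) (hCl : C < l) (hG : ∀ u v, ‖G u - G v‖ ≤ C * ‖u - v‖)
    {ω : HolderPath V γ} (hω : HasHolderGrowth γ ω.1.1) :
    ∃ D : ℝ, 0 ≤ D ∧ ∀ (a τ : ℝ), 0 ≤ τ → ∀ n : ℕ,
      ‖flow S K G (n + τ) (shift (-(n + τ)) (shift a ω)) 0 -
        flow S K G n (shift (-n) (shift a ω)) 0‖ ≤
        D * (2 + |a| + 2 * τ) ^ 3 * ((1 + n) ^ 3 * Real.exp (-((l - C) * n))) := by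
  obtain ⟨D, hD, hb⟩ := exists_norm_flow_shift_le hS hγ hγ1 hC hCl hG hω
  refine ⟨D, hD, fun a τ hτ n => ?_⟩
  have hn : (0 : ℝ) ≤ n := Nat.cast_nonneg n
  rw [flow_add hS hγ hC hCl hG _ 0 hn hτ, ← shift_add τ]
  have h0 : τ + -(n + τ) = -(n : ℝ) := by ring
  rw [h0]
  refine (norm_flow_sub_flow_le hS hγ hC hCl hG _ _ _ hn).trans ?_
  rw [sub_zero, ← shift_add]
  have h1 := hb (-(n + τ) + a) τ hτ
  have h2 : 2 + |-(n + τ) + a| + τ ≤ (2 + |a| + 2 * τ) * (1 + n) := by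
    have h3 := abs_add_le (-(n + τ)) a
    rw [abs_neg, abs_of_nonneg (add_nonneg hn hτ)] at h3
    nlinarith [abs_nonneg a, mul_nonneg (abs_nonneg a) hn, mul_nonneg hτ hn]
  have h4 : D * (2 + |-(n + τ) + a| + τ) ^ 3 ≤ D * ((2 + |a| + 2 * τ) * (1 + n)) ^ 3 := by
    gcongr
  calc _ ≤ Real.exp (-((l - C) * n)) * (D * ((2 + |a| + 2 * τ) * (1 + n)) ^ 3) := by
        gcongr
        exact h1.trans h4
    _ = _ := by ring

theorem tendsto_pullbackLimit (hS : IsSmoothingSemigroup S A K l) (hγ : 0 < γ)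
    (hγ1 : γ ≤ 1) (hC : 0 ≤ C) (hCl : C < l) (hG : ∀ u v, ‖G u - G v‖ ≤ C * ‖u - v‖)
    {ω : HolderPath V γ} (hω : HasHolderGrowth γ ω.1.1) :
    (∀ a : ℝ, Tendsto (fun n : ℕ => flow S K G n (shift (-n) (shift a ω)) 0) atTop
      (𝓝 (pullbackLimit S K G (shift a ω)))) ∧
    ∃ D : ℝ, ∀ a : ℝ, ‖pullbackLimit S K G (shift a ω)‖ ≤ D * (4 + |a|) ^ 3 := by
  obtain ⟨D, hD, hb⟩ := exists_norm_pullback_sub_le hS hγ hγ1 hC hCl hG hω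
  have hsum := summable_cube_mul_exp (sub_pos.2 hCl)
  have hd : ∀ (a : ℝ) (n : ℕ), dist (flow S K G n (shift (-n) (shift a ω)) 0)
      (flow S K G (n.succ : ℕ) (shift (-(n.succ : ℕ)) (shift a ω)) 0) ≤
      D * (4 + |a|) ^ 3 * ((1 + n) ^ 3 * Real.exp (-((l - C) * n))) := fun a n => by
    have := hb a 1 zero_le_one n
    rw [dist_comm, dist_eq_norm, Nat.succ_eq_add_one, Nat.cast_add, Nat.cast_one]
    refine this.trans (le_of_eq ?_)
    ring
  have hlim : ∀ a : ℝ, Tendsto (fun n : ℕ => flow S K G n (shift (-n) (shift a ω)) 0) atTop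
      (𝓝 (pullbackLimit S K G (shift a ω))) := fun a =>
    tendsto_nhds_limUnder (cauchySeq_tendsto_of_complete
      (cauchySeq_of_dist_le_of_summable _ (hd a) (hsum.mul_left _)))
  refine ⟨hlim, D * ∑' n : ℕ, ((1 + n : ℝ) ^ 3 * Real.exp (-((l - C) * n))), fun a => ?_⟩
  have := dist_le_tsum_of_dist_le_of_tendsto₀ _ (hd a) (hsum.mul_left _) (hlim a)
  rw [Nat.cast_zero, flow_zero hS hγ hC hCl hG, dist_zero_left, tsum_mul_left] at this
  refine this.trans (le_of_eq ?_)
  ring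

/-- The pullback limit is a random fixed point. -/
theorem flow_pullbackLimit (hS : IsSmoothingSemigroup S A K l) (hγ : 0 < γ)
    (hγ1 : γ ≤ 1) (hC : 0 ≤ C) (hCl : C < l) (hG : ∀ u v, ‖G u - G v‖ ≤ C * ‖u - v‖)
    {ω : HolderPath V γ} (hω : HasHolderGrowth γ ω.1.1) {t : ℝ} (ht : 0 ≤ t) :
    flow S K G t ω (pullbackLimit S K G ω) = pullbackLimit S K G (shift t ω) := by
  obtain ⟨hlim, -⟩ := tendsto_pullbackLimit hS hγ hγ1 hC hCl hG hω
  obtain ⟨D, hD, hb⟩ := exists_norm_pullback_sub_le hS hγ hγ1 hC hCl hG hω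
  have hcont : Continuous (flow S K G t ω) := by
    refine (LipschitzWith.of_dist_le' (K := Real.exp (-((l - C) * t))) fun u v => ?_).continuous
    rw [dist_eq_norm, dist_eq_norm]
    exact norm_flow_sub_flow_le hS hγ hC hCl hG ω u v ht
  have h0 := hlim 0
  rw [shift_zero] at h0
  have h1 := (hcont.tendsto _).comp h0
  have h2 : ∀ n : ℕ, (flow S K G t ω ∘ fun n : ℕ => flow S K G n (shift (-n) ω) 0) n =
      flow S K G (n + t) (shift (-(n + t)) (shift t ω)) 0 := fun n => by
    have h3 := flow_add hS hγ hC hCl hG (shift (-n) ω) 0 ht (Nat.cast_nonneg n)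
    rw [← shift_add, add_neg_cancel, shift_zero] at h3
    rw [← shift_add, Function.comp_apply, ← h3, add_comm t]
    congr 2
    ring
  rw [funext h2] at h1
  refine tendsto_nhds_unique h1 ?_
  have h4 := (summable_cube_mul_exp (sub_pos.2 hCl)).tendsto_atTop_zero.const_mul
    (D * (2 + |t| + 2 * t) ^ 3)
  rw [mul_zero] at h4
  have h5 := (squeeze_zero_norm (hb t t ht) h4).add (hlim t)
  simpa using h5

end

section

/-! ### Hölder continuity from dyadic increments -/

section Dyadic

variable {V : Type*} [NormedAddCommGroup V] {f : ℝ → V} {D q : ℝ} {n : ℕ}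

theorem neg_mul_two_pow_le_floor {r : ℝ} (hr : -(n : ℝ) ≤ r) (m : ℕ) :
    -((n * 2 ^ m : ℕ) : ℤ) ≤ ⌊r * 2 ^ m⌋ := by
  rw [Int.le_floor]
  push_cast
  rw [← neg_mul]
  gcongr

theorem floor_le_mul_two_pow {r : ℝ} (hr : r ≤ n) (m : ℕ) :
    ⌊r * 2 ^ m⌋ ≤ ((n * 2 ^ m : ℕ) : ℤ) := by
  have h1 : ((⌊r * 2 ^ m⌋ : ℤ) : ℝ) ≤ ((n * 2 ^ m : ℕ) : ℝ) := by
    refine (Int.floor_le _).trans ?_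
    push_cast
    gcongr
  exact_mod_cast h1

theorem tendsto_dyadic_floor (r : ℝ) :
    Tendsto (fun m : ℕ => (⌊r * 2 ^ m⌋ : ℝ) / 2 ^ m) atTop (𝓝 r) := by
  have h0 : Tendsto (fun m : ℕ => r - (1 / 2 : ℝ) ^ m) atTop (𝓝 r) := by
    simpa using (tendsto_pow_atTop_nhds_zero_of_lt_one (r := (1 / 2 : ℝ)) (by norm_num)
      (by norm_num)).const_sub r
  refine tendsto_of_tendsto_of_tendsto_of_le_of_le h0 tendsto_const_nhds (fun m => ?_) fun m => ?_
  · have := Int.lt_floor_add_one (r * 2 ^ m)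
    simp only
    rw [le_div_iff₀ (by positivity), sub_mul, ← mul_pow]
    norm_num
    linarith
  · simp only
    rw [div_le_iff₀ (by positivity)]
    exact Int.floor_le _

/-- Distance from `f r` to the value of `f` at the dyadic approximation of `r` of level `m`. -/
theorem dist_dyadic_floor_le (hf : Continuous f) (hq0 : 0 ≤ q) (hq1 : q < 1)
    (hD : ∀ m : ℕ, ∀ k : ℤ, |k| ≤ n * 2 ^ m →
      ‖f ((k + 1) / 2 ^ m) - f (k / 2 ^ m)‖ ≤ D * q ^ m) {r : ℝ} (hr : r ∈ Icc (-n : ℝ) n) (m : ℕ) :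
    dist (f ((⌊r * 2 ^ m⌋ : ℝ) / 2 ^ m)) (f r) ≤ D * q / (1 - q) * q ^ m := by
  have hD0 : 0 ≤ D := by
    simpa using (norm_nonneg _).trans (hD 0 0 (by positivity))
  have hstep : ∀ m : ℕ, dist (f ((⌊r * 2 ^ m⌋ : ℝ) / 2 ^ m))
      (f ((⌊r * 2 ^ (m + 1)⌋ : ℝ) / 2 ^ (m + 1))) ≤ D * q * q ^ m := fun m => by
    have h1 := Int.floor_le (r * 2 ^ m)
    have h2 := Int.lt_floor_add_one (r * 2 ^ m)
    have h3 : (⌊r * 2 ^ m⌋ : ℝ) / 2 ^ m = ((2 * ⌊r * 2 ^ m⌋ : ℤ) : ℝ) / 2 ^ (m + 1) := by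
      push_cast
      rw [pow_succ]
      field_simp
    have hlow : 2 * ⌊r * 2 ^ m⌋ ≤ ⌊r * 2 ^ (m + 1)⌋ := by
      rw [Int.le_floor]
      push_cast
      rw [pow_succ]
      linarith
    have hup : ⌊r * 2 ^ (m + 1)⌋ < 2 * ⌊r * 2 ^ m⌋ + 2 := by
      rw [Int.floor_lt]
      push_cast
      rw [pow_succ]
      linarith
    have hcase : ⌊r * 2 ^ (m + 1)⌋ = 2 * ⌊r * 2 ^ m⌋ ∨
        ⌊r * 2 ^ (m + 1)⌋ = 2 * ⌊r * 2 ^ m⌋ + 1 := by omega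
    rcases hcase with h | h
    · rw [h, h3, dist_self]
      positivity
    · rw [h, h3, dist_comm, dist_eq_norm]
      have hk : |2 * ⌊r * 2 ^ m⌋| ≤ (n : ℤ) * 2 ^ (m + 1) := by
        have h4 := neg_mul_two_pow_le_floor hr.1 m
        have h5 := floor_le_mul_two_pow hr.2 m
        push_cast at h4 h5
        rw [abs_le, pow_succ]
        constructor <;> linarith
      have := hD (m + 1) _ hk
      push_cast at this ⊢
      refine this.trans (le_of_eq ?_)
      ring
  have hlim : Tendsto (fun m : ℕ => f ((⌊r * 2 ^ m⌋ : ℝ) / 2 ^ m)) atTop (𝓝 (f r)) :=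
    (hf.tendsto r).comp (tendsto_dyadic_floor r)
  refine (dist_le_of_le_geometric_of_tendsto q (D * q) hq1 hstep hlim m).trans (le_of_eq ?_)
  ring

theorem norm_sub_le_of_dyadic (hf : Continuous f) (hq0 : 0 ≤ q) (hq1 : q < 1)
    (hD : ∀ m : ℕ, ∀ k : ℤ, |k| ≤ n * 2 ^ m →
      ‖f ((k + 1) / 2 ^ m) - f (k / 2 ^ m)‖ ≤ D * q ^ m) {r s : ℝ} (hr : r ∈ Icc (-n : ℝ) n)
    (hs : s ∈ Icc (-n : ℝ) n) {m : ℕ} (hrs : r ≤ s) (hrs2 : s - r ≤ (1 / 2) ^ m) :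
    ‖f r - f s‖ ≤ D * (1 + 2 * (q / (1 - q))) * q ^ m := by
  have hD0 : 0 ≤ D := by
    simpa using (norm_nonneg _).trans (hD 0 0 (by positivity))
  have h2m : (0 : ℝ) < 2 ^ m := by positivity
  have hmid : dist (f ((⌊r * 2 ^ m⌋ : ℝ) / 2 ^ m)) (f ((⌊s * 2 ^ m⌋ : ℝ) / 2 ^ m)) ≤ D * q ^ m := by
    have hlow : ⌊r * 2 ^ m⌋ ≤ ⌊s * 2 ^ m⌋ := Int.floor_mono (by gcongr)
    have hup : ⌊s * 2 ^ m⌋ < ⌊r * 2 ^ m⌋ + 2 := by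
      rw [Int.floor_lt]
      push_cast
      have h1 := Int.lt_floor_add_one (r * 2 ^ m)
      have h2 := mul_le_mul_of_nonneg_right hrs2 h2m.le
      rw [← mul_pow, sub_mul] at h2
      norm_num at h2
      linarith
    have hcase : ⌊s * 2 ^ m⌋ = ⌊r * 2 ^ m⌋ ∨ ⌊s * 2 ^ m⌋ = ⌊r * 2 ^ m⌋ + 1 := by omega
    rcases hcase with h | h
    · rw [h, dist_self]
      positivity
    · rw [h, dist_comm, dist_eq_norm]
      have hk : |⌊r * 2 ^ m⌋| ≤ (n : ℤ) * 2 ^ m := by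
        have h4 := neg_mul_two_pow_le_floor hr.1 m
        have h5 := floor_le_mul_two_pow hr.2 m
        push_cast at h4 h5
        rw [abs_le]
        constructor <;> linarith
      simpa using hD m _ hk
  have h1 := dist_dyadic_floor_le hf hq0 hq1 hD hr m
  have h2 := dist_dyadic_floor_le hf hq0 hq1 hD hs m
  rw [dist_comm] at h1
  rw [← dist_eq_norm]
  refine (dist_triangle4 _ _ _ _).trans ((add_le_add_three h1 hmid h2).trans (le_of_eq ?_))
  ring

/-- A continuous function whose dyadic increments of level `m` in `[-n, n]` are at most
`D 2^{-γ m}` is `γ`-Hölder on `[-n, n]`. -/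
theorem holder_of_dyadic (hf : Continuous f) {γ : ℝ} (hγ : 0 < γ)
    (hD : ∀ m : ℕ, ∀ k : ℤ, |k| ≤ n * 2 ^ m →
      ‖f ((k + 1) / 2 ^ m) - f (k / 2 ^ m)‖ ≤ D * ((1 / 2 : ℝ) ^ γ) ^ m) {r s : ℝ}
    (hr : r ∈ Icc (-n : ℝ) n) (hs : s ∈ Icc (-n : ℝ) n) :
    ‖f r - f s‖ ≤ (2 * n + 1) * (D * (1 + 2 * ((1 / 2 : ℝ) ^ γ / (1 - (1 / 2 : ℝ) ^ γ))) * 2 ^ γ) *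
      |r - s| ^ γ := by
  have hD0 : 0 ≤ D := by
    simpa using (norm_nonneg _).trans (hD 0 0 (by positivity))
  set q : ℝ := (1 / 2 : ℝ) ^ γ with hq
  have hq0 : 0 < q := by positivity
  have hq1 : q < 1 := Real.rpow_lt_one (by norm_num) (by norm_num) hγ
  have hq2 : 2 ^ γ * q = 1 := by
    rw [hq, ← Real.mul_rpow (by norm_num) (by norm_num)]
    norm_num
  have h1q : 0 < 1 - q := sub_pos.2 hq1
  set M : ℝ := D * (1 + 2 * (q / (1 - q))) * 2 ^ γ with hM
  have hM0 : 0 ≤ M := by positivity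
  -- short distances: compare with the dyadic level of size `|r - s|`
  have hshort : ∀ r ∈ Icc (-n : ℝ) n, ∀ s ∈ Icc (-n : ℝ) n, r ≤ s → s - r ≤ 1 →
      ‖f r - f s‖ ≤ M * (s - r) ^ γ := fun r hr s hs hrs h1 => by
    rcases hrs.eq_or_lt with rfl | hlt
    · simp [Real.zero_rpow hγ.ne']
    · obtain ⟨m, hm1, hm2⟩ := exists_nat_pow_near_of_lt_one (sub_pos.2 hlt) h1
        (y := (1 / 2 : ℝ)) (by norm_num) (by norm_num)
      refine (norm_sub_le_of_dyadic hf hq0.le hq1 hD hr hs hrs hm2).trans ?_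
      have h3 : q ^ (m + 1) ≤ (s - r) ^ γ := by
        rw [hq, ← Real.rpow_natCast, ← Real.rpow_mul (by norm_num), mul_comm, Real.rpow_mul
          (by norm_num), Real.rpow_natCast]
        exact Real.rpow_le_rpow (by positivity) hm1.le hγ.le
      have h4 : q ^ m = 2 ^ γ * q ^ (m + 1) := by
        rw [pow_succ, mul_left_comm, hq2, mul_one]
      rw [h4, ← mul_assoc]
      exact mul_le_mul_of_nonneg_left h3 hM0
  -- long distances: split into `2 n + 1` equal steps of size at most `1`
  have hlong : ∀ r ∈ Icc (-n : ℝ) n, ∀ s ∈ Icc (-n : ℝ) n, r ≤ s →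
      ‖f r - f s‖ ≤ (2 * n + 1) * M * (s - r) ^ γ := fun r hr s hs hrs => by
    have hN : (0 : ℝ) < 2 * n + 1 := by positivity
    set h : ℝ := (s - r) / (2 * n + 1) with hh
    have hh0 : 0 ≤ h := div_nonneg (sub_nonneg.2 hrs) hN.le
    have hh1 : h ≤ 1 := by
      rw [hh, div_le_one hN]
      linarith [hr.1, hs.2]
    have hhs : h ≤ s - r := div_le_self (sub_nonneg.2 hrs) (by linarith)
    have hNh : (2 * n + 1) * h = s - r := by
      rw [hh]
      field_simp
    have hmem : ∀ i : ℕ, i ≤ 2 * n + 1 → r + i * h ∈ Icc (-n : ℝ) n := fun i hi => by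
      have h5 : (i : ℝ) ≤ 2 * n + 1 := by exact_mod_cast hi
      have h6 := mul_le_mul_of_nonneg_right h5 hh0
      have h7 : 0 ≤ i * h := by positivity
      constructor <;> linarith [hr.1, hs.2]
    have hsum := dist_le_range_sum_dist (fun i : ℕ => f (r + i * h)) (2 * n + 1)
    have hend : r + ((2 * n + 1 : ℕ) : ℝ) * h = s := by
      push_cast
      linarith
    simp only [hend, Nat.cast_zero, zero_mul, add_zero] at hsum
    rw [← dist_eq_norm]
    refine hsum.trans ((Finset.sum_le_card_nsmul _ _ (M * (s - r) ^ γ) fun i hi => ?_).trans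
      (le_of_eq ?_))
    · rw [Finset.mem_range] at hi
      rw [dist_eq_norm]
      refine (hshort _ (hmem i hi.le) _ (hmem (i + 1) hi) ?_ ?_).trans ?_
      · push_cast
        linarith
      · push_cast
        linarith
      · refine mul_le_mul_of_nonneg_left (Real.rpow_le_rpow ?_ ?_ hγ.le) hM0
        · push_cast
          linarith
        · push_cast
          linarith
    · rw [Finset.card_range, nsmul_eq_mul]
      push_cast
      ring
  rcases le_total r s with hrs | hrs
  · rw [abs_sub_comm, abs_of_nonneg (sub_nonneg.2 hrs)]
    exact hlong r hr s hs hrs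
  · rw [norm_sub_rev, abs_of_nonneg (sub_nonneg.2 hrs)]
    exact hlong s hs r hr hrs

end Dyadic

end

section

/-! ### Laws on the path space -/

/-- The linear observable `ω ↦ ∑ i, ⟨ω(t i), v i⟩`. -/
def linObs {V : Type*} [NormedAddCommGroup V] [InnerProductSpace ℝ V] {ι : Type} [Fintype ι]
    (t : ι → ℝ) (v : ι → V) (ω : C0Path V) : ℝ :=
  ∑ i, inner ℝ (ω.1 (t i)) (v i)

/-- The linear observable `ω ↦ ∑ i, ⟨ω(t i + τ) - ω(τ), v i⟩` of the increments after `τ`. -/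
def incObs {V : Type*} [NormedAddCommGroup V] [InnerProductSpace ℝ V] {ι : Type} [Fintype ι]
    (t : ι → ℝ) (v : ι → V) (τ : ℝ) (ω : C0Path V) : ℝ :=
  ∑ i, inner ℝ (ω.1 (t i + τ) - ω.1 τ) (v i)

section LinearObservables

variable {V : Type*} [NormedAddCommGroup V] [InnerProductSpace ℝ V] {ι : Type} [Fintype ι]

theorem continuous_linObs (t : ι → ℝ) (v : ι → V) : Continuous (linObs t v) :=
  continuous_finsetSum _ fun i _ => (continuous_eval_c0Path (t i)).inner continuous_const

theorem linObs_shiftC0 (t : ι → ℝ) (v : ι → V) (τ : ℝ) (ω : C0Path V) :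
    linObs t v (shiftC0 τ ω) = incObs t v τ ω := rfl

theorem incObs_eq_linObs (t : ι → ℝ) (v : ι → V) (τ : ℝ) (ω : C0Path V) :
    incObs t v τ ω = linObs (Sum.elim (fun i => t i + τ) (fun _ : ι => τ))
      (Sum.elim v fun i => -v i) ω := by
  simp only [incObs, linObs, Fintype.sum_sum_type, Sum.elim_inl, Sum.elim_inr, inner_neg_right,
    inner_sub_left, Finset.sum_sub_distrib, Finset.sum_neg_distrib]
  ring

theorem incObs_sub_eq_linObs (t : ι → ℝ) (v : ι → V) (τ σ : ℝ) (ω : C0Path V) :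
    incObs t v τ ω - incObs t v σ ω =
      linObs (Sum.elim (Sum.elim (fun i => t i + τ) (fun _ : ι => τ))
          (Sum.elim (fun i => t i + σ) (fun _ : ι => σ)))
        (Sum.elim (Sum.elim v fun i => -v i) (Sum.elim (fun i => -v i) v)) ω := by
  simp only [incObs, linObs, Fintype.sum_sum_type, Sum.elim_inl, Sum.elim_inr, inner_neg_right,
    inner_sub_left, Finset.sum_sub_distrib, Finset.sum_neg_distrib]
  ring

theorem continuous_incObs (t : ι → ℝ) (v : ι → V) (τ : ℝ) : Continuous (incObs t v τ) := by
  simp only [funext (incObs_eq_linObs t v τ)]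
  exact continuous_linObs _ _

end LinearObservables

section Uniqueness

variable {V : Type*} [NormedAddCommGroup V] [CompleteSpace V] [TopologicalSpace.SeparableSpace V]

instance instPolishSpaceC0Path : PolishSpace (C0Path V) :=
  IsClosed.polishSpace (isClosed_eq (continuous_eval_const (0 : ℝ)) continuous_const)

/-- By the Lusin–Souslin theorem the Borel σ-algebra of the path space is generated by the
evaluations at rational times. -/
theorem measurableEmbedding_rat_eval [MeasurableSpace V] [BorelSpace V] :
    MeasurableEmbedding fun (ω : C0Path V) (q : ℚ) => ω.1 (q : ℝ) := by
  refine Continuous.measurableEmbedding (continuous_pi fun q => continuous_eval_c0Path _) ?_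
  intro ω ω' h
  refine Subtype.ext (DFunLike.coe_injective ?_)
  exact Rat.isDenseEmbedding_coe_real.dense.equalizer ω.1.continuous ω'.1.continuous h

/-- A finite measure on the path space is determined by the characteristic functions of the linear
observables. -/
theorem measure_ext_of_linObs [InnerProductSpace ℝ V] [MeasurableSpace V] [BorelSpace V]
    {μ ν : Measure (C0Path V)} [IsFiniteMeasure μ] [IsFiniteMeasure ν]
    (h : ∀ (ι : Type) [Fintype ι] (t : ι → ℝ) (v : ι → V),
      ∫ ω, Complex.exp (linObs t v ω * Complex.I) ∂μ =
        ∫ ω, Complex.exp (linObs t v ω * Complex.I) ∂ν) : μ = ν := by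
  have he := measurableEmbedding_rat_eval (V := V)
  have hmap : μ.map (fun (ω : C0Path V) (q : ℚ) => ω.1 (q : ℝ)) =
      ν.map (fun (ω : C0Path V) (q : ℚ) => ω.1 (q : ℝ)) := by
    have hmeas : ∀ I : Finset ℚ, Measurable fun (ω : C0Path V) (q : I) => ω.1 ((q : ℚ) : ℝ) :=
      fun I => measurable_pi_lambda _ fun q => measurable_eval_c0Path _
    refine IsProjectiveLimit.unique
      (P := fun I : Finset ℚ => μ.map fun (ω : C0Path V) (q : I) => ω.1 ((q : ℚ) : ℝ))
      (fun I => ?_) (fun I => ?_)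
    · rw [Measure.map_map (by fun_prop) he.measurable]
      rfl
    · rw [Measure.map_map (by fun_prop) he.measurable]
      have : IsFiniteMeasure (μ.map fun (ω : C0Path V) (q : I) => ω.1 ((q : ℚ) : ℝ)) :=
        Measure.isFiniteMeasure_map _ _
      have : IsFiniteMeasure (ν.map fun (ω : C0Path V) (q : I) => ω.1 ((q : ℚ) : ℝ)) :=
        Measure.isFiniteMeasure_map _ _
      change ν.map (fun (ω : C0Path V) (q : I) => ω.1 ((q : ℚ) : ℝ)) =
        μ.map fun (ω : C0Path V) (q : I) => ω.1 ((q : ℚ) : ℝ)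
      refine Eq.symm (Measure.ext_of_charFunDual (E := I → V) (funext fun L => ?_))
      set v : I → V := fun q => (InnerProductSpace.toDual ℝ V).symm
        (L.comp (ContinuousLinearMap.single ℝ (fun _ : I => V) q)) with hv
      have hL : ∀ ω : C0Path V, L (fun q : I => ω.1 ((q : ℚ) : ℝ)) =
          linObs (fun q : I => ((q : ℚ) : ℝ)) v ω := fun ω => by
        have h1 : (fun q : I => ω.1 ((q : ℚ) : ℝ)) =
            ∑ q : I, Pi.single q (ω.1 ((q : ℚ) : ℝ)) := (Finset.univ_sum_single _).symm
        rw [h1, map_sum, linObs]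
        refine Finset.sum_congr rfl fun q _ => ?_
        rw [real_inner_comm, hv, InnerProductSpace.toDual_symm_apply]
        rfl
      rw [charFunDual_apply, charFunDual_apply,
        integral_map (hmeas I).aemeasurable (by fun_prop),
        integral_map (hmeas I).aemeasurable (by fun_prop)]
      simp only [hL]
      exact h I _ v
  rw [← he.comap_map μ, ← he.comap_map ν, hmap]

end Uniqueness

end

section

/-! ### Gaussian computations for fractional Brownian motion -/

/-- The covariance of the increments of a fractional Brownian motion over `[τ, τ + a]` and
`[σ, σ + b]`, as a function of `d = τ - σ`. -/
def incCov (H a b d : ℝ) : ℝ :=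
  |a + d| ^ (2 * H) + |d - b| ^ (2 * H) - |a + d - b| ^ (2 * H) - |d| ^ (2 * H)

section Asymptotics

theorem tendsto_sub_of_tendsto_deriv {f f' : ℝ → ℝ} (hf : ∀ᶠ x in atTop, HasDerivAt f (f' x) x)
    (hf' : Tendsto f' atTop (𝓝 0)) (a : ℝ) :
    Tendsto (fun x => f (x + a) - f x) atTop (𝓝 0) := by
  rw [Metric.tendsto_nhds]
  intro ε hε
  have hc : 0 < ε / (|a| + 1) := by positivity
  obtain ⟨X, hX⟩ := eventually_atTop.1 (hf.and (hf'.norm.eventually_lt_const (by simpa using hc)))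
  filter_upwards [eventually_ge_atTop (X + |a|)] with x hx
  have h1 := (convex_Ici X).norm_image_sub_le_of_norm_hasDerivWithin_le
    (fun y hy => (hX y hy).1.hasDerivWithinAt) (fun y hy => (hX y hy).2.le)
    (x := x) (y := x + a) (by have := abs_nonneg a; exact mem_Ici.2 (by linarith))
    (by have := neg_abs_le a; exact mem_Ici.2 (by linarith))
  rw [dist_zero_right]
  refine h1.trans_lt ?_
  rw [add_sub_cancel_left, Real.norm_eq_abs, div_mul_eq_mul_div, div_lt_iff₀ (by positivity)]
  nlinarith [abs_nonneg a]

/-- The increments of a fractional Brownian motion decorrelate as their distance grows. -/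
theorem tendsto_incCov {H : ℝ} (hH1 : H < 1) (a b : ℝ) :
    Tendsto (incCov H a b) atTop (𝓝 0) := by
  -- `incCov` is a second difference of `x ^ p`, whose second derivative is of order `x ^ (p - 2)`
  set p := 2 * H with hp
  have hpow : Tendsto (fun x : ℝ => (p - 1) * x ^ (p - 2)) atTop (𝓝 0) := by
    have := tendsto_rpow_neg_atTop (y := 2 - p) (by linarith)
    rw [neg_sub] at this
    simpa using this.const_mul (p - 1)
  have h1 : ∀ᶠ x : ℝ in atTop, HasDerivAt (fun x : ℝ => x ^ (p - 1)) ((p - 1) * x ^ (p - 2)) x := by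
    filter_upwards [eventually_gt_atTop 0] with x hx
    have := Real.hasDerivAt_rpow_const (p := p - 1) (Or.inl hx.ne')
    rwa [show p - 1 - 1 = p - 2 by ring] at this
  have h2 : Tendsto (fun x : ℝ => p * ((x + a) ^ (p - 1) - x ^ (p - 1))) atTop (𝓝 0) := by
    simpa using (tendsto_sub_of_tendsto_deriv h1 hpow a).const_mul p
  have h3 : ∀ᶠ x : ℝ in atTop, HasDerivAt (fun x : ℝ => (x + a) ^ p - x ^ p)
      (p * ((x + a) ^ (p - 1) - x ^ (p - 1))) x := by
    filter_upwards [eventually_gt_atTop 0, eventually_gt_atTop (-a)] with x hx hxa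
    have h4 : HasDerivAt (fun x : ℝ => (x + a) ^ p) (1 * p * (x + a) ^ (p - 1)) x :=
      ((hasDerivAt_id x).add_const a).rpow_const (Or.inl (by simp only [id]; linarith))
    refine (h4.sub (Real.hasDerivAt_rpow_const (p := p) (Or.inl hx.ne'))).congr_deriv ?_
    ring
  have h5 := (tendsto_sub_of_tendsto_deriv h3 h2 (-b)).neg
  rw [neg_zero] at h5
  refine h5.congr' ?_
  filter_upwards [eventually_gt_atTop 0, eventually_gt_atTop (-a), eventually_gt_atTop b,
    eventually_gt_atTop (b - a)] with x hx hxa hxb hxab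
  rw [incCov, ← hp, abs_of_pos hx, abs_of_pos (by linarith), abs_of_pos (by linarith),
    abs_of_pos (by linarith)]
  rw [show x + -b + a = a + x - b by ring, show x + a = a + x by ring,
    show x + -b = x - b by ring]
  ring

end Asymptotics

variable {V : Type*} [NormedAddCommGroup V] [InnerProductSpace ℝ V] [CompleteSpace V]
  [TopologicalSpace.SeparableSpace V] [MeasurableSpace V] [BorelSpace V]
  {H : ℝ} {Q : V →L[ℝ] V} {P : Measure (C0Path V)} {ι : Type} [Fintype ι]

omit [CompleteSpace V] [TopologicalSpace.SeparableSpace V] [MeasurableSpace V] [BorelSpace V] in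
theorem incObs_zero (t : ι → ℝ) (v : ι → V) : incObs t v 0 = linObs t v := by
  funext ω
  simp only [incObs, linObs, add_zero, ω.2, sub_zero]

namespace IsFBMLaw

theorem hasGaussianLaw_linObs (hP : IsFBMLaw H Q P) (t : ι → ℝ) (v : ι → V) :
    HasGaussianLaw (linObs t v) P := by
  have h := ((hP.gaussian.comp_right t).comp_left (fun i => innerSL ℝ (v i))).hasGaussianLaw_fun_sum
    (I := Finset.univ)
  refine h.congr (ae_of_all _ fun ω => ?_)
  simp [linObs, real_inner_comm]

theorem hasGaussianLaw_inner (hP : IsFBMLaw H Q P) (t : ℝ) (v : V) :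
    HasGaussianLaw (fun ω : C0Path V => inner ℝ (ω.1 t) v) P := by
  have h := hP.hasGaussianLaw_linObs (fun _ : Unit => t) (fun _ => v)
  exact h.congr (ae_of_all _ fun ω => by simp [linObs])

theorem hasGaussianLaw_incObs (hP : IsFBMLaw H Q P) (t : ι → ℝ) (v : ι → V) (τ : ℝ) :
    HasGaussianLaw (incObs t v τ) P := by
  rw [funext (incObs_eq_linObs t v τ)]
  exact hP.hasGaussianLaw_linObs _ _

theorem integral_linObs (hP : IsFBMLaw H Q P) (t : ι → ℝ) (v : ι → V) :
    ∫ ω, linObs t v ω ∂P = 0 := by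
  simp only [linObs]
  rw [integral_finsetSum _ fun i _ => (hP.hasGaussianLaw_inner (t i) (v i)).integrable]
  exact Finset.sum_eq_zero fun i _ => hP.mean (t i) (v i)

/-- A linear observable is a centred Gaussian variable. -/
theorem integral_exp_linObs (hP : IsFBMLaw H Q P) (t : ι → ℝ) (v : ι → V) :
    ∫ ω, Complex.exp (linObs t v ω * Complex.I) ∂P =
      Real.exp (-(∫ ω, linObs t v ω ^ 2 ∂P) / 2) := by
  have hg := hP.hasGaussianLaw_linObs t v
  have h := hg.charFun_map_eq 1
  rw [charFun_apply, integral_map hg.aemeasurable (by fun_prop)] at h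
  simp only [RCLike.inner_apply, conj_trivial, mul_one, one_mul] at h
  rw [h, hP.integral_linObs, variance_of_integral_eq_zero hg.aemeasurable (hP.integral_linObs t v)]
  push_cast
  congr 1
  simp [neg_div]

theorem integral_increment_mul_increment (hP : IsFBMLaw H Q P) (a b τ σ : ℝ) (v w : V) :
    ∫ ω : C0Path V, inner ℝ (ω.1 (a + τ) - ω.1 τ) v * inner ℝ (ω.1 (b + σ) - ω.1 σ) w ∂P =
      incCov H a b (τ - σ) * inner ℝ (Q v) w := by
  have hi : ∀ r s : ℝ, Integrable (fun ω : C0Path V => inner ℝ (ω.1 r) v * inner ℝ (ω.1 s) w) P :=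
    fun r s => (hP.hasGaussianLaw_inner r v).memLp_two.integrable_mul
      (hP.hasGaussianLaw_inner s w).memLp_two
  have hi2 : ∀ r s s' : ℝ, Integrable (fun ω : C0Path V =>
      inner ℝ (ω.1 r) v * inner ℝ (ω.1 s) w - inner ℝ (ω.1 r) v * inner ℝ (ω.1 s') w) P :=
    fun r s s' => (hi r s).sub (hi r s')
  have hexp : ∀ ω : C0Path V,
      inner ℝ (ω.1 (a + τ) - ω.1 τ) v * inner ℝ (ω.1 (b + σ) - ω.1 σ) w =
      inner ℝ (ω.1 (a + τ)) v * inner ℝ (ω.1 (b + σ)) w -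
        inner ℝ (ω.1 (a + τ)) v * inner ℝ (ω.1 σ) w -
        (inner ℝ (ω.1 τ) v * inner ℝ (ω.1 (b + σ)) w - inner ℝ (ω.1 τ) v * inner ℝ (ω.1 σ) w) :=
    fun ω => by
      rw [inner_sub_left, inner_sub_left]
      ring
  simp only [hexp]
  rw [integral_sub (hi2 _ _ _) (hi2 _ _ _),
    integral_sub (hi _ _) (hi _ _), integral_sub (hi _ _) (hi _ _), hP.covariance, hP.covariance,
    hP.covariance, hP.covariance, incCov, show a + τ - (b + σ) = a + (τ - σ) - b by ring,
    show a + τ - σ = a + (τ - σ) by ring, show τ - (b + σ) = τ - σ - b by ring]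
  ring

theorem integral_incObs_mul_incObs (hP : IsFBMLaw H Q P) (t : ι → ℝ) (v : ι → V) (τ σ : ℝ) :
    ∫ ω, incObs t v τ ω * incObs t v σ ω ∂P =
      ∑ i, ∑ j, incCov H (t i) (t j) (τ - σ) * inner ℝ (Q (v i)) (v j) := by
  have hL : ∀ i τ, MemLp (fun ω : C0Path V => inner ℝ (ω.1 (t i + τ) - ω.1 τ) (v i)) 2 P :=
    fun i τ => by
      simp only [inner_sub_left]
      exact (hP.hasGaussianLaw_inner _ _).memLp_two.sub (hP.hasGaussianLaw_inner _ _).memLp_two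
  have hLL : ∀ i j, Integrable (fun ω : C0Path V => inner ℝ (ω.1 (t i + τ) - ω.1 τ) (v i) *
      inner ℝ (ω.1 (t j + σ) - ω.1 σ) (v j)) P :=
    fun i j => (hL i τ).integrable_mul (hL j σ)
  simp only [incObs, Finset.sum_mul_sum]
  rw [integral_finsetSum _ fun i _ => integrable_finsetSum _ fun j _ => hLL i j]
  refine Finset.sum_congr rfl fun i _ => ?_
  rw [integral_finsetSum _ fun j _ => hLL i j]
  exact Finset.sum_congr rfl fun j _ => hP.integral_increment_mul_increment _ _ _ _ _ _

theorem integral_incObs_sq (hP : IsFBMLaw H Q P) (t : ι → ℝ) (v : ι → V) (τ : ℝ) :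
    ∫ ω, incObs t v τ ω ^ 2 ∂P = ∫ ω, incObs t v 0 ω ^ 2 ∂P := by
  simp only [sq]
  rw [hP.integral_incObs_mul_incObs, hP.integral_incObs_mul_incObs, sub_self, sub_self]

/-- Fractional Brownian motion has stationary increments: its law is invariant under the shift. -/
theorem measurePreserving_shiftC0 (hP : IsFBMLaw H Q P) (τ : ℝ) :
    MeasurePreserving (shiftC0 τ) P P := by
  have : IsProbabilityMeasure P := hP.gaussian.isProbabilityMeasure
  have hm : Measurable (shiftC0 (V := V) τ) :=
    (continuous_shiftC0.comp (continuous_const.prodMk continuous_id)).measurable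
  refine ⟨hm, ?_⟩
  have : IsFiniteMeasure (P.map (shiftC0 τ)) := Measure.isFiniteMeasure_map _ _
  refine measure_ext_of_linObs fun ι _ t v => ?_
  have hc := continuous_linObs t v
  rw [integral_map hm.aemeasurable (by fun_prop)]
  simp only [linObs_shiftC0]
  rw [hP.integral_exp_linObs, ← incObs_zero t v, ← hP.integral_incObs_sq t v τ]
  simp only [incObs_eq_linObs t v τ]
  rw [hP.integral_exp_linObs]

end IsFBMLaw

end

section

/-! ### Ergodicity of the shift -/

theorem integrable_of_continuous_of_norm_le {X : Type*} [TopologicalSpace X] [MeasurableSpace X]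
    [OpensMeasurableSpace X] {μ : Measure X} [IsFiniteMeasure μ] {f : X → ℂ}
    (hf : Continuous f) {c : ℝ} (hc : ∀ x, ‖f x‖ ≤ c) : Integrable f μ :=
  Integrable.of_bound hf.aestronglyMeasurable c (ae_of_all _ hc)

variable {V : Type*} [NormedAddCommGroup V] [InnerProductSpace ℝ V] [CompleteSpace V]
  [TopologicalSpace.SeparableSpace V] [MeasurableSpace V] [BorelSpace V]
  {H : ℝ} {Q : V →L[ℝ] V} {P : Measure (C0Path V)} {ι : Type} [Fintype ι]

/-- The covariance function `τ - σ ↦ 𝔼[L(θ_τ ω) L(θ_σ ω)]` of a linear observable `L`. -/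
def obsCov (H : ℝ) (Q : V →L[ℝ] V) (t : ι → ℝ) (v : ι → V) (d : ℝ) : ℝ :=
  ∑ i, ∑ j, incCov H (t i) (t j) d * inner ℝ (Q (v i)) (v j)

omit [CompleteSpace V] [TopologicalSpace.SeparableSpace V] [MeasurableSpace V] [BorelSpace V] in
theorem tendsto_obsCov (hH1 : H < 1) (t : ι → ℝ) (v : ι → V) :
    Tendsto (obsCov H Q t v) atTop (𝓝 0) := by
  have h : Tendsto (obsCov H Q t v) atTop
      (𝓝 (∑ i : ι, ∑ j : ι, 0 * inner ℝ (Q (v i)) (v j))) :=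
    tendsto_finsetSum _ fun i _ => tendsto_finsetSum _ fun j _ =>
      (tendsto_incCov hH1 (t i) (t j)).mul_const _
  simpa using h

/-- The centred character `exp(i L(θ_τ ω)) - 𝔼 exp(i L)` of a linear observable `L`. -/
def centredChar (H : ℝ) (Q : V →L[ℝ] V) (t : ι → ℝ) (v : ι → V) (τ : ℝ) (ω : C0Path V) : ℂ :=
  Complex.exp (incObs t v τ ω * Complex.I) - (Real.exp (-(obsCov H Q t v 0) / 2) : ℂ)

omit [CompleteSpace V] [TopologicalSpace.SeparableSpace V] [MeasurableSpace V] [BorelSpace V] in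
theorem continuous_centredChar (t : ι → ℝ) (v : ι → V) (τ : ℝ) :
    Continuous (centredChar H Q t v τ) := by
  have := continuous_incObs t v τ
  unfold centredChar
  fun_prop

omit [CompleteSpace V] [TopologicalSpace.SeparableSpace V] [MeasurableSpace V] [BorelSpace V] in
theorem norm_centredChar_le (t : ι → ℝ) (v : ι → V) (τ : ℝ) (ω : C0Path V) :
    ‖centredChar H Q t v τ ω‖ ≤ 1 + Real.exp (-(obsCov H Q t v 0) / 2) := by
  refine (norm_sub_le _ _).trans ?_
  rw [Complex.norm_exp_ofReal_mul_I, Complex.norm_real, Real.norm_of_nonneg (Real.exp_pos _).le]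

namespace IsFBMLaw

theorem integral_exp_incObs (hP : IsFBMLaw H Q P) (t : ι → ℝ) (v : ι → V) (τ : ℝ) :
    ∫ ω, Complex.exp (incObs t v τ ω * Complex.I) ∂P =
      Real.exp (-(obsCov H Q t v 0) / 2) := by
  have h1 : ∫ ω, incObs t v τ ω ^ 2 ∂P = obsCov H Q t v 0 := by
    simp only [sq]
    rw [hP.integral_incObs_mul_incObs, sub_self, obsCov]
  rw [← h1]
  simp only [incObs_eq_linObs t v τ]
  exact hP.integral_exp_linObs _ _

theorem integral_exp_incObs_sub (hP : IsFBMLaw H Q P) (t : ι → ℝ) (v : ι → V) (τ σ : ℝ) :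
    ∫ ω, Complex.exp ((incObs t v τ ω - incObs t v σ ω : ℝ) * Complex.I) ∂P =
      Real.exp (obsCov H Q t v (τ - σ) - obsCov H Q t v 0) := by
  have hL : ∀ τ, MemLp (incObs t v τ) 2 P := fun τ => (hP.hasGaussianLaw_incObs t v τ).memLp_two
  have hi : ∀ τ σ, Integrable (fun ω => incObs t v τ ω * incObs t v σ ω) P := fun τ σ =>
    (hL τ).integrable_mul (hL σ)
  have h1 : ∫ ω, (incObs t v τ ω - incObs t v σ ω) ^ 2 ∂P =
      2 * obsCov H Q t v 0 - 2 * obsCov H Q t v (τ - σ) := by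
    have hexp : ∀ ω, (incObs t v τ ω - incObs t v σ ω) ^ 2 =
        incObs t v τ ω * incObs t v τ ω + incObs t v σ ω * incObs t v σ ω -
          2 * (incObs t v τ ω * incObs t v σ ω) := fun ω => by ring
    simp only [hexp]
    rw [integral_sub (by exact (hi _ _).add (hi _ _)) ((hi _ _).const_mul 2),
      integral_add (hi _ _) (hi _ _), integral_const_mul, hP.integral_incObs_mul_incObs,
      hP.integral_incObs_mul_incObs, hP.integral_incObs_mul_incObs, sub_self, sub_self]
    simp only [obsCov]
    ring
  have h2 : Real.exp (obsCov H Q t v (τ - σ) - obsCov H Q t v 0) =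
      Real.exp (-(∫ ω, (incObs t v τ ω - incObs t v σ ω) ^ 2 ∂P) / 2) := by
    rw [h1]
    congr 1
    ring
  rw [h2]
  simp only [incObs_sub_eq_linObs t v τ σ]
  exact hP.integral_exp_linObs _ _

theorem integral_centredChar_mul_conj (hP : IsFBMLaw H Q P) (t : ι → ℝ) (v : ι → V) (τ σ : ℝ) :
    ∫ ω, centredChar H Q t v τ ω * (starRingEnd ℂ) (centredChar H Q t v σ ω) ∂P =
      (Real.exp (-(obsCov H Q t v 0)) * (Real.exp (obsCov H Q t v (τ - σ)) - 1) : ℝ) := by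
  have : IsProbabilityMeasure P := hP.gaussian.isProbabilityMeasure
  have hc := fun τ => continuous_incObs t v τ
  set m : ℝ := Real.exp (-(obsCov H Q t v 0) / 2) with hm
  have hexp : ∀ ω, centredChar H Q t v τ ω * (starRingEnd ℂ) (centredChar H Q t v σ ω) =
      Complex.exp ((incObs t v τ ω - incObs t v σ ω : ℝ) * Complex.I) -
        m * (starRingEnd ℂ) (Complex.exp (incObs t v σ ω * Complex.I)) -
        (m * Complex.exp (incObs t v τ ω * Complex.I) - m * m) := fun ω => by
    have h1 : Complex.exp ((incObs t v τ ω - incObs t v σ ω : ℝ) * Complex.I) =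
        Complex.exp (incObs t v τ ω * Complex.I) *
          (starRingEnd ℂ) (Complex.exp (incObs t v σ ω * Complex.I)) := by
      rw [← Complex.exp_conj, ← Complex.exp_add]
      congr 1
      simp
      ring
    rw [h1, centredChar, centredChar, map_sub, Complex.conj_ofReal, ← hm]
    ring
  have hi1 : Integrable (fun ω => Complex.exp ((incObs t v τ ω - incObs t v σ ω : ℝ) *
      Complex.I)) P :=
    integrable_of_continuous_of_norm_le (c := 1) (by have := hc τ; have := hc σ; fun_prop)
      fun ω => (Complex.norm_exp_ofReal_mul_I _).le
  have hi2 : ∀ τ, Integrable (fun ω => Complex.exp (incObs t v τ ω * Complex.I)) P := fun τ =>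
    integrable_of_continuous_of_norm_le (c := 1) (by have := hc τ; fun_prop)
      fun ω => (Complex.norm_exp_ofReal_mul_I _).le
  have hi3 : Integrable (fun ω => (starRingEnd ℂ) (Complex.exp (incObs t v σ ω * Complex.I))) P :=
    integrable_of_continuous_of_norm_le (c := 1)
      (by have := hc σ; exact Complex.continuous_conj.comp (by fun_prop))
      fun ω => by rw [RCLike.norm_conj, Complex.norm_exp_ofReal_mul_I]
  simp only [hexp]
  have hi4 : Integrable (fun ω => Complex.exp ((incObs t v τ ω - incObs t v σ ω : ℝ) * Complex.I) -
      m * (starRingEnd ℂ) (Complex.exp (incObs t v σ ω * Complex.I))) P := hi1.sub (hi3.const_mul _)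
  have hi5 : Integrable (fun ω => m * Complex.exp (incObs t v τ ω * Complex.I) - (m * m : ℂ)) P :=
    ((hi2 τ).const_mul _).sub (integrable_const _)
  rw [integral_sub hi4 hi5, integral_sub hi1 (hi3.const_mul _),
    integral_sub ((hi2 τ).const_mul _) (integrable_const _),
    integral_const_mul, integral_const_mul, integral_conj, hP.integral_exp_incObs,
    hP.integral_exp_incObs, hP.integral_exp_incObs_sub, integral_const, Complex.conj_ofReal]
  have hmm : m * m = Real.exp (-(obsCov H Q t v 0)) := by
    rw [hm, ← Real.exp_add]
    congr 1
    ring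
  rw [probReal_univ, one_smul, ← hm, mul_sub, ← Real.exp_add, ← hmm, neg_add_eq_sub]
  push_cast
  ring

/-- The centred characters along the orbit are asymptotically orthogonal, so they converge weakly
to zero; hence an invariant event is uncorrelated with every character. -/
theorem setIntegral_centredChar_eq_zero (hP : IsFBMLaw H Q P) (hH1 : H < 1) (t : ι → ℝ)
    (v : ι → V) {A : Set (C0Path V)} (hA : MeasurableSet A)
    (hinv : ∀ τ, shiftC0 τ ⁻¹' A = A) : ∫ ω in A, centredChar H Q t v 0 ω ∂P = 0 := by
  have : IsProbabilityMeasure P := hP.gaussian.isProbabilityMeasure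
  set c := ∫ ω in A, centredChar H Q t v 0 ω ∂P with hc
  have hcont := fun τ => continuous_centredChar (H := H) (Q := Q) t v τ
  have hint : ∀ τ, Integrable (centredChar H Q t v τ) P := fun τ =>
    integrable_of_continuous_of_norm_le (hcont τ) (norm_centredChar_le t v τ)
  have hstat : ∀ τ, ∫ ω in A, centredChar H Q t v τ ω ∂P = c := fun τ => by
    have h1 := setIntegral_map (μ := P) (g := shiftC0 τ) (f := centredChar H Q t v 0) hA
      (hcont 0).aestronglyMeasurable (hP.measurePreserving_shiftC0 τ).measurable.aemeasurable
    rw [(hP.measurePreserving_shiftC0 τ).map_eq, hinv] at h1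
    rw [hc, h1]
    refine integral_congr_ae (ae_of_all _ fun ω => ?_)
    simp only [centredChar, incObs_zero, linObs_shiftC0]
  set r : ℝ → ℝ := fun d => Real.exp (-(obsCov H Q t v 0)) * (Real.exp (obsCov H Q t v d) - 1)
    with hr
  have hr0 : r 0 ≤ 1 := by
    simp only [hr, mul_sub, ← Real.exp_add, neg_add_cancel, Real.exp_zero, mul_one]
    linarith [Real.exp_pos (-(obsCov H Q t v 0))]
  have hrlim : Tendsto r atTop (𝓝 0) := by
    have h1 := ((Real.continuous_exp.tendsto 0).comp (tendsto_obsCov (Q := Q) hH1 t v)).sub_const 1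
    rw [Real.exp_zero, sub_self] at h1
    simpa using h1.const_mul (Real.exp (-(obsCov H Q t v 0)))
  have hsymm : ∀ τ σ, r (τ - σ) = r (σ - τ) := fun τ σ => by
    have h1 := hP.integral_centredChar_mul_conj t v τ σ
    have h2 := hP.integral_centredChar_mul_conj t v σ τ
    have h3 : ∀ ω, centredChar H Q t v σ ω * (starRingEnd ℂ) (centredChar H Q t v τ ω) =
        (starRingEnd ℂ) (centredChar H Q t v τ ω * (starRingEnd ℂ) (centredChar H Q t v σ ω)) :=
      fun ω => by rw [map_mul, Complex.conj_conj, mul_comm]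
    simp only [h3] at h2
    rw [integral_conj, h1, Complex.conj_ofReal] at h2
    exact_mod_cast h2
  by_contra hne
  have hη : 0 < ‖c‖ ^ 2 := by positivity
  obtain ⟨M, hM0, hM⟩ : ∃ M : ℝ, 0 < M ∧ ∀ d, M ≤ d → r d ≤ ‖c‖ ^ 2 / 2 := by
    obtain ⟨M, hM⟩ := eventually_atTop.1 (hrlim.eventually_le_const (half_pos hη))
    exact ⟨max M 1, by positivity, fun d hd => hM d ((le_max_left _ _).trans hd)⟩
  obtain ⟨N, hN⟩ := exists_nat_gt (2 / ‖c‖ ^ 2)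
  have hN0 : (0 : ℝ) < N := lt_trans (by positivity) hN
  set F : C0Path V → ℂ := fun ω => ∑ k ∈ Finset.range N, centredChar H Q t v (k * M) ω with hF
  have hFc : Continuous F := continuous_finsetSum _ fun k _ => hcont _
  have hFb : ∀ ω, ‖F ω‖ ≤ N * (1 + Real.exp (-(obsCov H Q t v 0) / 2)) := fun ω => by
    refine (norm_sum_le_of_le (f := fun k : ℕ => centredChar H Q t v (k * M) ω) (Finset.range N)
      fun k _ => norm_centredChar_le t v (k * M) ω).trans (le_of_eq ?_)
    simp [mul_add]
  have hFi : Integrable F P := integrable_of_continuous_of_norm_le hFc hFb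
  have hFA : ∫ ω in A, F ω ∂P = N * c := by
    simp only [hF]
    rw [integral_finsetSum _ fun k _ => (hint _).integrableOn]
    simp [hstat]
  -- second moment of `F`: the `N` diagonal terms are at most `1`, the others are small
  have hF2 : ∫ ω, ‖F ω‖ ^ 2 ∂P ≤ N + N * N * (‖c‖ ^ 2 / 2) := by
    have h1 : ∀ ω, ((‖F ω‖ ^ 2 : ℝ) : ℂ) = ∑ j ∈ Finset.range N, ∑ k ∈ Finset.range N,
        centredChar H Q t v (j * M) ω * (starRingEnd ℂ) (centredChar H Q t v (k * M) ω) :=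
      fun ω => by
        rw [← Finset.sum_mul_sum, ← map_sum]
        push_cast
        exact (Complex.mul_conj' (F ω)).symm
    have hprod : ∀ j k : ℕ, Integrable (fun ω => centredChar H Q t v (j * M) ω *
        (starRingEnd ℂ) (centredChar H Q t v (k * M) ω)) P := fun j k => by
      refine integrable_of_continuous_of_norm_le
        ((hcont _).mul (Complex.continuous_conj.comp (hcont _)))
        (c := (1 + Real.exp (-(obsCov H Q t v 0) / 2)) * (1 + Real.exp (-(obsCov H Q t v 0) / 2)))
        fun ω => ?_
      rw [norm_mul, RCLike.norm_conj]
      exact mul_le_mul (norm_centredChar_le t v _ ω) (norm_centredChar_le t v _ ω)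
        (norm_nonneg _) (by positivity)
    have h2 : ((∫ ω, ‖F ω‖ ^ 2 ∂P : ℝ) : ℂ) =
        ((∑ j ∈ Finset.range N, ∑ k ∈ Finset.range N, r (j * M - k * M) : ℝ) : ℂ) := by
      rw [← integral_complex_ofReal]
      simp only [h1]
      rw [integral_finsetSum _ fun j _ => integrable_finsetSum _ fun k _ => hprod j k]
      push_cast
      refine Finset.sum_congr rfl fun j _ => ?_
      rw [integral_finsetSum _ fun k _ => hprod j k]
      exact Finset.sum_congr rfl fun k _ => hP.integral_centredChar_mul_conj t v _ _
    rw [Complex.ofReal_inj.1 h2]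
    have h3 : ∀ j k : ℕ, r (j * M - k * M) ≤ (if j = k then 1 else 0) + ‖c‖ ^ 2 / 2 := by
      have hlt : ∀ j k : ℕ, k < j → r (j * M - k * M) ≤ ‖c‖ ^ 2 / 2 := fun j k hjk => by
        refine hM _ ?_
        have h4 : (k : ℝ) + 1 ≤ j := by exact_mod_cast hjk
        nlinarith
      intro j k
      rcases lt_trichotomy j k with h | h | h
      · rw [if_neg h.ne, zero_add, hsymm]
        exact hlt k j h
      · rw [if_pos h, h, sub_self]
        linarith
      · rw [if_neg h.ne', zero_add]
        exact hlt j k h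
    refine (Finset.sum_le_sum fun j _ => Finset.sum_le_sum fun k _ => h3 j k).trans (le_of_eq ?_)
    simp only [Finset.sum_add_distrib, Finset.sum_const, Finset.card_range, nsmul_eq_mul,
      Finset.sum_ite_eq, Finset.mem_range]
    rw [Finset.sum_congr rfl fun j hj => if_pos (Finset.mem_range.1 hj)]
    simp
    ring
  have hnorm : (N * ‖c‖) ^ 2 ≤ ∫ ω, ‖F ω‖ ^ 2 ∂P := by
    have h1 : N * ‖c‖ ≤ ∫ ω, ‖F ω‖ ∂P := by
      have h2 : ‖∫ ω in A, F ω ∂P‖ = N * ‖c‖ := by rw [hFA, norm_mul, Complex.norm_natCast]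
      rw [← h2]
      exact (norm_integral_le_integral_norm _).trans
        (setIntegral_le_integral hFi.norm (ae_of_all _ fun ω => norm_nonneg _))
    have hsqi : Integrable (fun ω => ‖F ω‖ ^ 2) P := by
      refine Integrable.of_bound (hFc.norm.pow 2).aestronglyMeasurable
        ((N * (1 + Real.exp (-(obsCov H Q t v 0) / 2))) ^ 2) (ae_of_all _ fun ω => ?_)
      rw [norm_pow, norm_norm]
      have := hFb ω
      gcongr
    have h3 : 0 ≤ ∫ ω, (‖F ω‖ - ∫ ω', ‖F ω'‖ ∂P) ^ 2 ∂P := integral_nonneg fun ω => sq_nonneg _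
    set e := ∫ ω', ‖F ω'‖ ∂P with he
    have hexp : ∀ ω, (‖F ω‖ - e) ^ 2 = ‖F ω‖ ^ 2 - 2 * e * ‖F ω‖ + e ^ 2 := fun ω => by ring
    simp only [hexp] at h3
    rw [integral_add (by exact hsqi.sub (hFi.norm.const_mul _)) (integrable_const _),
      integral_sub hsqi (hFi.norm.const_mul _), integral_const_mul, integral_const, ← he,
      probReal_univ, one_smul] at h3
    have h4 : (N * ‖c‖) ^ 2 ≤ e ^ 2 := by gcongr
    nlinarith
  -- `N² ‖c‖² ≤ N + N² ‖c‖² / 2` fails for `N > 2 / ‖c‖²`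
  have hcontra := hnorm.trans hF2
  rw [div_lt_iff₀ hη] at hN
  nlinarith

/-- The shift is ergodic under the law of fractional Brownian motion. -/
theorem ergodic_shiftC0 (hP : IsFBMLaw H Q P) (hH1 : H < 1) {A : Set (C0Path V)}
    (hA : MeasurableSet A) (hinv : ∀ τ, shiftC0 τ ⁻¹' A = A) : P A = 0 ∨ P A = 1 := by
  have : IsProbabilityMeasure P := hP.gaussian.isProbabilityMeasure
  have hfin : IsFiniteMeasure (P A • P) := P.smul_finite (measure_ne_top _ _)
  -- the characters do not see the conditioning on `A`, so `A` is independent of everything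
  have key : P.restrict A = P A • P := by
    refine measure_ext_of_linObs fun ι _ t v => ?_
    have h0 := hP.setIntegral_centredChar_eq_zero hH1 t v hA hinv
    have hc := continuous_linObs t v
    have hi : Integrable (fun ω => Complex.exp (linObs t v ω * Complex.I)) P :=
      integrable_of_continuous_of_norm_le (c := 1) (by fun_prop)
        fun ω => (Complex.norm_exp_ofReal_mul_I _).le
    have h1 := hP.integral_exp_incObs t v 0
    simp only [centredChar, incObs_zero] at h0 h1
    rw [integral_sub hi.integrableOn (integrable_const _), sub_eq_zero] at h0
    rw [h0, integral_smul_measure, h1]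
    simp [Measure.real]
  have h1 := congrArg (fun μ : Measure (C0Path V) => μ A) key
  simp only [Measure.restrict_apply_self, Measure.smul_apply, smul_eq_mul] at h1
  by_cases h0 : P A = 0
  · exact Or.inl h0
  · right
    have h2 := (ENNReal.mul_right_inj h0 (measure_ne_top P A)).1 (h1.symm.trans (mul_one _).symm)
    exact h2

end IsFBMLaw

end

section

/-! ### Growth of the Hölder constants of fractional Brownian motion -/

theorem ae_forall_le_of_summable_integral {Ω ι : Type*} [MeasurableSpace Ω] {μ : Measure Ω}
    [Countable ι] {Z : ι → Ω → ℝ} (hZ : ∀ i, Integrable (Z i) μ) (hZ0 : ∀ i ω, 0 ≤ Z i ω)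
    (hs : Summable fun i => ∫ ω, Z i ω ∂μ) : ∀ᵐ ω ∂μ, ∃ C : ℝ, ∀ i, Z i ω ≤ C := by
  have h1 : ∫⁻ ω, ∑' i, ENNReal.ofReal (Z i ω) ∂μ ≠ ⊤ := by
    rw [lintegral_tsum fun i => (hZ i).aemeasurable.ennreal_ofReal]
    simp only [← fun i => ofReal_integral_eq_lintegral_ofReal (hZ i) (ae_of_all _ (hZ0 i))]
    exact hs.tsum_ofReal_ne_top
  filter_upwards [ae_lt_top' (AEMeasurable.tsum fun i =>
    (hZ i).aemeasurable.ennreal_ofReal) h1] with ω hω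
  exact ⟨_, fun i => (ENNReal.ofReal_le_iff_le_toReal hω.ne).1 (ENNReal.le_tsum i)⟩

theorem summable_one_div_one_add_sq_int : Summable fun k : ℤ => 1 / (1 + (k : ℝ) ^ 2) := by
  refine Summable.of_norm_bounded_eventually
    (Real.summable_one_div_int_pow.2 (by norm_num : 1 < 2)) ?_
  filter_upwards [(Set.finite_singleton (0 : ℤ)).compl_mem_cofinite] with k hk
  have hk' : (k : ℝ) ≠ 0 := by exact_mod_cast hk
  rw [Real.norm_of_nonneg (by positivity)]
  have : 0 < (k : ℝ) ^ 2 := by positivity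
  gcongr
  linarith

variable {V : Type*} [NormedAddCommGroup V] [InnerProductSpace ℝ V] [CompleteSpace V]
  [TopologicalSpace.SeparableSpace V] [MeasurableSpace V] [BorelSpace V]
  {H : ℝ} {Q : V →L[ℝ] V} {P : Measure (C0Path V)}

namespace IsFBMLaw

theorem integral_exp_inner_increment (hP : IsFBMLaw H Q P) (hH : 0 < H) (a s : ℝ) (v : V) :
    ∫ ω : C0Path V, Complex.exp ((inner ℝ (ω.1 (a + s) - ω.1 s) v : ℝ) * Complex.I) ∂P =
      Real.exp (-(|a| ^ H * |a| ^ H * inner ℝ (Q v) v)) := by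
  have h := hP.integral_exp_incObs (fun _ : Unit => a) (fun _ => v) s
  simp only [incObs, obsCov, Finset.univ_unique, Finset.sum_const, Finset.card_singleton,
    one_smul] at h
  rw [h, incCov, add_zero, zero_sub, abs_neg, sub_self, abs_zero,
    Real.zero_rpow (by positivity), two_mul H]
  rcases eq_or_ne a 0 with rfl | ha
  · simp [Real.zero_rpow hH.ne', Real.zero_rpow (add_pos hH hH).ne']
  · rw [Real.rpow_add (abs_pos.2 ha)]
    congr 2
    ring

/-- Self-similarity and stationarity: an increment over a time interval of length `|a|` has the
law of `|a| ^ H • ω(1)`. -/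
theorem map_increment (hP : IsFBMLaw H Q P) (hH : 0 < H) (a s : ℝ) :
    P.map (fun ω : C0Path V => ω.1 (a + s) - ω.1 s) =
      P.map (fun ω : C0Path V => (|a| ^ H) • ω.1 1) := by
  have : IsProbabilityMeasure P := hP.gaussian.isProbabilityMeasure
  have : SecondCountableTopology V := UniformSpace.secondCountable_of_separable V
  have hc := fun t : ℝ => continuous_eval_c0Path (V := V) t
  have hm1 : Measurable fun ω : C0Path V => ω.1 (a + s) - ω.1 s :=
    ((hc _).sub (hc _)).measurable
  have hm2 : Measurable fun ω : C0Path V => (|a| ^ H) • ω.1 1 := ((hc _).const_smul _).measurable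
  have := Measure.isFiniteMeasure_map P fun ω : C0Path V => ω.1 (a + s) - ω.1 s
  have := Measure.isFiniteMeasure_map P fun ω : C0Path V => (|a| ^ H) • ω.1 1
  refine Measure.ext_of_charFun (funext fun v => ?_)
  rw [charFun_apply, charFun_apply, integral_map hm1.aemeasurable (by fun_prop),
    integral_map hm2.aemeasurable (by fun_prop), hP.integral_exp_inner_increment hH]
  have h := hP.integral_exp_inner_increment hH 1 0 ((|a| ^ H) • v)
  have h0 : ∀ ω : C0Path V, ω.1 0 = 0 := fun ω => ω.2
  simp only [add_zero, h0, sub_zero, abs_one, Real.one_rpow, one_mul, map_smul, inner_smul_left,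
    inner_smul_right, conj_trivial] at h
  simp only [inner_smul_left, conj_trivial]
  rw [h]
  congr 2
  ring

theorem integrable_norm_pow (hP : IsFBMLaw H Q P) (p : ℕ) (t : ℝ) :
    Integrable (fun ω : C0Path V => ‖ω.1 t‖ ^ p) P := by
  have : SecondCountableTopology V := UniformSpace.secondCountable_of_separable V
  have : IsProbabilityMeasure P := hP.gaussian.isProbabilityMeasure
  exact ((hP.gaussian.hasGaussianLaw_eval t).memLp (ENNReal.natCast_ne_top p)).integrable_norm_pow'

theorem integrable_norm_increment_pow (hP : IsFBMLaw H Q P) (hH : 0 < H) (p : ℕ) (a s : ℝ) :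
    Integrable (fun ω : C0Path V => ‖ω.1 (a + s) - ω.1 s‖ ^ p) P ∧
    ∫ ω : C0Path V, ‖ω.1 (a + s) - ω.1 s‖ ^ p ∂P =
      (|a| ^ H) ^ p * ∫ ω : C0Path V, ‖ω.1 1‖ ^ p ∂P := by
  have hc := fun t : ℝ => continuous_eval_c0Path (V := V) t
  have hm1 : Measurable fun ω : C0Path V => ω.1 (a + s) - ω.1 s :=
    ((hc _).sub (hc _)).measurable
  have hm2 : Measurable fun ω : C0Path V => (|a| ^ H) • ω.1 1 := ((hc _).const_smul _).measurable
  have hf : ∀ μ : Measure V, AEStronglyMeasurable (fun v : V => ‖v‖ ^ p) μ := fun μ =>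
    Measurable.aestronglyMeasurable (by fun_prop)
  have hnorm : ∀ ω : C0Path V, ‖(|a| ^ H) • ω.1 1‖ ^ p = (|a| ^ H) ^ p * ‖ω.1 1‖ ^ p := fun ω => by
    rw [norm_smul, Real.norm_of_nonneg (by positivity), mul_pow]
  constructor
  · have h1 : Integrable (fun v : V => ‖v‖ ^ p) (P.map fun ω : C0Path V => (|a| ^ H) • ω.1 1) := by
      rw [integrable_map_measure (hf _) hm2.aemeasurable]
      simp only [Function.comp_def, hnorm]
      exact (hP.integrable_norm_pow p 1).const_mul _
    rw [← hP.map_increment hH a s, integrable_map_measure (hf _) hm1.aemeasurable] at h1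
    exact h1
  · rw [← integral_map hm1.aemeasurable (f := fun v : V => ‖v‖ ^ p) (hf _), hP.map_increment hH,
      integral_map hm2.aemeasurable (hf _)]
    simp only [hnorm]
    exact integral_const_mul _ _

/-- Kolmogorov's argument, keeping track of the time window: almost surely the dyadic increments
are bounded by a random multiple of `(1 + n) * 2 ^ (-γ * m)` on `[-n, n]`. The high power `p` of
the moments absorbs the number `(1 + n) * 2 ^ m` of dyadic intervals. -/
theorem ae_dyadic_increment_le (hP : IsFBMLaw H Q P) (hH : 0 < H) {γ : ℝ} (hγ : γ < H) :
    ∀ᵐ ω : C0Path V ∂P, ∃ C : ℝ, 0 ≤ C ∧ ∀ n m : ℕ, ∀ k : ℤ, |k| ≤ n * 2 ^ m →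
      ‖ω.1 ((k + 1) / 2 ^ m) - ω.1 (k / 2 ^ m)‖ ≤ C * (1 + n) * ((1 / 2 : ℝ) ^ γ) ^ m := by
  have hq0 : 0 < (1 / 2 : ℝ) ^ γ := by positivity
  have hh0 : 0 < (1 / 2 : ℝ) ^ H := by positivity
  have hhq : (1 / 2 : ℝ) ^ H < (1 / 2 : ℝ) ^ γ :=
    Real.rpow_lt_rpow_of_exponent_gt (by norm_num) (by norm_num) hγ
  have hpow : ∀ m : ℕ, |(1 / 2 : ℝ) ^ m| ^ H = ((1 / 2 : ℝ) ^ H) ^ m := fun m => by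
    rw [abs_of_pos (by positivity), ← Real.rpow_natCast, ← Real.rpow_mul (by norm_num), mul_comm,
      Real.rpow_mul (by norm_num), Real.rpow_natCast]
  generalize (1 / 2 : ℝ) ^ γ = q at *
  generalize (1 / 2 : ℝ) ^ H = h at *
  -- The weights `b ^ (-m * p)` leave the expectations summable because `h < b`, and `b < q`
  -- with `p` large pays for the factor `4 ^ m` by which `1 + k ^ 2` can grow at level `m`.
  obtain ⟨b, hhb, hbq⟩ := exists_between hhq
  have hb0 : 0 < b := hh0.trans hhb
  obtain ⟨p, hp2, hp4⟩ : ∃ p : ℕ, 2 ≤ p ∧ 4 * b ^ p ≤ q ^ p := by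
    have hlim := tendsto_pow_atTop_nhds_zero_of_lt_one (div_pos hb0 hq0).le ((div_lt_one hq0).2 hbq)
    obtain ⟨p, hp⟩ := ((eventually_ge_atTop 2).and
      (hlim.eventually_le_const (by norm_num : (0 : ℝ) < 1 / 4))).exists
    refine ⟨p, hp.1, ?_⟩
    have h1 := hp.2
    rw [div_pow, div_le_iff₀ (by positivity)] at h1
    linarith
  set Z : ℕ × ℤ → C0Path V → ℝ := fun i ω => ((b ^ i.1)⁻¹ ^ p / (1 + (i.2 : ℝ) ^ 2)) *
    ‖ω.1 ((i.2 + 1) / 2 ^ i.1) - ω.1 (i.2 / 2 ^ i.1)‖ ^ p with hZ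
  have hinc : ∀ (i : ℕ × ℤ), ((i.2 : ℝ) + 1) / 2 ^ i.1 = (1 / 2) ^ i.1 + i.2 / 2 ^ i.1 :=
      fun i => by
    rw [one_div, inv_pow]
    ring
  have hZi : ∀ i, Integrable (Z i) P := fun i => by
    simp only [hZ, hinc]
    exact (hP.integrable_norm_increment_pow hH p _ _).1.const_mul _
  have halg : ∀ (m : ℕ) (d M : ℝ), (b ^ m)⁻¹ ^ p / d * ((h ^ m) ^ p * M) =
      ((h / b) ^ p) ^ m * (1 / d) * M := fun m d M => by
    rw [div_pow, div_pow, inv_pow, pow_right_comm b, pow_right_comm h]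
    ring
  have hZint : ∀ i, ∫ ω, Z i ω ∂P = (((h / b) ^ p) ^ i.1 * (1 / (1 + (i.2 : ℝ) ^ 2))) *
      ∫ ω : C0Path V, ‖ω.1 1‖ ^ p ∂P := fun i => by
    simp only [hZ, hinc]
    rw [integral_const_mul, (hP.integrable_norm_increment_pow hH p _ _).2, hpow, halg]
  have hsum : Summable fun i => ∫ ω, Z i ω ∂P := by
    have hr1 : (h / b) ^ p < 1 := pow_lt_one₀ (by positivity) ((div_lt_one hb0).2 hhb) (by omega)
    have hr0 : 0 ≤ (h / b) ^ p := by positivity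
    have h1 := Summable.mul_of_nonneg (f := fun m : ℕ => ((h / b) ^ p) ^ m)
      (g := fun k : ℤ => 1 / (1 + (k : ℝ) ^ 2)) (summable_geometric_of_lt_one hr0 hr1)
      summable_one_div_one_add_sq_int (fun m => pow_nonneg hr0 m) fun k => by positivity
    exact (h1.mul_right (∫ ω : C0Path V, ‖ω.1 1‖ ^ p ∂P)).congr fun i => (hZint i).symm
  have hZ0 : ∀ i ω, 0 ≤ Z i ω := fun i ω => by
    simp only [hZ]
    positivity
  filter_upwards [ae_forall_le_of_summable_integral hZi hZ0 hsum] with ω hω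
  obtain ⟨C, hC⟩ := hω
  refine ⟨max C 1, by positivity, fun n m k hk => ?_⟩
  obtain ⟨D, hD⟩ : ∃ D, D = max C 1 := ⟨_, rfl⟩
  have hD1 : 1 ≤ D := hD ▸ le_max_right _ _
  rw [← hD]
  refine le_of_pow_le_pow_left₀ (n := p) (by omega) (by positivity) ?_
  have h1 : (b ^ m)⁻¹ ^ p / (1 + (k : ℝ) ^ 2) *
      ‖ω.1 ((k + 1) / 2 ^ m) - ω.1 (k / 2 ^ m)‖ ^ p ≤ D := (hC (m, k)).trans (hD ▸ le_max_left _ _)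
  have h2 : 1 + (k : ℝ) ^ 2 ≤ (1 + n) ^ 2 * 4 ^ m := by
    have hk' : |(k : ℝ)| ≤ n * 2 ^ m := by exact_mod_cast hk
    have h3 : (k : ℝ) ^ 2 ≤ (n * 2 ^ m) ^ 2 := 
      sq_le_sq.2 (hk'.trans (le_abs_self _))
    have h4 : ((2 : ℝ) ^ m) ^ 2 = 4 ^ m := by rw [← pow_mul, mul_comm, pow_mul]; norm_num
    have h5 : (1 : ℝ) ≤ 4 ^ m := one_le_pow₀ (by norm_num)
    rw [mul_pow, h4] at h3
    have h6 : 0 ≤ (n : ℝ) * 4 ^ m := by positivity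
    nlinarith
  rw [div_mul_eq_mul_div, div_le_iff₀ (by positivity), inv_pow,
    inv_mul_le_iff₀ (by positivity)] at h1
  calc _ ≤ (b ^ m) ^ p * (D * (1 + (k : ℝ) ^ 2)) := h1
    _ ≤ (b ^ m) ^ p * (D * ((1 + n) ^ 2 * 4 ^ m)) := by gcongr
    _ = D * (1 + n) ^ 2 * (4 * b ^ p) ^ m := by
        rw [mul_pow, pow_right_comm b]
        ring
    _ ≤ D ^ p * (1 + n) ^ p * (q ^ p) ^ m := by
        gcongr
        · exact le_self_pow₀ hD1 (by omega)
        · linarith [(Nat.cast_nonneg n : (0 : ℝ) ≤ n)]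
    _ = (D * (1 + n) * q ^ m) ^ p := by
        rw [mul_pow, mul_pow, pow_right_comm q]

/-- Almost every path of fractional Brownian motion is locally `γ`-Hölder, `γ < H`, with Hölder
constants on `[-n, n]` of polynomial growth in `n`. -/
theorem ae_hasHolderGrowth (hP : IsFBMLaw H Q P) (hH : 0 < H) {γ : ℝ} (hγ0 : 0 < γ)
    (hγ : γ < H) : ∀ᵐ ω : C0Path V ∂P, HasHolderGrowth γ (ω.1 : ℝ → V) := by
  filter_upwards [hP.ae_dyadic_increment_le hH hγ] with ω hω
  obtain ⟨C, hC0, hC⟩ := hω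
  set c : ℝ := (1 + 2 * ((1 / 2 : ℝ) ^ γ / (1 - (1 / 2 : ℝ) ^ γ))) * 2 ^ γ with hc
  have hq1 : (1 / 2 : ℝ) ^ γ < 1 := Real.rpow_lt_one (by norm_num) (by norm_num) hγ0
  have hc0 : 0 ≤ c := by
    have := sub_pos.2 hq1
    positivity
  obtain ⟨N, hN⟩ := exists_nat_ge (2 * (C * c))
  refine ⟨N, fun n r hr s hs => ?_⟩
  have h1 := holder_of_dyadic (n := n) (D := C * (1 + n)) ω.1.continuous hγ0
    (fun m k hk => hC n m k hk) hr hs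
  refine h1.trans ?_
  refine mul_le_mul_of_nonneg_right ?_ (by positivity)
  calc _ = (2 * n + 1) * (1 + n) * (C * c) := by rw [hc]; ring
    _ ≤ (2 * (1 + n)) * (1 + n) * (C * c) := by
        gcongr
        linarith
    _ = 2 * (C * c) * (1 + n) ^ 2 := by ring
    _ ≤ _ := by gcongr

end IsFBMLaw

end

section

/-! ### The canonical metric dynamical system -/

section MetricDynamicalSystem

variable {V : Type*} [NormedAddCommGroup V]

theorem isLocallyHolder_shiftC0_iff {γ : ℝ≥0} (t : ℝ) (ω : C0Path V) :
    IsLocallyHolder γ ((shiftC0 t ω).1 : ℝ → V) ↔ IsLocallyHolder γ (ω.1 : ℝ → V) := by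
  refine ⟨fun h => ?_, isLocallyHolder_shiftC0 t ω⟩
  have h1 : shiftC0 (-t) (shiftC0 t ω) = ω :=
    Subtype.ext (ContinuousMap.ext fun s => by
      change (ω.1 (s + -t + t) - ω.1 t) - (ω.1 (-t + t) - ω.1 t) = ω.1 s
      rw [neg_add_cancel_right, neg_add_cancel, ω.2]
      abel)
  rw [← h1]
  exact isLocallyHolder_shiftC0 (-t) _ h

theorem hasHolderGrowth_shift_iff {γ : ℝ≥0} (t : ℝ) (ω : HolderPath V γ) :
    HasHolderGrowth γ ((shift t ω).1.1 : ℝ → V) ↔ HasHolderGrowth γ (ω.1.1 : ℝ → V) := by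
  refine ⟨fun h => ?_, fun h => h.shift t⟩
  have h1 : shift (-t) (shift t ω) = ω := by rw [← shift_add, neg_add_cancel, shift_zero]
  rw [← h1]
  exact h.shift (-t)

variable [InnerProductSpace ℝ V] [CompleteSpace V]
  [TopologicalSpace.SeparableSpace V] [MeasurableSpace V] [BorelSpace V]
  {H : ℝ} {Q : V →L[ℝ] V} {P : Measure (C0Path V)} {γ : ℝ≥0}

namespace IsFBMLaw

theorem ae_isLocallyHolder (hP : IsFBMLaw H Q P) (hH : 0 < H) (hγ0 : 0 < γ) (hγ : (γ : ℝ) < H) :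
    ∀ᵐ ω ∂P, ω ∈ {ω : C0Path V | IsLocallyHolder γ (ω.1 : ℝ → V)} :=
  (hP.ae_hasHolderGrowth hH (NNReal.coe_pos.2 hγ0) hγ).mono fun _ h => h.isLocallyHolder

/-- The Hölder paths have full measure, so restricting to them loses nothing. -/
theorem map_comap_val (hP : IsFBMLaw H Q P) (hH : 0 < H) (hγ0 : 0 < γ) (hγ : (γ : ℝ) < H) :
    (P.comap (Subtype.val : HolderPath V γ → C0Path V)).map Subtype.val = P := by
  have hemb : MeasurableEmbedding (Subtype.val : HolderPath V γ → C0Path V) :=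
    MeasurableEmbedding.subtype_coe (measurableSet_isLocallyHolder γ)
  rw [hemb.map_comap]
  exact Measure.restrict_eq_self_of_ae_mem
    ((hP.ae_isLocallyHolder hH hγ0 hγ).mono fun ω hω => ⟨⟨ω, hω⟩, rfl⟩)

theorem isErgodicMDS_shift (hP : IsFBMLaw H Q P) (hH : 0 < H) (hH1 : H < 1) (hγ0 : 0 < γ)
    (hγ : (γ : ℝ) < H) {ε : ℝ} (hε : 0 < ε) :
    IsErgodicMDS (P.comap (Subtype.val : HolderPath V γ → C0Path V))
      fun t => shift (γ := γ) (t / ε) := by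
  have : SecondCountableTopology V := UniformSpace.secondCountable_of_separable V
  have : IsProbabilityMeasure P := hP.gaussian.isProbabilityMeasure
  have hemb : MeasurableEmbedding (Subtype.val : HolderPath V γ → C0Path V) :=
    MeasurableEmbedding.subtype_coe (measurableSet_isLocallyHolder γ)
  have hmap := hP.map_comap_val hH hγ0 hγ
  set P' := P.comap (Subtype.val : HolderPath V γ → C0Path V) with hP'
  have hmeas : ∀ t : ℝ, Measurable (shift (V := V) (γ := γ) t) := fun t =>
    measurable_shift.comp (measurable_const.prodMk measurable_id)
  refine ⟨⟨?_⟩, ?_, fun ω => ?_, fun s t ω => ?_, fun t => ⟨hmeas _, ?_⟩, fun A hA hinv => ?_⟩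
  · rw [← preimage_univ (f := (Subtype.val : HolderPath V γ → C0Path V)),
      ← hemb.map_apply, hmap, measure_univ]
  · exact measurable_shift.comp ((measurable_fst.div_const ε).prodMk measurable_snd)
  · rw [zero_div, shift_zero]
  · rw [add_div, shift_add]
  · refine (Measure.ext fun A hA => ?_)
    rw [Measure.map_apply (hmeas _) hA, ← hemb.injective.preimage_image A,
      ← hemb.map_apply, hmap, ← (hP.measurePreserving_shiftC0 (t / ε)).measure_preimage
        (hemb.measurableSet_image.2 hA).nullMeasurableSet]
    conv_rhs => rw [← hmap, hemb.map_apply]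
    rfl
  -- an invariant event of Hölder paths is an invariant event of the full path space
  · have hinv' : ∀ τ, shiftC0 τ ⁻¹' (Subtype.val '' A) = (Subtype.val '' A : Set (C0Path V)) := by
      intro τ
      have hτ : shift (γ := γ) τ ⁻¹' A = A := by
        have := hinv (τ * ε)
        rwa [mul_div_cancel_right₀ _ hε.ne'] at this
      ext ω
      simp only [mem_preimage, mem_image, Subtype.exists, exists_and_right, exists_eq_right,
        isLocallyHolder_shiftC0_iff]
      refine exists_congr fun hω => ?_
      nth_rw 2 [← hτ]
      rfl
    have h := hP.ergodic_shiftC0 hH1 (hemb.measurableSet_image.2 hA) hinv'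
    rwa [← hemb.comap_apply] at h

theorem isInvariantFull_hasHolderGrowth (hP : IsFBMLaw H Q P) (hH : 0 < H) (hγ0 : 0 < γ)
    (hγ : (γ : ℝ) < H) (ε : ℝ) :
    IsInvariantFull (P.comap (Subtype.val : HolderPath V γ → C0Path V))
      (fun t => shift (γ := γ) (t / ε)) {ω | HasHolderGrowth γ (ω.1.1 : ℝ → V)} := by
  have hemb : MeasurableEmbedding (Subtype.val : HolderPath V γ → C0Path V) :=
    MeasurableEmbedding.subtype_coe (measurableSet_isLocallyHolder γ)
  refine ⟨measurable_subtype_coe (measurableSet_hasHolderGrowth γ), fun t => ?_, ?_⟩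
  · ext ω
    exact hasHolderGrowth_shift_iff (t / ε) ω
  · rw [hemb.comap_apply]
    refine measure_mono_null ?_ (ae_iff.1 (hP.ae_hasHolderGrowth hH (NNReal.coe_pos.2 hγ0) hγ))
    rintro _ ⟨ω, hω, rfl⟩
    exact hω

end IsFBMLaw

end MetricDynamicalSystem

/-! ### Time change to the fast equation -/

section TimeChange

variable {V : Type*} [NormedAddCommGroup V] [InnerProductSpace ℝ V]
  {S A : ℝ → V →L[ℝ] V} {K : V →L[ℝ] V} {l C ε : ℝ} {γ : ℝ≥0}

theorem integral_rescaled_eq_conv (hε : ε ≠ 0) (h : ℝ → V) (t : ℝ) :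
    ∫ r in (0 : ℝ)..t, S ((t - r) / ε) (h (r / ε)) = ε • conv S h (t / ε) := by
  have := intervalIntegral.integral_comp_div (a := 0) (b := t)
    (fun s => S (t / ε - s) (h s)) hε
  rw [zero_div] at this
  simp only [sub_div]
  exact this

theorem SolvesInverse.congr {G : V → V} {ω : ℝ → V} {y : V} {Y Y' : ℝ → V}
    (h : SolvesInverse S K G ω y Y) (hYY' : ∀ t, 0 ≤ t → Y' t = Y t) :
    SolvesInverse S K G ω y Y' := by
  refine ⟨h.continuousOn.congr hYY', fun t ht => ?_⟩
  rw [hYY' t ht, h.eq t ht, IsSmoothingSemigroup.conv_congr (S := S) (h₁ := fun r => G (Y' r)) ht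
    fun r hr => by rw [hYY' r hr.1]]

/-- In the time variable `t / ε` the fast equation becomes the equation with `ε = 1`; the vector
`w = B ∫ S ω` is eliminated by applying `K = (-B)⁻¹`. -/
theorem isMildSolution_iff {B : V →ₗ.[ℝ] V} (hK : ∀ v w : V, (v, w) ∈ B.graph ↔ v = -K w)
    (hε : 0 < ε) {g : V → V → V} {x y : V} {ω Y : ℝ → V} :
    IsMildSolution B S g x ε ω y Y ↔
      SolvesInverse S K (g x) ω y fun s => Y (ε * s) := by
  have hg : ∀ t, ∫ r in (0 : ℝ)..t, S ((t - r) / ε) (g x (Y r)) =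
      ε • conv S (fun s => g x (Y (ε * s))) (t / ε) := fun t => by
    rw [← integral_rescaled_eq_conv hε.ne']
    simp only [mul_div_cancel₀ _ hε.ne']
  constructor
  · intro h
    refine ⟨h.continuousOn.comp (by fun_prop) fun s hs => mul_nonneg hε.le hs, fun s hs => ?_⟩
    obtain ⟨w, hw, hY⟩ := h.eq (ε * s) (by positivity)
    rw [integral_rescaled_eq_conv hε.ne', hK, mul_div_cancel_left₀ _ hε.ne'] at hw
    rw [hg, mul_div_cancel_left₀ _ hε.ne', inv_smul_smul₀ hε.ne'] at hY
    have hw' : ε⁻¹ • K w = -conv S ω s := by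
      rw [← inv_smul_smul₀ hε.ne' (conv S ω s), hw, smul_neg, neg_neg]
    rw [hY, ← add_assoc, map_add, map_smul, hw', ← sub_eq_add_neg]
  · intro h
    refine ⟨(h.continuousOn.comp (f := fun t => t / ε) (by fun_prop)
      fun t ht => div_nonneg ht hε.le).congr fun t _ => ?_, fun t ht => ?_⟩
    · simp only [Function.comp_apply, mul_div_cancel₀ _ hε.ne']
    · have hs := h.eq (t / ε) (by positivity)
      rw [mul_div_cancel₀ _ hε.ne'] at hs
      refine ⟨ε • (Y t - (S (t / ε) y + conv S (fun s => g x (Y (ε * s))) (t / ε) + ω (t / ε))),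
        ?_, ?_⟩
      · rw [hK, integral_rescaled_eq_conv hε.ne', map_smul, map_sub, hs, sub_sub_cancel_left,
          smul_neg, neg_neg]
      · rw [hg, inv_smul_smul₀ hε.ne', inv_smul_smul₀ hε.ne']
        abel

variable [CompleteSpace V]

theorem isGeneratedByFastEquation_flow (hS : IsSmoothingSemigroup S A K l) {B : V →ₗ.[ℝ] V}
    (hK : ∀ v w : V, (v, w) ∈ B.graph ↔ v = -K w) (hε : 0 < ε) (hγ : 0 < γ) (hC : 0 ≤ C)
    (hCl : C < l) {g : V → V → V} {x : V} (hG : ∀ u v, ‖g x u - g x v‖ ≤ C * ‖u - v‖) :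
    IsGeneratedByFastEquation (γ := γ) B S g x ε fun t ω y => flow S K (g x) (t / ε) ω y := by
  refine fun ω y => ⟨?_, fun Y hY t => ?_⟩
  · rw [isMildSolution_iff hK hε]
    refine (solvesInverse_flow hS hγ hC hCl hG ω y).congr fun t ht => ?_
    beta_reduce
    rw [Real.coe_toNNReal _ (by positivity), mul_div_cancel_left₀ _ hε.ne']
  · rw [isMildSolution_iff hK hε] at hY
    have h := flow_eq_of_solvesInverse hS hγ hC hCl hG hY (t := t / ε) (by positivity)
    rwa [mul_div_cancel₀ _ hε.ne'] at h

theorem isRDS_flow [TopologicalSpace.SeparableSpace V] [MeasurableSpace V] [BorelSpace V]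
    (hS : IsSmoothingSemigroup S A K l) (hε : 0 < ε) (hγ : 0 < γ) (hC : 0 ≤ C)
    (hCl : C < l) {G : V → V} (hG : ∀ u v, ‖G u - G v‖ ≤ C * ‖u - v‖) :
    IsRDS (fun t => shift (V := V) (γ := γ) (t / ε))
      fun t ω y => flow S K G (t / ε) ω y := by
  refine ⟨?_, fun ω y => ?_, fun t τ ω y => ?_⟩
  · have h1 : Measurable fun p : ℝ≥0 × HolderPath V γ × V => (p.1 / ε.toNNReal, p.2) :=
      (measurable_fst.div_const _).prodMk measurable_snd
    have h2 := (measurable_flow hS hγ hC hCl hG).comp h1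
    simpa only [Function.comp_def, NNReal.coe_div, Real.coe_toNNReal _ hε.le] using h2
  · rw [NNReal.coe_zero, zero_div, flow_zero hS hγ hC hCl hG]
  · rw [NNReal.coe_add, add_div, flow_add hS hγ hC hCl hG ω y (by positivity) (by positivity)]

/-! ### Temperedness and pullback attraction of the random fixed point -/

theorem temperedAt_pullbackLimit (hS : IsSmoothingSemigroup S A K l) (hε : 0 < ε) (hγ : 0 < γ)
    (hγ1 : γ ≤ 1) (hC : 0 ≤ C) (hCl : C < l) {G : V → V} (hG : ∀ u v, ‖G u - G v‖ ≤ C * ‖u - v‖)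
    {ω : HolderPath V γ} (hω : HasHolderGrowth γ ω.1.1) :
    TemperedAt (fun t => shift (γ := γ) (t / ε)) (fun ω' => ‖pullbackLimit S K G ω'‖) ω := by
  obtain ⟨-, D, hD⟩ := tendsto_pullbackLimit hS hγ hγ1 hC hCl hG hω
  have h : TemperedAt (shift (γ := γ)) (fun ω' => ‖pullbackLimit S K G ω'‖) ω :=
    ⟨tendsto_posLog_div_abs (fun t => norm_nonneg _) hD tendsto_abs_atTop_atTop,
      tendsto_posLog_div_abs (fun t => norm_nonneg _) hD tendsto_abs_atBot_atTop⟩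
  exact h.comp_div hε

end TimeChange

/-- Forward attraction started from `θ_{-t} ω` bounds the pullback distance by `e^{-ρt}` times the
distance of two points which are tempered along the orbit of `ω`; temperedness of the attracting
point is needed only for the rate `δ < ρ`. -/
theorem isPullbackAttracting_of_forward {Ω E : Type*} [NormedAddCommGroup E] {θ : ℝ → Ω → Ω}
    {φ : ℝ≥0 → Ω → E → E} {Y : Ω → E} {Ω₀ : Set Ω} {ρ : ℝ} (hθ0 : ∀ ω, θ 0 ω = ω)
    (hθ : ∀ s t ω, θ (s + t) ω = θ s (θ t ω)) (hinv : ∀ t, θ t ⁻¹' Ω₀ = Ω₀)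
    (hY : ∀ ω ∈ Ω₀, TemperedAt θ (fun ω' => ‖Y ω'‖) ω)
    (hfwd : IsForwardAttracting θ φ Y Ω₀ ρ) : IsPullbackAttracting θ φ Y Ω₀ ρ := by
  intro y ω hω
  have hb : ∀ t : ℝ≥0, ‖φ t (θ (-t) ω) (y (θ (-t) ω)) - Y ω‖ ≤
      Real.exp (-(ρ * t)) * ‖y (θ (-t) ω) - Y (θ (-t) ω)‖ := fun t => by
    have hmem : θ (-t) ω ∈ Ω₀ := by
      rw [← hinv (-t)] at hω
      exact hω
    have h := hfwd _ hmem (y (θ (-t) ω)) t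
    rwa [← hθ, add_neg_cancel, hθ0] at h
  refine ⟨hb, fun hy δ hδ => ?_⟩
  have hη : 0 < ρ - δ := sub_pos.2 hδ
  have h1 := tendsto_exp_neg_mul_of_posLog (f := fun t => ‖y (θ t ω)‖) (fun t => norm_nonneg _)
    hy.2 hη
  have h2 := tendsto_exp_neg_mul_of_posLog (f := fun t => ‖Y (θ t ω)‖) (fun t => norm_nonneg _)
    (hY ω hω).2 hη
  have h3 := (h1.add h2).comp (NNReal.tendsto_coe_atTop.2 tendsto_id)
  rw [add_zero] at h3
  refine squeeze_zero (fun t => by positivity) (fun t => ?_) h3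
  simp only [Function.comp_apply, id, ← mul_add]
  calc Real.exp (δ * t) * ‖φ t (θ (-t) ω) (y (θ (-t) ω)) - Y ω‖
      ≤ Real.exp (δ * t) * (Real.exp (-(ρ * t)) * ‖y (θ (-t) ω) - Y (θ (-t) ω)‖) := by
        gcongr
        exact hb t
    _ = Real.exp (-((ρ - δ) * t)) * ‖y (θ (-t) ω) - Y (θ (-t) ω)‖ := by
        rw [← mul_assoc, ← Real.exp_add]
        ring_nf
    _ ≤ _ := by
        gcongr
        exact norm_sub_le _ _

end

end FastRDS

end

theorem theorem4p3 {V : Type*} [NormedAddCommGroup V] [InnerProductSpace ℝ V] [CompleteSpace V]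
    [TopologicalSpace.SeparableSpace V] [MeasurableSpace V] [BorelSpace V]
    (B : V →ₗ.[ℝ] V) (hB : FastRDS.IsPositiveSymmetricWithCompactInverse (-B))
    (lamB : ℝ) (hlamB : ∀ μ : ℝ, FastRDS.IsEigenvalue (-B) μ → lamB ≤ μ)
    (g : V → V → V) (C₁ : ℝ) (hC₁ : 0 < C₁)
    (hg : ∀ x₁ x₂ y₁ y₂ : V, ‖g x₁ y₁ - g x₂ y₂‖ ≤ C₁ * (‖x₁ - x₂‖ + ‖y₁ - y₂‖))
    (hgap : C₁ < lamB)
    (H : ℝ) (hH₀ : 0 < H) (hH₁ : H < 1) (γ : ℝ≥0) (hγ₀ : 0 < γ) (hγ : (γ : ℝ) < H)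
    (Q : V →L[ℝ] V) (P : Measure (FastRDS.C0Path V)) (hP : FastRDS.IsFBMLaw H Q P) :
    ∃ S : ℝ → V →L[ℝ] V, FastRDS.IsSemigroupGeneratedBy S B ∧
      (∀ t : ℝ, 0 ≤ t → ‖S t‖ ≤ Real.exp (-(lamB * t))) ∧
      ∀ (x : V) (ε : ℝ), 0 < ε →
        let P' : Measure (FastRDS.HolderPath V γ) := P.comap Subtype.val
        let θ : ℝ → FastRDS.HolderPath V γ → FastRDS.HolderPath V γ :=
          fun t => FastRDS.shift (t / ε)
        FastRDS.IsErgodicMDS P' θ ∧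
        ∃ φ : ℝ≥0 → FastRDS.HolderPath V γ → V → V,
          FastRDS.IsRDS θ φ ∧
          FastRDS.IsGeneratedByFastEquation B S g x ε φ ∧
          ∃ Y : FastRDS.HolderPath V γ → V, Measurable Y ∧
            ∃ Ω₀ : Set (FastRDS.HolderPath V γ), FastRDS.IsInvariantFull P' θ Ω₀ ∧
              (∀ ω ∈ Ω₀, ∀ t : ℝ≥0, φ t ω (Y ω) = Y (θ t ω)) ∧
              (∀ ω ∈ Ω₀, FastRDS.TemperedAt θ (fun ω' => ‖Y ω'‖) ω) ∧
              FastRDS.IsForwardAttracting θ φ Y Ω₀ ((lamB - C₁) / ε) ∧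
              FastRDS.IsPullbackAttracting θ φ Y Ω₀ ((lamB - C₁) / ε) := by
  obtain ⟨S, A, K, hK, hgen, hS⟩ := FastRDS.exists_isSmoothingSemigroup hB hlamB
  refine ⟨S, hgen, fun t ht => hS.norm_le t ht, fun x ε hε => ?_⟩
  intro P' θ
  have hG : ∀ u v, ‖g x u - g x v‖ ≤ C₁ * ‖u - v‖ := fun u v => by simpa using hg x x u v
  have hγ1 : γ ≤ 1 := by exact_mod_cast (hγ.trans hH₁).le
  have hmds : FastRDS.IsErgodicMDS P' θ := hP.isErgodicMDS_shift hH₀ hH₁ hγ₀ hγ hε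
  have hfull := hP.isInvariantFull_hasHolderGrowth hH₀ hγ₀ hγ ε
  have hfix : ∀ ω ∈ {ω : FastRDS.HolderPath V γ | FastRDS.HasHolderGrowth γ ω.1.1}, ∀ t : ℝ≥0,
      FastRDS.flow S K (g x) (t / ε) ω (FastRDS.pullbackLimit S K (g x) ω) =
        FastRDS.pullbackLimit S K (g x) (θ t ω) := fun ω hω t =>
    FastRDS.flow_pullbackLimit hS hγ₀ hγ1 hC₁.le hgap hG hω (by positivity)
  have htemp : ∀ ω ∈ {ω : FastRDS.HolderPath V γ | FastRDS.HasHolderGrowth γ ω.1.1},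
      FastRDS.TemperedAt θ (fun ω' => ‖FastRDS.pullbackLimit S K (g x) ω'‖) ω := fun ω hω =>
    FastRDS.temperedAt_pullbackLimit hS hε hγ₀ hγ1 hC₁.le hgap hG hω
  have hfwd : FastRDS.IsForwardAttracting θ (fun t ω y => FastRDS.flow S K (g x) (t / ε) ω y)
      (FastRDS.pullbackLimit S K (g x)) {ω | FastRDS.HasHolderGrowth γ ω.1.1}
      ((lamB - C₁) / ε) := fun ω hω y t => by
    rw [← hfix ω hω t, div_mul_eq_mul_div, mul_div_assoc]
    exact FastRDS.norm_flow_sub_flow_le hS hγ₀ hC₁.le hgap hG ω y _ (by positivity)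
  exact ⟨hmds, _, FastRDS.isRDS_flow hS hε hγ₀ hC₁.le hgap hG,
    FastRDS.isGeneratedByFastEquation_flow hS hK hε hγ₀ hC₁.le hgap hG,
    FastRDS.pullbackLimit S K (g x), FastRDS.measurable_pullbackLimit hS hγ₀ hC₁.le hgap hG, _,
    hfull, hfix, htemp, hfwd,
    FastRDS.isPullbackAttracting_of_forward hmds.zero hmds.add hfull.invariant htemp hfwd⟩
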